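/- Let $P\subset\mathbb R^3$ be a simple $3$-polytope (a convex $3$-polytope each of whose vertices lies in exactly three facets). A belt of $P$ is a cyclic sequence of $k\ge 3$ distinct facets, considered up to rotation and reversal, such that two of them share an edge if and only if they follow each other in the sequence, and no three of them have a common vertex. The middle line $\gamma(\mathcal B)\subset\partial P$ of a belt $\mathcal B$ is the closed polygonal curve consisting, for each facet $F$ of $\mathcal B$, of the segment connecting the midpoints of the two edges along which $F$ meets the adjacent facets of $\mathcal B$. Two belts $\mathcal B_1,\mathcal B_2$ are compatible if $\gamma(\mathcal B_2)$ lies in the closure of a connected component of $\partial P\setminus\gamma(\mathcal B_1)$. A nested family of belts is a set of belts any two of which are compatible. A nested family of curves corresponding to a nested family of belts is a family of pairwise disjoint piecewise linear simple closed curves $\widetilde\gamma(\mathcal B)$, one for each belt $\mathcal B$ of the family, such that the segments of $\widetilde\gamma(\mathcal B)$ correspond bijectively to the facets of $\mathcal B$, and each segment connects two points in the relative interiors of the edges of intersection of the corresponding facet with the adjacent facets of $\mathcal B$. Then every nested family of belts of $P$ admits a nested family of curves. Moreover, any two nested families of curves $(\gamma_0(\mathcal B))_{\mathcal B}$ and $(\gamma_1(\mathcal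 B))_{\mathcal B}$ corresponding to the same nested family of belts are isotopic in the class of nested families of curves: there are continuous maps $H_{\mathcal B}\colon[0,1]\times S^1\to\mathbb R^3$, one for each belt $\mathcal B$ of the family, such that each $H_{\mathcal B}(t,\cdot)$ is injective, for each $t\in[0,1]$ the curves $H_{\mathcal B}(\{t\}\times S^1)$ form a nested family of curves corresponding to the given family of belts, and $H_{\mathcal B}(\{0\}\times S^1)=\gamma_0(\mathcal B)$, $H_{\mathcal B}(\{1\}\times S^1)=\gamma_1(\mathcal B)$ for every $\mathcal B$. -/

import Mathlib

/-- A geometric simple `3`-polytope in Euclidean space `ℝ³`, given by its irredundant system of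
linear inequalities `⟪normal i, x⟫ ≤ offset i`. It is bounded, three-dimensional, and each of its
vertices lies in exactly three facets. By irredundancy the sets cut out by the equalities
`⟪normal i, x⟫ = offset i` are precisely the facets, each listed once. -/
structure SimplePolytope3 where
  /-- the number of facets -/
  m : ℕ
  /-- outer normals of the facets -/
  normal : Fin m → EuclideanSpace ℝ (Fin 3)
  /-- right-hand sides of the inequalities -/
  offset : Fin m → ℝ
  bounded : Bornology.IsBounded
    {x : EuclideanSpace ℝ (Fin 3) | ∀ i, inner ℝ (normal i) x ≤ offset i}
  nonempty_interior : (interior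
    {x : EuclideanSpace ℝ (Fin 3) | ∀ i, inner ℝ (normal i) x ≤ offset i}).Nonempty
  irredundant : ∀ i, ∃ x : EuclideanSpace ℝ (Fin 3),
    (∀ j, j ≠ i → inner ℝ (normal j) x ≤ offset j) ∧ offset i < inner ℝ (normal i) x
  simple : ∀ v ∈ Set.extremePoints ℝ
      {x : EuclideanSpace ℝ (Fin 3) | ∀ i, inner ℝ (normal i) x ≤ offset i},
    {i | inner ℝ (normal i) v = offset i}.ncard = 3

namespace SimplePolytope3

/-- The polytope as a set of points. -/
def body (P : SimplePolytope3) : Set (EuclideanSpace ℝ (Fin 3)) :=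
  {x | ∀ i, inner ℝ (P.normal i) x ≤ P.offset i}

/-- The facet with index `i`. -/
def facet (P : SimplePolytope3) (i : Fin P.m) : Set (EuclideanSpace ℝ (Fin 3)) :=
  {x | x ∈ P.body ∧ inner ℝ (P.normal i) x = P.offset i}

/-- Two facets are adjacent if they are distinct and share an edge. The intersection of two
distinct facets is a face of dimension at most one, so it is an edge exactly when it has more than
one point. -/
def Adj (P : SimplePolytope3) (i j : Fin P.m) : Prop :=
  i ≠ j ∧ (P.facet i ∩ P.facet j).Nontrivial

/-- A set of facets is a belt if it can be arranged in a cyclic sequence of `k ≥ 3` distinct facets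
such that two of them are adjacent if and only if they follow each other, and no three of them have
a common point (equivalently, a common vertex). As a cyclic sequence, up to rotation and reversal,
a belt is determined by its set of facets through the adjacency relation. -/
def IsBelt (P : SimplePolytope3) (B : Finset (Fin P.m)) : Prop :=
  ∃ k : ℕ, 3 ≤ k ∧ ∃ c : ZMod k → Fin P.m,
    Function.Injective c ∧ Set.range c = (B : Set (Fin P.m)) ∧
    (∀ s t, P.Adj (c s) (c t) ↔ t = s + 1 ∨ s = t + 1) ∧
    ∀ r s t, r ≠ s → s ≠ t → r ≠ t →
      P.facet (c r) ∩ P.facet (c s) ∩ P.facet (c t) = ∅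

/-- The midpoint of the edge `F_i ∩ F_j` (of interest only for adjacent facets). -/
noncomputable def edgeMid (P : SimplePolytope3) (i j : Fin P.m) : EuclideanSpace ℝ (Fin 3) :=
  Classical.epsilon fun x =>
    ∃ u v, P.facet i ∩ P.facet j = segment ℝ u v ∧ x = midpoint ℝ u v

/-- The closed polygonal line through a belt `B` with vertices `p i j` on the edges of intersection
`F_i ∩ F_j` of adjacent facets of `B`. In each facet `F_i` of the belt it has one segment, which
joins the points on the edges of intersection of `F_i` with its two adjacent facets `F_j`, `F_l` of
the belt. -/
def beltPolygon (P : SimplePolytope3) (B : Finset (Fin P.m))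
    (p : Fin P.m → Fin P.m → EuclideanSpace ℝ (Fin 3)) : Set (EuclideanSpace ℝ (Fin 3)) :=
  {x | ∃ i ∈ B, ∃ j ∈ B, ∃ l ∈ B, j ≠ l ∧ P.Adj i j ∧ P.Adj i l ∧ x ∈ segment ℝ (p i j) (p i l)}

/-- The middle line `γ(B)` of a belt. -/
noncomputable def middleLine (P : SimplePolytope3) (B : Finset (Fin P.m)) :
    Set (EuclideanSpace ℝ (Fin 3)) :=
  P.beltPolygon B P.edgeMid

/-- Two belts are compatible if the middle line of the second lies in the closure of a connected
component of the complement of the middle line of the first in the boundary `∂P`. -/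
def Compatible (P : SimplePolytope3) (B₁ B₂ : Finset (Fin P.m)) : Prop :=
  ∃ x ∈ frontier P.body \ P.middleLine B₁,
    P.middleLine B₂ ⊆ closure (connectedComponentIn (frontier P.body \ P.middleLine B₁) x)

/-- A nested family of belts: any two of them are compatible. -/
def IsNestedFamily (P : SimplePolytope3) (𝓑 : Set (Finset (Fin P.m))) : Prop :=
  (∀ B ∈ 𝓑, P.IsBelt B) ∧ 𝓑.Pairwise P.Compatible

/-- `C` is a simple closed curve: a homeomorphic (continuous injective) image of a circle. -/
def IsSimpleClosedCurve (C : Set (EuclideanSpace ℝ (Fin 3))) : Prop :=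
  ∃ f : UnitAddCircle → EuclideanSpace ℝ (Fin 3),
    Continuous f ∧ Function.Injective f ∧ Set.range f = C

/-- `C` is a piecewise linear simple closed curve whose segments correspond to the facets of `B`,
each segment joining two points in the relative interiors of the edges of intersection of the
corresponding facet with the adjacent facets of the belt. -/
def IsBeltCurve (P : SimplePolytope3) (B : Finset (Fin P.m))
    (C : Set (EuclideanSpace ℝ (Fin 3))) : Prop :=
  IsSimpleClosedCurve C ∧
  ∃ p : Fin P.m → Fin P.m → EuclideanSpace ℝ (Fin 3),
    (∀ i j, p i j = p j i) ∧
    (∀ i ∈ B, ∀ j ∈ B, P.Adj i j → p i j ∈ intrinsicInterior ℝ (P.facet i ∩ P.facet j)) ∧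
    C = P.beltPolygon B p

/-- A nested family of curves corresponding to the family of belts `𝓑`
(only the values `Γ B` for `B ∈ 𝓑` matter). -/
def IsNestedCurves (P : SimplePolytope3) (𝓑 : Set (Finset (Fin P.m)))
    (Γ : Finset (Fin P.m) → Set (EuclideanSpace ℝ (Fin 3))) : Prop :=
  (∀ B ∈ 𝓑, P.IsBeltCurve B (Γ B)) ∧ 𝓑.Pairwise fun B₁ B₂ => Disjoint (Γ B₁) (Γ B₂)

/-- Two families of curves corresponding to `𝓑` are isotopic in the class of nested families of
curves: there are isotopies of embedded circles `H B`, one for each belt, that carry `Γ B` to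
`Γ' B` and such that at each moment the curves form a nested family of curves corresponding
to `𝓑`. -/
def IsotopicInClass (P : SimplePolytope3) (𝓑 : Set (Finset (Fin P.m)))
    (Γ Γ' : Finset (Fin P.m) → Set (EuclideanSpace ℝ (Fin 3))) : Prop :=
  ∃ H : Finset (Fin P.m) → unitInterval → UnitAddCircle → EuclideanSpace ℝ (Fin 3),
    (∀ B ∈ 𝓑, Continuous fun q : unitInterval × UnitAddCircle => H B q.1 q.2) ∧
    (∀ B ∈ 𝓑, ∀ t, Function.Injective (H B t)) ∧
    (∀ t, P.IsNestedCurves 𝓑 fun B => Set.range (H B t)) ∧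
    ∀ B ∈ 𝓑, Set.range (H B 0) = Γ B ∧ Set.range (H B 1) = Γ' B

end SimplePolytope3

/-!
A curve of a belt is given by one point in the relative interior of every edge that the belt
crosses, and consists of chords of the facets of the belt. Whether two such curves are disjoint can
be decided facet by facet: in every common facet the two ends of the second chord have to lie
strictly on one side of the first chord (`disjoint_beltPolygon_iff`). In this form everything
depends only on the order in which the curves cross their common edges.

*Uniqueness.* If two different belts cross a common edge, follow them until they diverge
(`not_of_parallel`). In the facet where they diverge, the order of the two disjoint curves on the
edge of entry is determined by the cyclic order of three edges of a convex polygon, and along the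
common run the order on one edge determines the order on the next one. So the order does not depend
on the curves (`sign_along_eq_of_disjoint`). Hence the linear motion of the vertices from one family
of curves to the other never makes two vertices collide. A point on the boundary of a facet lies on
the line of a chord only if it is an end of that chord, so the sides on which the ends of the chords
lie cannot change during the motion, and the curves stay disjoint (`disjoint_lineMap`).

*Existence.* By a version of the Jordan curve theorem the middle line of a belt separates the
boundary of the polytope, and its two sides in every facet of the belt belong to different parts
(`IsBelt.exists_separation`). This is proved by projecting the boundary to a plane from a point `N`
in a facet outside the belt: the winding number of the projected polygon around the projected point
is locally constant off the polygon and jumps by one across it, so its parity distinguishes the two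
sides. A compatible belt therefore lies on a definite side of the first one, and this prescribes an
order of the two belts on each of their common edges (`exists_isSideRelation`). Following the belts
until they diverge shows that these orders are antisymmetric and have no cycles of length three, so
they are linear orders on the belts crossing an edge. Placing the vertices on every edge in this
order gives disjoint curves.
-/

/-! ### Determinants in `ℝ³` -/

/-- Euclidean space `ℝ³`. -/
abbrev E3 := EuclideanSpace ℝ (Fin 3)

/-- The determinant of three vectors of `ℝ³`, in coordinates. -/
def det3 (a b c : E3) : ℝ :=
  a 0 * (b 1 * c 2 - b 2 * c 1) - a 1 * (b 0 * c 2 - b 2 * c 0) + a 2 * (b 0 * c 1 - b 1 * c 0)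

lemma inner_eq_coords (x y : E3) : inner ℝ x y = x 0 * y 0 + x 1 * y 1 + x 2 * y 2 := by
  simp only [PiLp.inner_apply, Fin.sum_univ_three]
  simp [mul_comm]

@[fun_prop]
lemma continuous_det3 {X : Type*} [TopologicalSpace X] {a b c : X → E3} (ha : Continuous a)
    (hb : Continuous b) (hc : Continuous c) : Continuous fun x => det3 (a x) (b x) (c x) := by
  unfold det3
  fun_prop

lemma ext_coords {x y : E3} (h0 : x 0 = y 0) (h1 : x 1 = y 1) (h2 : x 2 = y 2) : x = y := by
  ext i
  fin_cases i
  · exact h0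
  · exact h1
  · exact h2

lemma eq_zero_of_det3_ne_zero {a b c d : E3} (h : det3 a b c ≠ 0) (ha : inner ℝ a d = 0)
    (hb : inner ℝ b d = 0) (hc : inner ℝ c d = 0) : d = 0 := by
  rw [inner_eq_coords] at ha hb hc
  -- Cramer's rule
  have h0 : det3 a b c * d 0 = 0 := by
    unfold det3
    linear_combination (b 1 * c 2 - b 2 * c 1) * ha + (c 1 * a 2 - c 2 * a 1) * hb
      + (a 1 * b 2 - a 2 * b 1) * hc
  have h1 : det3 a b c * d 1 = 0 := by
    unfold det3
    linear_combination (b 2 * c 0 - b 0 * c 2) * ha + (c 2 * a 0 - c 0 * a 2) * hb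
      + (a 2 * b 0 - a 0 * b 2) * hc
  have h2 : det3 a b c * d 2 = 0 := by
    unfold det3
    linear_combination (b 0 * c 1 - b 1 * c 0) * ha + (c 0 * a 1 - c 1 * a 0) * hb
      + (a 0 * b 1 - a 1 * b 0) * hc
  apply ext_coords
  · simpa [h] using h0
  · simpa [h] using h1
  · simpa [h] using h2

lemma exists_ne_zero_of_det3_eq_zero {a b c : E3} (h : det3 a b c = 0) :
    ∃ d : E3, d ≠ 0 ∧ inner ℝ a d = 0 ∧ inner ℝ b d = 0 ∧ inner ℝ c d = 0 := by
  have hdet : (!![a 0, a 1, a 2; b 0, b 1, b 2; c 0, c 1, c 2] : Matrix (Fin 3) (Fin 3) ℝ).det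
      = 0 := by
    rw [Matrix.det_fin_three]
    simp only [Matrix.of_apply, Matrix.cons_val', Matrix.cons_val_zero, Matrix.cons_val_one,
      Matrix.cons_val_fin_one, Matrix.cons_val]
    rw [← h]
    unfold det3
    ring
  obtain ⟨v, hv, hM⟩ := Matrix.exists_mulVec_eq_zero_iff.2 hdet
  refine ⟨WithLp.toLp 2 v, ?_, ?_, ?_, ?_⟩
  · intro h0
    apply hv
    simpa using h0
  · have := congrFun hM 0
    simpa [Matrix.mulVec, dotProduct, Fin.sum_univ_three, inner_eq_coords] using this
  · have := congrFun hM 1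
    simpa [Matrix.mulVec, dotProduct, Fin.sum_univ_three, inner_eq_coords] using this
  · have := congrFun hM 2
    simpa [Matrix.mulVec, dotProduct, Fin.sum_univ_three, inner_eq_coords] using this

namespace SimplePolytope3

variable {P : SimplePolytope3}

/-! ### Faces of a simple polytope -/

lemma isClosed_body : IsClosed P.body := by
  have : P.body = ⋂ i, {x | inner ℝ (P.normal i) x ≤ P.offset i} := by
    ext x; simp [body]
  rw [this]
  exact isClosed_iInter fun i => isClosed_le (by fun_prop) (by fun_prop)

lemma isCompact_body : IsCompact P.body :=
  Metric.isCompact_of_isClosed_isBounded isClosed_body P.bounded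

lemma mem_body_of_mem_segment {x y z : E3} (hx : x ∈ P.body) (hy : y ∈ P.body)
    (hz : z ∈ segment ℝ x y) : z ∈ P.body := by
  obtain ⟨a, b, ha, hb, hab, rfl⟩ := hz
  intro i
  rw [inner_add_right, inner_smul_right, inner_smul_right]
  have hs : a * P.offset i + b * P.offset i = P.offset i := by rw [← add_mul, hab, one_mul]
  linarith [mul_le_mul_of_nonneg_left (hx i) ha, mul_le_mul_of_nonneg_left (hy i) hb]

lemma tight_of_tight_combination {x y : E3} (hx : x ∈ P.body) (hy : y ∈ P.body) {a b : ℝ}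
    (ha : 0 < a) (hb : 0 < b) (hab : a + b = 1) {i : Fin P.m}
    (h : inner ℝ (P.normal i) (a • x + b • y) = P.offset i) :
    inner ℝ (P.normal i) x = P.offset i ∧ inner ℝ (P.normal i) y = P.offset i := by
  rw [inner_add_right, inner_smul_right, inner_smul_right] at h
  have h1 := hx i
  have h2 := hy i
  obtain rfl : b = 1 - a := by linarith
  constructor <;> nlinarith

lemma normal_ne_zero (i : Fin P.m) : P.normal i ≠ 0 := by
  intro h
  obtain ⟨x, hx⟩ := P.nonempty_interior
  obtain ⟨y, -, hy⟩ := P.irredundant i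
  have := interior_subset hx i
  rw [h, inner_zero_left] at this hy
  linarith

lemma mem_interior_body {x : E3} (hx : ∀ i, inner ℝ (P.normal i) x < P.offset i) :
    x ∈ interior P.body := by
  refine mem_interior.2 ⟨⋂ i, {x | inner ℝ (P.normal i) x < P.offset i}, ?_, ?_, ?_⟩
  · intro y hy i
    exact (Set.mem_iInter.1 hy i).le
  · exact isOpen_iInter_of_finite fun i => isOpen_lt (by fun_prop) (by fun_prop)
  · exact Set.mem_iInter.2 hx

lemma lt_of_mem_interior_body {x : E3} (hx : x ∈ interior P.body) (i : Fin P.m) :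
    inner ℝ (P.normal i) x < P.offset i := by
  have hcont : Filter.Tendsto (fun t : ℝ => x + t • P.normal i) (nhds 0) (nhds x) := by
    have : Continuous fun t : ℝ => x + t • P.normal i := by fun_prop
    simpa using this.tendsto 0
  have h1 := hcont.eventually (isOpen_interior.mem_nhds hx)
  have h2 : ∀ᶠ t in nhdsWithin (0 : ℝ) (Set.Ioi 0), x + t • P.normal i ∈ interior P.body :=
    h1.filter_mono nhdsWithin_le_nhds
  obtain ⟨t, ht, ht0⟩ := (h2.and self_mem_nhdsWithin).exists
  have ht0 : 0 < t := ht0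
  have := interior_subset ht i
  rw [inner_add_right, inner_smul_right] at this
  have hn : 0 < inner ℝ (P.normal i) (P.normal i) := real_inner_self_pos.2 (normal_ne_zero i)
  nlinarith [mul_pos ht0 hn]

lemma mem_frontier_body {x : E3} :
    x ∈ frontier P.body ↔ x ∈ P.body ∧ ∃ i, inner ℝ (P.normal i) x = P.offset i := by
  rw [isClosed_body.frontier_eq]
  refine ⟨fun h => ⟨h.1, ?_⟩, fun h => ⟨h.1, fun hi => ?_⟩⟩
  · by_contra! hne
    exact h.2 (mem_interior_body fun i => lt_of_le_of_ne (h.1 i) (hne i))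
  · obtain ⟨i, hi'⟩ := h.2
    exact (lt_of_mem_interior_body hi i).ne hi'

lemma facet_subset_frontier (i : Fin P.m) : P.facet i ⊆ frontier P.body :=
  fun _ hx => mem_frontier_body.2 ⟨hx.1, i, hx.2⟩

lemma mem_facet_of_mem_segment {i : Fin P.m} {x y z : E3} (hx : x ∈ P.facet i)
    (hy : y ∈ P.facet i) (hz : z ∈ segment ℝ x y) : z ∈ P.facet i := by
  refine ⟨mem_body_of_mem_segment hx.1 hy.1 hz, ?_⟩
  obtain ⟨a, b, ha, hb, hab, rfl⟩ := hz
  rw [inner_add_right, inner_smul_right, inner_smul_right, hx.2, hy.2, ← add_mul, hab, one_mul]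

/-- Every facet has a point that lies in no other facet. -/
lemma exists_mem_facet_relint (i : Fin P.m) :
    ∃ x, inner ℝ (P.normal i) x = P.offset i ∧
      ∀ j, j ≠ i → inner ℝ (P.normal j) x < P.offset j := by
  obtain ⟨y, hy⟩ := P.nonempty_interior
  have hy := lt_of_mem_interior_body hy
  obtain ⟨x, hx, hxi⟩ := P.irredundant i
  -- the point where the segment from an interior point to `x` crosses the hyperplane of `i`
  set α := inner ℝ (P.normal i) x - P.offset i with hα
  set β := P.offset i - inner ℝ (P.normal i) y with hβ
  have hα0 : 0 < α := by linarith
  have hβ0 : 0 < β := by linarith [hy i]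
  have hs : α + β ≠ 0 := by positivity
  refine ⟨(α / (α + β)) • y + (β / (α + β)) • x, ?_, ?_⟩
  · rw [inner_add_right, inner_smul_right, inner_smul_right]
    field_simp
    have e1 : inner ℝ (P.normal i) x = P.offset i + α := by rw [hα]; ring
    have e2 : inner ℝ (P.normal i) y = P.offset i - β := by rw [hβ]; ring
    rw [e1, e2]
    ring
  · intro j hj
    rw [inner_add_right, inner_smul_right, inner_smul_right]
    have h1 := mul_lt_mul_of_pos_left (hy j) (show 0 < α / (α + β) by positivity)
    have h2 := mul_le_mul_of_nonneg_left (hx j hj) (show 0 ≤ β / (α + β) by positivity)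
    have h3 : α / (α + β) * P.offset j + β / (α + β) * P.offset j = P.offset j := by
      field_simp
    linarith

/-- Every face of the polytope has a vertex. -/
lemma exists_vertex {x : E3} (hx : x ∈ P.body) :
    ∃ v ∈ Set.extremePoints ℝ P.body,
      ∀ i, inner ℝ (P.normal i) x = P.offset i → inner ℝ (P.normal i) v = P.offset i := by
  set F : Set E3 := {z | z ∈ P.body ∧ ∀ i, inner ℝ (P.normal i) x = P.offset i →
    inner ℝ (P.normal i) z = P.offset i} with hF
  have hFe : IsExtreme ℝ P.body F := by
    refine ⟨fun z hz => hz.1, ?_⟩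
    intro y hy z hz w hw hwo
    refine ⟨hy, fun i hi => ?_⟩
    obtain ⟨a, b, ha, hb, hab, rfl⟩ := hwo
    exact (tight_of_tight_combination hy hz ha hb hab (hw.2 i hi)).1
  have hFc : IsClosed F := by
    have : F = P.body ∩ ⋂ i, ⋂ (_ : inner ℝ (P.normal i) x = P.offset i),
        {z | inner ℝ (P.normal i) z = P.offset i} := by
      ext z; simp [hF]
    rw [this]
    exact isClosed_body.inter (isClosed_iInter fun i => isClosed_iInter fun _ =>
      isClosed_eq (by fun_prop) (by fun_prop))
  have hFk : IsCompact F := isCompact_body.of_isClosed_subset hFc fun z hz => hz.1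
  obtain ⟨v, hv⟩ := hFk.extremePoints_nonempty ⟨x, hx, fun i hi => hi⟩
  exact ⟨v, hFe.extremePoints_subset_extremePoints hv, hv.1.2⟩

/-- At a vertex no direction is orthogonal to the normals of all facets through it. -/
lemma eq_zero_of_vertex {v d : E3} (hv : v ∈ Set.extremePoints ℝ P.body)
    (hd : ∀ i, inner ℝ (P.normal i) v = P.offset i → inner ℝ (P.normal i) d = 0) : d = 0 := by
  -- otherwise a short segment around `v` in the direction `d` stays in the body
  have key : ∀ e : E3, (∀ i, inner ℝ (P.normal i) v = P.offset i → inner ℝ (P.normal i) e = 0) →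
      ∀ᶠ t in nhdsWithin (0 : ℝ) (Set.Ioi 0), v + t • e ∈ P.body := by
    intro e he
    refine Filter.Eventually.filter_mono nhdsWithin_le_nhds ?_
    have : ∀ i, ∀ᶠ t in nhds (0 : ℝ), inner ℝ (P.normal i) (v + t • e) ≤ P.offset i := by
      intro i
      rcases (hv.1 i).eq_or_lt with h | h
      · refine Filter.Eventually.of_forall fun t => ?_
        rw [inner_add_right, inner_smul_right, he i h, h]; simp
      · have hc : Continuous fun t : ℝ => inner ℝ (P.normal i) (v + t • e) := by fun_prop
        have := hc.tendsto 0
        simp only [zero_smul, add_zero] at this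
        exact (this.eventually (gt_mem_nhds h)).mono fun t ht => le_of_lt ht
    exact (Filter.eventually_all.2 this).mono fun t ht i => ht i
  have hd' : ∀ i, inner ℝ (P.normal i) v = P.offset i → inner ℝ (P.normal i) (-d) = 0 := by
    intro i hi
    rw [inner_neg_right, hd i hi, neg_zero]
  obtain ⟨t, ⟨h1, h2⟩, ht⟩ := (((key d hd).and (key (-d) hd')).and self_mem_nhdsWithin).exists
  have ht : 0 < t := ht
  have hmem : v ∈ openSegment ℝ (v + t • d) (v + t • (-d)) :=
    ⟨1 / 2, 1 / 2, by norm_num, by norm_num, by norm_num, by module⟩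
  have := hv.2 h1 h2 hmem
  have h0 : t • d = 0 := by simpa using this
  exact (smul_eq_zero.1 h0).resolve_left ht.ne'

/-- Three distinct facets with a common point have linearly independent normals, and they are all
the facets through that point. -/
lemma three_tight {x : E3} (hx : x ∈ P.body) {i j l : Fin P.m} (hij : i ≠ j) (hil : i ≠ l)
    (hjl : j ≠ l) (hi : inner ℝ (P.normal i) x = P.offset i)
    (hj : inner ℝ (P.normal j) x = P.offset j) (hl : inner ℝ (P.normal l) x = P.offset l) :
    det3 (P.normal i) (P.normal j) (P.normal l) ≠ 0 ∧
      ∀ r, inner ℝ (P.normal r) x = P.offset r → r = i ∨ r = j ∨ r = l := by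
  obtain ⟨v, hv, hvt⟩ := exists_vertex hx
  have hcard := P.simple v hv
  have hsub : ({i, j, l} : Set (Fin P.m)) ⊆ {r | inner ℝ (P.normal r) v = P.offset r} := by
    rintro r (rfl | rfl | rfl)
    · exact hvt _ hi
    · exact hvt _ hj
    · exact hvt _ hl
  have hc3 : ({i, j, l} : Set (Fin P.m)).ncard = 3 :=
    Set.ncard_eq_three.2 ⟨i, j, l, hij, hil, hjl, rfl⟩
  have heq := Set.eq_of_subset_of_ncard_le hsub (by rw [hcard, hc3]) (Set.toFinite _)
  refine ⟨fun h0 => ?_, fun r hr => ?_⟩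
  · obtain ⟨d, hd0, hdi, hdj, hdl⟩ := exists_ne_zero_of_det3_eq_zero h0
    refine hd0 (eq_zero_of_vertex hv fun r hr => ?_)
    have : r ∈ ({i, j, l} : Set (Fin P.m)) := heq ▸ hr
    rcases this with rfl | rfl | rfl <;> assumption
  · have : r ∈ ({i, j, l} : Set (Fin P.m)) := heq ▸ hvt r hr
    simpa using this

/-- If two facets meet, then they meet in a vertex, which lies on a third facet. -/
lemma exists_third_facet {x : E3} (hx : x ∈ P.body) {i j : Fin P.m} (hij : i ≠ j)
    (hi : inner ℝ (P.normal i) x = P.offset i) (hj : inner ℝ (P.normal j) x = P.offset j) :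
    ∃ v ∈ P.body, ∃ l, i ≠ l ∧ j ≠ l ∧ inner ℝ (P.normal i) v = P.offset i ∧
      inner ℝ (P.normal j) v = P.offset j ∧ inner ℝ (P.normal l) v = P.offset l := by
  obtain ⟨v, hv, hvt⟩ := exists_vertex hx
  have hcard := P.simple v hv
  obtain ⟨l, hl, hl'⟩ : ∃ l ∈ {r | inner ℝ (P.normal r) v = P.offset r},
      l ∉ ({i, j} : Set (Fin P.m)) := by
    refine Set.exists_mem_notMem_of_ncard_lt_ncard ?_ (Set.toFinite _)
    rw [hcard, Set.ncard_pair hij]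
    norm_num
  simp only [Set.mem_insert_iff, Set.mem_singleton_iff, not_or] at hl'
  exact ⟨v, hv.1, l, fun h => hl'.1 h.symm, fun h => hl'.2 h.symm, hvt i hi, hvt j hj, hl⟩

/-! ### Edges -/

/-- The relative interior of the edge `F_i ∩ F_j`, described by its incidences: the points of the
polytope that lie in the facets `F_i`, `F_j` and in no other one. -/
def openEdge (P : SimplePolytope3) (i j : Fin P.m) : Set E3 :=
  {x | x ∈ P.body ∧ ∀ r, inner ℝ (P.normal r) x = P.offset r ↔ r = i ∨ r = j}

lemma openEdge_comm (i j : Fin P.m) : P.openEdge i j = P.openEdge j i := by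
  simp only [openEdge, or_comm]

lemma Adj.symm {i j : Fin P.m} (h : P.Adj i j) : P.Adj j i :=
  ⟨h.1.symm, Set.inter_comm _ _ ▸ h.2⟩

lemma mem_facet_left {i j : Fin P.m} {x : E3} (h : x ∈ P.openEdge i j) : x ∈ P.facet i :=
  ⟨h.1, (h.2 i).2 (Or.inl rfl)⟩

lemma mem_facet_right {i j : Fin P.m} {x : E3} (h : x ∈ P.openEdge i j) : x ∈ P.facet j :=
  ⟨h.1, (h.2 j).2 (Or.inr rfl)⟩

/-- No third facet contains two points of an edge. -/
lemma eq_of_mem_three_facets {i j r : Fin P.m} (hij : i ≠ j) (hri : r ≠ i) (hrj : r ≠ j) {x y : E3}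
    (hxi : x ∈ P.facet i) (hxj : x ∈ P.facet j) (hxr : x ∈ P.facet r)
    (hyi : y ∈ P.facet i) (hyj : y ∈ P.facet j) (hyr : y ∈ P.facet r) : x = y := by
  have h := (three_tight hxi.1 hij hri.symm hrj.symm hxi.2 hxj.2 hxr.2).1
  have := eq_zero_of_det3_ne_zero (d := x - y) h
    (by rw [inner_sub_right, hxi.2, hyi.2, sub_self])
    (by rw [inner_sub_right, hxj.2, hyj.2, sub_self])
    (by rw [inner_sub_right, hxr.2, hyr.2, sub_self])
  exact sub_eq_zero.1 this

lemma combination_mem_openEdge {i j : Fin P.m} (hij : i ≠ j) {x y : E3} (hne : x ≠ y)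
    (hxi : x ∈ P.facet i) (hxj : x ∈ P.facet j) (hyi : y ∈ P.facet i) (hyj : y ∈ P.facet j)
    {a b : ℝ} (ha : 0 < a) (hb : 0 < b) (hab : a + b = 1) : a • x + b • y ∈ P.openEdge i j := by
  have hseg : a • x + b • y ∈ segment ℝ x y := ⟨a, b, ha.le, hb.le, hab, rfl⟩
  refine ⟨mem_body_of_mem_segment hxi.1 hyi.1 hseg, fun r => ⟨fun hr => ?_, ?_⟩⟩
  · by_contra! hcon
    obtain ⟨h1, h2⟩ := tight_of_tight_combination hxi.1 hyi.1 ha hb hab hr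
    exact hne (eq_of_mem_three_facets hij hcon.1 hcon.2 hxi hxj ⟨hxi.1, h1⟩ hyi hyj ⟨hyi.1, h2⟩)
  · rintro (rfl | rfl)
    · exact (mem_facet_of_mem_segment hxi hyi hseg).2
    · exact (mem_facet_of_mem_segment hxj hyj hseg).2

lemma Adj.openEdge_nonempty {i j : Fin P.m} (h : P.Adj i j) : (P.openEdge i j).Nonempty := by
  obtain ⟨hij, x, hx, y, hy, hne⟩ := h
  exact ⟨_, combination_mem_openEdge hij hne hx.1 hx.2 hy.1 hy.2 (a := 1 / 2) (b := 1 / 2)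
    (by norm_num) (by norm_num) (by norm_num)⟩

lemma openEdge_convex {i j : Fin P.m} : Convex ℝ (P.openEdge i j) := by
  intro x hx y hy a b ha hb hab
  have hseg : a • x + b • y ∈ segment ℝ x y := ⟨a, b, ha, hb, hab, rfl⟩
  refine ⟨mem_body_of_mem_segment hx.1 hy.1 hseg, fun r => ⟨fun hr => ?_, ?_⟩⟩
  · rcases ha.eq_or_lt with rfl | ha
    · obtain rfl : b = 1 := by linarith
      simpa [hy.2] using hr
    rcases hb.eq_or_lt with rfl | hb
    · obtain rfl : a = 1 := by linarith
      simpa [hx.2] using hr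
    exact (hx.2 r).1 (tight_of_tight_combination hx.1 hy.1 ha hb hab hr).1
  · rintro (rfl | rfl)
    · exact (mem_facet_of_mem_segment (mem_facet_left hx) (mem_facet_left hy) hseg).2
    · exact (mem_facet_of_mem_segment (mem_facet_right hx) (mem_facet_right hy) hseg).2

lemma intrinsicInterior_eq_openEdge {i j : Fin P.m} (h : P.Adj i j) :
    intrinsicInterior ℝ (P.facet i ∩ P.facet j) = P.openEdge i j := by
  apply Set.Subset.antisymm
  · intro x hx
    have hxE := intrinsicInterior_subset hx
    refine ⟨hxE.1.1, fun r => ⟨fun hr => ?_, ?_⟩⟩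
    · by_contra! hcon
      obtain ⟨y, hy, hyx⟩ := h.2.exists_ne x
      obtain ⟨x', hx', rfl⟩ := mem_intrinsicInterior.1 hx
      have hline : ∀ t : ℝ, AffineMap.lineMap (x' : E3) y t ∈
          affineSpan ℝ (P.facet i ∩ P.facet j) := fun t =>
        AffineMap.lineMap_mem t (subset_affineSpan ℝ _ hxE) (subset_affineSpan ℝ _ hy)
      -- beyond `x` on the line from `y` through `x` there are further points of the edge
      have hcont : Continuous fun t : ℝ =>
          (⟨AffineMap.lineMap (x' : E3) y t, hline t⟩ : affineSpan ℝ (P.facet i ∩ P.facet j)) :=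
        Continuous.subtype_mk (AffineMap.lineMap_continuous) _
      have hev : ∀ᶠ t in nhds (0 : ℝ), AffineMap.lineMap (x' : E3) y t ∈ P.facet i ∩ P.facet j := by
        have h0 : (⟨AffineMap.lineMap (x' : E3) y (0 : ℝ), hline 0⟩ :
            affineSpan ℝ (P.facet i ∩ P.facet j)) = x' := by
          apply Subtype.ext; simp
        have := hcont.tendsto 0
        rw [h0] at this
        exact (this.eventually (isOpen_interior.mem_nhds hx')).mono fun t ht => by
          have := interior_subset ht
          exact this
      obtain ⟨t, ht, ht0⟩ :=
        ((hev.filter_mono (nhdsWithin_le_nhds (s := Set.Iio 0))).and self_mem_nhdsWithin).exists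
      have ht0 : t < 0 := ht0
      have h1 := ht.1.1 r
      rw [AffineMap.lineMap_apply_module, inner_add_right, inner_smul_right, inner_smul_right,
        hr] at h1
      have h2 := hy.1.1 r
      have h3 : inner ℝ (P.normal r) y = P.offset r := by nlinarith
      exact hyx (eq_of_mem_three_facets h.1 hcon.1 hcon.2 hy.1 hy.2 ⟨hy.1.1, h3⟩ hxE.1 hxE.2
        ⟨hxE.1.1, hr⟩)
    · rintro (rfl | rfl)
      exacts [hxE.1.2, hxE.2.2]
  · intro x hx
    have hxE : x ∈ P.facet i ∩ P.facet j := ⟨mem_facet_left hx, mem_facet_right hx⟩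
    refine mem_intrinsicInterior.2 ⟨⟨x, subset_affineSpan ℝ _ hxE⟩, ?_, rfl⟩
    have hspan : ∀ y ∈ affineSpan ℝ (P.facet i ∩ P.facet j),
        inner ℝ (P.normal i) y = P.offset i ∧ inner ℝ (P.normal j) y = P.offset j := by
      intro y hy
      refine affineSpan_induction (p := fun y => inner ℝ (P.normal i) y = P.offset i ∧
        inner ℝ (P.normal j) y = P.offset j) hy (fun z hz => ⟨hz.1.2, hz.2.2⟩) ?_
      · intro c u v w hu hv hw
        simp only [vsub_eq_sub, vadd_eq_add, inner_add_right, inner_smul_right, inner_sub_right,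
          hu.1, hu.2, hv.1, hv.2, hw.1, hw.2]
        constructor <;> ring
    refine mem_interior.2 ⟨⋂ r : {r // r ≠ i ∧ r ≠ j},
      {y | inner ℝ (P.normal r) (y : E3) < P.offset r}, ?_, ?_, ?_⟩
    · intro y hy
      have hy' := hspan y y.2
      have hb : (y : E3) ∈ P.body := by
        intro r
        by_cases hri : r = i
        · rw [hri, hy'.1]
        by_cases hrj : r = j
        · rw [hrj, hy'.2]
        exact (Set.mem_iInter.1 hy ⟨r, hri, hrj⟩).le
      exact ⟨⟨hb, hy'.1⟩, ⟨hb, hy'.2⟩⟩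
    · exact isOpen_iInter_of_finite fun r => isOpen_lt (by fun_prop) (by fun_prop)
    · refine Set.mem_iInter.2 fun r => lt_of_le_of_ne (hx.1 r) fun hr => ?_
      rcases (hx.2 r).1 hr with hr | hr
      exacts [r.2.1 hr, r.2.2 hr]

lemma edgeMid_comm (i j : Fin P.m) : P.edgeMid i j = P.edgeMid j i := by
  unfold edgeMid
  rw [Set.inter_comm]

lemma facet_inter_eq_segment {i j : Fin P.m} (h : P.Adj i j) :
    ∃ u v, P.facet i ∩ P.facet j = segment ℝ u v := by
  obtain ⟨x, hx⟩ := h.2.nonempty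
  obtain ⟨w, hw, l, hil, hjl, hwi, hwj, hwl⟩ := exists_third_facet hx.1.1 h.1 hx.1.2 hx.2.2
  -- the normal of a facet through an end of the edge is not constant along the edge
  have hdet := (three_tight hw h.1 hil hjl hwi hwj hwl).1
  have hc : IsCompact (P.facet i ∩ P.facet j) := by
    refine isCompact_body.of_isClosed_subset ?_ fun z hz => hz.1.1
    have : P.facet i ∩ P.facet j = P.body ∩ ({z | inner ℝ (P.normal i) z = P.offset i} ∩
        {z | inner ℝ (P.normal j) z = P.offset j}) := by
      ext z
      simp only [facet, Set.mem_inter_iff, Set.mem_ofPred_eq]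
      tauto
    rw [this]
    exact isClosed_body.inter ((isClosed_eq (by fun_prop) (by fun_prop)).inter
      (isClosed_eq (by fun_prop) (by fun_prop)))
  have hcont : ContinuousOn (fun z => inner ℝ (P.normal l) z) (P.facet i ∩ P.facet j) :=
    Continuous.continuousOn (by fun_prop)
  obtain ⟨u, hu, hmin⟩ := hc.exists_isMinOn h.2.nonempty hcont
  obtain ⟨v, hv, hmax⟩ := hc.exists_isMaxOn h.2.nonempty hcont
  refine ⟨u, v, Set.Subset.antisymm (fun z hz => ?_) fun z hz =>
    ⟨mem_facet_of_mem_segment hu.1 hv.1 hz, mem_facet_of_mem_segment hu.2 hv.2 hz⟩⟩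
  have h1 : inner ℝ (P.normal l) u ≤ inner ℝ (P.normal l) z := hmin hz
  have h2 : inner ℝ (P.normal l) z ≤ inner ℝ (P.normal l) v := hmax hz
  have hmem : inner ℝ (P.normal l) z ∈
      segment ℝ (inner ℝ (P.normal l) u) (inner ℝ (P.normal l) v) := by
    rw [segment_eq_Icc (h1.trans h2)]
    exact ⟨h1, h2⟩
  obtain ⟨a, b, ha, hb, hab, hl⟩ := hmem
  refine ⟨a, b, ha, hb, hab, ?_⟩
  refine sub_eq_zero.1 (eq_zero_of_det3_ne_zero hdet ?_ ?_ ?_)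
  · rw [inner_sub_right, inner_add_right, inner_smul_right, inner_smul_right, hu.1.2, hv.1.2,
      hz.1.2, ← add_mul, hab, one_mul, sub_self]
  · rw [inner_sub_right, inner_add_right, inner_smul_right, inner_smul_right, hu.2.2, hv.2.2,
      hz.2.2, ← add_mul, hab, one_mul, sub_self]
  · rw [inner_sub_right, inner_add_right, inner_smul_right, inner_smul_right, ← hl]
    simp

lemma edgeMid_mem {i j : Fin P.m} (h : P.Adj i j) : P.edgeMid i j ∈ P.openEdge i j := by
  obtain ⟨u, v, huv⟩ := facet_inter_eq_segment h
  have hex : ∃ x, ∃ u v, P.facet i ∩ P.facet j = segment ℝ u v ∧ x = midpoint ℝ u v :=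
    ⟨_, u, v, huv, rfl⟩
  obtain ⟨u', v', hseg, hmid⟩ := Classical.epsilon_spec hex
  have hmid : P.edgeMid i j = midpoint ℝ u' v' := hmid
  have hu : u' ∈ P.facet i ∩ P.facet j := hseg ▸ left_mem_segment ℝ u' v'
  have hv : v' ∈ P.facet i ∩ P.facet j := hseg ▸ right_mem_segment ℝ u' v'
  have hne : u' ≠ v' := by
    rintro rfl
    have := h.2
    rw [hseg, segment_same] at this
    exact Set.not_nontrivial_singleton this
  rw [hmid, show midpoint ℝ u' v' = (1 / 2 : ℝ) • u' + (1 / 2 : ℝ) • v' by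
    rw [midpoint_eq_smul_add]; simp]
  exact combination_mem_openEdge h.1 hne hu.1 hu.2 hv.1 hv.2 (by norm_num) (by norm_num)
    (by norm_num)

end SimplePolytope3

/-! ### Plane geometry in a facet -/

/-- Two vectors in the plane orthogonal to `n` are parallel if their determinant with `n`
vanishes. -/
lemma exists_smul_eq_of_det3_eq_zero {n a b : E3} (hn : n ≠ 0) (ha : inner ℝ n a = 0)
    (hb : inner ℝ n b = 0) (hdet : det3 n a b = 0) (ha0 : a ≠ 0) : ∃ t : ℝ, b = t • a := by
  have hn2 : inner ℝ n n ≠ 0 := (real_inner_self_pos.2 hn).ne'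
  have ha2 : inner ℝ a a ≠ 0 := (real_inner_self_pos.2 ha0).ne'
  rw [inner_eq_coords] at ha hb hn2 ha2
  unfold det3 at hdet
  -- the cross product of `a` and `b` is a multiple of `n`, hence zero
  have c0 : a 1 * b 2 - a 2 * b 1 = 0 := by
    refine (mul_eq_zero.1 ?_).resolve_left hn2
    linear_combination n 0 * hdet - (n 2 * b 1 - n 1 * b 2) * ha - (n 1 * a 2 - n 2 * a 1) * hb
  have c1 : a 2 * b 0 - a 0 * b 2 = 0 := by
    refine (mul_eq_zero.1 ?_).resolve_left hn2
    linear_combination n 1 * hdet - (n 0 * b 2 - n 2 * b 0) * ha - (n 2 * a 0 - n 0 * a 2) * hb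
  have c2 : a 0 * b 1 - a 1 * b 0 = 0 := by
    refine (mul_eq_zero.1 ?_).resolve_left hn2
    linear_combination n 2 * hdet - (n 1 * b 0 - n 0 * b 1) * ha - (n 0 * a 1 - n 1 * a 0) * hb
  refine ⟨(a 0 * b 0 + a 1 * b 1 + a 2 * b 2) / (a 0 * a 0 + a 1 * a 1 + a 2 * a 2), ?_⟩
  apply ext_coords
  · simp only [PiLp.smul_apply, smul_eq_mul]
    rw [div_mul_eq_mul_div, eq_div_iff ha2]
    linear_combination a 2 * c1 - a 1 * c2
  · simp only [PiLp.smul_apply, smul_eq_mul]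
    rw [div_mul_eq_mul_div, eq_div_iff ha2]
    linear_combination a 0 * c2 - a 2 * c0
  · simp only [PiLp.smul_apply, smul_eq_mul]
    rw [div_mul_eq_mul_div, eq_div_iff ha2]
    linear_combination a 1 * c0 - a 0 * c1

lemma gram_pos_of_det3_ne_zero {a b c : E3} (h : det3 a b c ≠ 0) :
    0 < inner ℝ a a * inner ℝ b b - inner ℝ a b ^ 2 := by
  simp only [inner_eq_coords]
  unfold det3 at h
  generalize a 0 = a0, a 1 = a1, a 2 = a2, b 0 = b0, b 1 = b1, b 2 = b2 at *
  have hsum : (a0 * a0 + a1 * a1 + a2 * a2) * (b0 * b0 + b1 * b1 + b2 * b2) -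
      (a0 * b0 + a1 * b1 + a2 * b2) ^ 2 =
      (a1 * b2 - a2 * b1) ^ 2 + (a2 * b0 - a0 * b2) ^ 2 + (a0 * b1 - a1 * b0) ^ 2 := by ring
  rw [hsum]
  refine lt_of_le_of_ne (by positivity) fun h0 => h ?_
  have c0 : a1 * b2 - a2 * b1 = 0 := by
    refine pow_eq_zero_iff two_ne_zero |>.1 (le_antisymm ?_ (sq_nonneg _))
    linarith [sq_nonneg (a2 * b0 - a0 * b2), sq_nonneg (a0 * b1 - a1 * b0)]
  have c1 : a2 * b0 - a0 * b2 = 0 := by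
    refine pow_eq_zero_iff two_ne_zero |>.1 (le_antisymm ?_ (sq_nonneg _))
    linarith [sq_nonneg (a1 * b2 - a2 * b1), sq_nonneg (a0 * b1 - a1 * b0)]
  have c2 : a0 * b1 - a1 * b0 = 0 := by
    refine pow_eq_zero_iff two_ne_zero |>.1 (le_antisymm ?_ (sq_nonneg _))
    linarith [sq_nonneg (a1 * b2 - a2 * b1), sq_nonneg (a2 * b0 - a0 * b2)]
  linear_combination c 0 * c0 + c 1 * c1 + c 2 * c2

/-- For `u` orthogonal to `a` and `b`, and `v` orthogonal to `a`: the vector `u` is a multiple of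
the cross product of `a` and `b`, so the two determinants determine each other. -/
lemma det3_mul_gram {a b u v : E3} (hua : inner ℝ a u = 0) (hub : inner ℝ b u = 0)
    (hva : inner ℝ a v = 0) :
    det3 a v u * (inner ℝ a a * inner ℝ b b - inner ℝ a b ^ 2) =
      det3 a b u * (inner ℝ a a * inner ℝ b v) := by
  simp only [inner_eq_coords] at hua hub hva ⊢
  unfold det3
  generalize a 0 = a0, a 1 = a1, a 2 = a2, b 0 = b0, b 1 = b1, b 2 = b2, u 0 = u0, u 1 = u1,
    u 2 = u2, v 0 = v0, v 1 = v1, v 2 = v2 at *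
  set A := a0 * a0 + a1 * a1 + a2 * a2 with hA
  set B := b0 * b0 + b1 * b1 + b2 * b2 with hB
  set C := a0 * b0 + a1 * b1 + a2 * b2 with hC
  set D := a0 * (b1 * u2 - b2 * u1) - a1 * (b0 * u2 - b2 * u0) + a2 * (b0 * u1 - b1 * u0) with hD
  have e0 : u0 * (A * B - C ^ 2) = D * (a1 * b2 - a2 * b1) := by
    rw [hA, hB, hC, hD]
    linear_combination (B * a0 - C * b0) * hua + (A * b0 - C * a0) * hub
  have e1 : u1 * (A * B - C ^ 2) = D * (a2 * b0 - a0 * b2) := by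
    rw [hA, hB, hC, hD]
    linear_combination (B * a1 - C * b1) * hua + (A * b1 - C * a1) * hub
  have e2 : u2 * (A * B - C ^ 2) = D * (a0 * b1 - a1 * b0) := by
    rw [hA, hB, hC, hD]
    linear_combination (B * a2 - C * b2) * hua + (A * b2 - C * a2) * hub
  linear_combination (a1 * v2 - a2 * v1) * e0 + (a2 * v0 - a0 * v2) * e1
    + (a0 * v1 - a1 * v0) * e2 - D * C * hva

lemma sign_eq_of_forall_ne_zero {f : ℝ → ℝ} (hf : Continuous f)
    (h0 : ∀ t ∈ Set.Icc (0 : ℝ) 1, f t ≠ 0) {s t : ℝ} (hs : s ∈ Set.Icc (0 : ℝ) 1)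
    (ht : t ∈ Set.Icc (0 : ℝ) 1) : SignType.sign (f s) = SignType.sign (f t) := by
  refine isPreconnected_Icc.constant (f := fun t => SignType.sign (f t)) ?_ hs ht
  intro r hr
  exact ((continuousAt_sign_of_ne_zero (h0 r hr)).comp hf.continuousAt).continuousWithinAt

namespace SimplePolytope3

variable {P : SimplePolytope3}

/-- The orientation of the triangle `x y z` in the facet `F_i`: its sign tells on which side of the
line `xy` the point `z` lies. -/
def side (P : SimplePolytope3) (i : Fin P.m) (x y z : E3) : ℝ :=
  det3 (P.normal i) (y - x) (z - x)

/-- The oriented distance, up to a positive factor, from `x` to `y` along the edge `F_i ∩ F_j`,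
which is directed as a part of the boundary of `F_i`. -/
def along (P : SimplePolytope3) (i j : Fin P.m) (x y : E3) : ℝ :=
  det3 (P.normal i) (P.normal j) (y - x)

lemma continuous_side {X : Type*} [TopologicalSpace X] {i : Fin P.m} {a b c : X → E3}
    (ha : Continuous a) (hb : Continuous b) (hc : Continuous c) :
    Continuous fun x => P.side i (a x) (b x) (c x) := by
  unfold side
  fun_prop

lemma side_swap (i : Fin P.m) (x y z : E3) : P.side i y x z = -P.side i x y z := by
  simp only [side, det3, PiLp.sub_apply]; ring

lemma side_left (i : Fin P.m) (x y : E3) : P.side i x y x = 0 := by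
  simp only [side, det3, PiLp.sub_apply]; ring

lemma side_right (i : Fin P.m) (x y : E3) : P.side i x y y = 0 := by
  simp only [side, det3, PiLp.sub_apply]; ring

lemma side_combination (i : Fin P.m) (x y z w : E3) {a b : ℝ} (hab : a + b = 1) :
    P.side i x y (a • z + b • w) = a * P.side i x y z + b * P.side i x y w := by
  obtain rfl : a = 1 - b := by linarith
  simp only [side, det3, PiLp.sub_apply, PiLp.add_apply, PiLp.smul_apply, smul_eq_mul]; ring

lemma along_comm (i j : Fin P.m) (x y : E3) : P.along j i x y = -P.along i j x y := by
  simp only [along, det3, PiLp.sub_apply]; ring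

lemma along_swap (i j : Fin P.m) (x y : E3) : P.along i j y x = -P.along i j x y := by
  simp only [along, det3, PiLp.sub_apply]; ring

lemma along_lineMap (i j : Fin P.m) (x₀ x₁ y₀ y₁ : E3) (t : ℝ) :
    P.along i j (AffineMap.lineMap x₀ x₁ t) (AffineMap.lineMap y₀ y₁ t) =
      (1 - t) * P.along i j x₀ y₀ + t * P.along i j x₁ y₁ := by
  simp only [along, det3, AffineMap.lineMap_apply_module, PiLp.sub_apply, PiLp.add_apply,
    PiLp.smul_apply, smul_eq_mul]
  ring

/-- A point of an open edge of `F_i` lies strictly inside the half-plane of any other edge. -/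
lemma lt_of_mem_openEdge {i j l : Fin P.m} (hjl : j ≠ l) (hij : i ≠ j) {y : E3}
    (hy : y ∈ P.openEdge i l) : inner ℝ (P.normal j) y < P.offset j := by
  refine lt_of_le_of_ne (hy.1 j) fun h => ?_
  rcases (hy.2 j).1 h with h | h
  exacts [hij h.symm, hjl h]

lemma ne_of_mem_openEdge {i j l : Fin P.m} (hjl : j ≠ l) (hij : i ≠ j) {x y : E3}
    (hx : x ∈ P.openEdge i j) (hy : y ∈ P.openEdge i l) : x ≠ y := by
  rintro rfl
  exact (lt_of_mem_openEdge hjl hij hy).ne (mem_facet_right hx).2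

/-- The chord of a facet between two of its edges has its inner points in no other facet. -/
lemma tight_of_mem_chord {i j l : Fin P.m} (hjl : j ≠ l) {x y z : E3} (hx : x ∈ P.openEdge i j)
    (hy : y ∈ P.openEdge i l) (hz : z ∈ segment ℝ x y) :
    z = x ∨ z = y ∨ ∀ r, inner ℝ (P.normal r) z = P.offset r → r = i := by
  obtain ⟨a, b, ha, hb, hab, rfl⟩ := hz
  rcases ha.eq_or_lt with rfl | ha
  · obtain rfl : b = 1 := by linarith
    right; left; simp
  rcases hb.eq_or_lt with rfl | hb
  · obtain rfl : a = 1 := by linarith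
    left; simp
  right; right
  intro r hr
  obtain ⟨h1, h2⟩ := tight_of_tight_combination hx.1 hy.1 ha hb hab hr
  rcases (hx.2 r).1 h1 with h | h
  · exact h
  rcases (hy.2 r).1 h2 with h' | h'
  · exact h'
  · exact absurd (h.symm.trans h') hjl

/-- The line through two points on different edges of a facet meets the facet in the segment
between them. -/
lemma mem_segment_of_side_eq_zero {i j l : Fin P.m} (hij : i ≠ j) (hil : i ≠ l) (hjl : j ≠ l)
    {x y z : E3} (hx : x ∈ P.openEdge i j) (hy : y ∈ P.openEdge i l) (hz : z ∈ P.facet i)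
    (h : P.side i x y z = 0) : z ∈ segment ℝ x y := by
  have hxi := mem_facet_left hx
  have hyi := mem_facet_left hy
  have hne := ne_of_mem_openEdge hjl hij hx hy
  obtain ⟨t, ht⟩ := exists_smul_eq_of_det3_eq_zero (normal_ne_zero i)
    (by rw [inner_sub_right, hyi.2, hxi.2, sub_self])
    (by rw [inner_sub_right, hz.2, hxi.2, sub_self]) h (sub_ne_zero.2 hne.symm)
  have hzt : z = (1 - t) • x + t • y := by
    rw [sub_eq_iff_eq_add.1 ht]; module
  have hj := hz.1 j
  have hl := hz.1 l
  rw [hzt, inner_add_right, inner_smul_right, inner_smul_right] at hj hl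
  rw [(mem_facet_right hx).2] at hj
  rw [(mem_facet_right hy).2] at hl
  have hj' := lt_of_mem_openEdge hjl hij hy
  have hl' := lt_of_mem_openEdge hjl.symm hil hx
  refine ⟨1 - t, t, ?_, ?_, by ring, hzt.symm⟩ <;> nlinarith

lemma side_ne_zero {i j l q : Fin P.m} (hij : i ≠ j) (hil : i ≠ l) (hjl : j ≠ l) (hiq : i ≠ q)
    {x y z : E3} (hx : x ∈ P.openEdge i j) (hy : y ∈ P.openEdge i l) (hz : z ∈ P.openEdge i q)
    (hzx : z ≠ x) (hzy : z ≠ y) : P.side i x y z ≠ 0 := by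
  intro h
  rcases tight_of_mem_chord hjl hx hy
    (mem_segment_of_side_eq_zero hij hil hjl hx hy (mem_facet_left hz) h) with h | h | h
  · exact hzx h
  · exact hzy h
  · exact hiq (h q (mem_facet_right hz).2).symm

/-- Two chords of a facet are disjoint if and only if the ends of the second one lie strictly on
the same side of the first one. -/
lemma disjoint_chords_iff {i j l q r : Fin P.m} (hij : i ≠ j) (hil : i ≠ l) (hjl : j ≠ l)
    (hiq : i ≠ q) (hir : i ≠ r) {x y z w : E3} (hx : x ∈ P.openEdge i j)
    (hy : y ∈ P.openEdge i l) (hz : z ∈ P.openEdge i q) (hw : w ∈ P.openEdge i r) :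
    Disjoint (segment ℝ x y) (segment ℝ z w) ↔ 0 < P.side i x y z * P.side i x y w := by
  constructor
  · intro hd
    have hz0 := side_ne_zero hij hil hjl hiq hx hy hz
      (fun h => Set.disjoint_left.1 hd (left_mem_segment ℝ x y) (h ▸ left_mem_segment ℝ z w))
      (fun h => Set.disjoint_left.1 hd (right_mem_segment ℝ x y) (h ▸ left_mem_segment ℝ z w))
    have hw0 := side_ne_zero hij hil hjl hir hx hy hw
      (fun h => Set.disjoint_left.1 hd (left_mem_segment ℝ x y) (h ▸ right_mem_segment ℝ z w))
      (fun h => Set.disjoint_left.1 hd (right_mem_segment ℝ x y) (h ▸ right_mem_segment ℝ z w))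
    by_contra hneg
    have hneg : P.side i x y z * P.side i x y w < 0 :=
      lt_of_le_of_ne (not_lt.1 hneg) (mul_ne_zero hz0 hw0)
    set α := P.side i x y z
    set β := P.side i x y w
    -- the point of the second chord where the linear functional `side` vanishes
    have hd0 : α - β ≠ 0 := by
      intro h
      rw [sub_eq_zero.1 h] at hneg
      nlinarith [mul_self_nonneg β]
    have hmem : (-β / (α - β)) • z + (α / (α - β)) • w ∈ segment ℝ z w := by
      refine ⟨_, _, ?_, ?_, ?_, rfl⟩
      · rcases lt_or_gt_of_ne hz0 with h | h
        · exact div_nonneg_of_nonpos (by nlinarith) (by nlinarith)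
        · exact div_nonneg (by nlinarith) (by nlinarith)
      · rcases lt_or_gt_of_ne hz0 with h | h
        · exact div_nonneg_of_nonpos (by nlinarith) (by nlinarith)
        · exact div_nonneg (by nlinarith) (by nlinarith)
      · field_simp; ring
    refine Set.disjoint_left.1 hd (mem_segment_of_side_eq_zero hij hil hjl hx hy
      (mem_facet_of_mem_segment (mem_facet_left hz) (mem_facet_left hw) hmem) ?_) hmem
    rw [side_combination _ _ _ _ _ (by field_simp; ring)]
    change -β / (α - β) * α + α / (α - β) * β = 0
    ring
  · intro hpos
    refine Set.disjoint_left.2 fun u hu hu' => ?_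
    obtain ⟨a, b, ha, hb, hab, rfl⟩ := hu'
    obtain ⟨c, d, hc, hd, hcd, he⟩ := hu
    have h0 : P.side i x y (a • z + b • w) = 0 := by
      rw [← he, side_combination _ _ _ _ _ hcd, side_left, side_right]; ring
    rw [side_combination _ _ _ _ _ hab] at h0
    rcases pos_and_pos_or_neg_and_neg_of_mul_pos hpos with ⟨h1, h2⟩ | ⟨h1, h2⟩
    · rcases ha.eq_or_lt with rfl | ha
      · nlinarith
      · nlinarith [mul_pos ha h1, mul_nonneg hb h2.le]
    · rcases ha.eq_or_lt with rfl | ha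
      · nlinarith
      · nlinarith [mul_pos ha (neg_pos.2 h1), mul_nonneg hb (neg_pos.2 h2).le]

/-- If `x`, `z` lie on the edge `F_i ∩ F_j` and `y` elsewhere in the facet `F_i`, then the side of
the line `xy` on which `z` lies is given by the order of `x` and `z` on the edge. -/
lemma sign_side_eq_neg_sign_along {i j : Fin P.m} (hij : i ≠ j) {x y z : E3}
    (hx : x ∈ P.openEdge i j) (hy : y ∈ P.facet i) (hyj : inner ℝ (P.normal j) y < P.offset j)
    (hz : z ∈ P.openEdge i j) :
    SignType.sign (P.side i x y z) = -SignType.sign (P.along i j x z) := by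
  have hn : 0 < inner ℝ (P.normal i) (P.normal i) := real_inner_self_pos.2 (normal_ne_zero i)
  have hui : inner ℝ (P.normal i) (z - x) = 0 := by
    rw [inner_sub_right, (mem_facet_left hz).2, (mem_facet_left hx).2, sub_self]
  have huj : inner ℝ (P.normal j) (z - x) = 0 := by
    rw [inner_sub_right, (mem_facet_right hz).2, (mem_facet_right hx).2, sub_self]
  have hvi : inner ℝ (P.normal i) (y - x) = 0 := by
    rw [inner_sub_right, hy.2, (mem_facet_left hx).2, sub_self]
  have hvj : inner ℝ (P.normal j) (y - x) < 0 := by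
    rw [inner_sub_right, (mem_facet_right hx).2]; linarith
  have hG : 0 < inner ℝ (P.normal i) (P.normal i) * inner ℝ (P.normal j) (P.normal j)
      - inner ℝ (P.normal i) (P.normal j) ^ 2 := by
    obtain ⟨v, hv, l, hil, hjl, hvi, hvj, hvl⟩ :=
      exists_third_facet hx.1 hij (mem_facet_left hx).2 (mem_facet_right hx).2
    exact gram_pos_of_det3_ne_zero (three_tight hv hij hil hjl hvi hvj hvl).1
  have key := det3_mul_gram hui huj hvi
  have hs := congrArg SignType.sign key
  rw [sign_mul, sign_mul, sign_mul, sign_pos hG, sign_pos hn, sign_neg hvj] at hs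
  simpa [side, along] using hs

/-- Chords whose ends move linearly along edges of a facet keep their position relative to a point
that moves linearly along an edge, as long as that point does not meet their ends. -/
lemma sign_side_lineMap {i j l q : Fin P.m} (hij : i ≠ j) (hil : i ≠ l) (hjl : j ≠ l)
    (hiq : i ≠ q) {x₀ x₁ y₀ y₁ z₀ z₁ : E3} (hx₀ : x₀ ∈ P.openEdge i j) (hx₁ : x₁ ∈ P.openEdge i j)
    (hy₀ : y₀ ∈ P.openEdge i l) (hy₁ : y₁ ∈ P.openEdge i l) (hz₀ : z₀ ∈ P.openEdge i q)
    (hz₁ : z₁ ∈ P.openEdge i q)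
    (hxz : ∀ t ∈ Set.Icc (0 : ℝ) 1, AffineMap.lineMap z₀ z₁ t ≠ AffineMap.lineMap x₀ x₁ t)
    (hyz : ∀ t ∈ Set.Icc (0 : ℝ) 1, AffineMap.lineMap z₀ z₁ t ≠ AffineMap.lineMap y₀ y₁ t)
    {s t : ℝ} (hs : s ∈ Set.Icc (0 : ℝ) 1) (ht : t ∈ Set.Icc (0 : ℝ) 1) :
    SignType.sign (P.side i (AffineMap.lineMap x₀ x₁ s) (AffineMap.lineMap y₀ y₁ s)
        (AffineMap.lineMap z₀ z₁ s)) =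
      SignType.sign (P.side i (AffineMap.lineMap x₀ x₁ t) (AffineMap.lineMap y₀ y₁ t)
        (AffineMap.lineMap z₀ z₁ t)) := by
  refine sign_eq_of_forall_ne_zero (f := fun t => P.side i (AffineMap.lineMap x₀ x₁ t)
    (AffineMap.lineMap y₀ y₁ t) (AffineMap.lineMap z₀ z₁ t)) ?_ ?_ hs ht
  · exact continuous_side AffineMap.lineMap_continuous AffineMap.lineMap_continuous
      AffineMap.lineMap_continuous
  · intro r hr
    exact side_ne_zero hij hil hjl hiq (openEdge_convex.lineMap_mem hx₀ hx₁ hr)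
      (openEdge_convex.lineMap_mem hy₀ hy₁ hr) (openEdge_convex.lineMap_mem hz₀ hz₁ hr)
      (hxz r hr) (hyz r hr)

/-! ### Belts and their polygons -/

lemma two_ne_zero_zmod {k : ℕ} (hk : 3 ≤ k) : (2 : ZMod k) ≠ 0 := by
  intro h
  have h' : ((2 : ℕ) : ZMod k) = 0 := by exact_mod_cast h
  have := Nat.le_of_dvd (by norm_num) ((ZMod.natCast_eq_zero_iff 2 k).1 h')
  omega

lemma IsBelt.exists_other_neighbour {B : Finset (Fin P.m)} (hB : P.IsBelt B) {i j : Fin P.m}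
    (hi : i ∈ B) (hj : j ∈ B) (hij : P.Adj i j) :
    ∃ l ∈ B, j ≠ l ∧ P.Adj i l ∧ ∀ r ∈ B, P.Adj i r → r = j ∨ r = l := by
  obtain ⟨k, hk, c, hc, hr, ha, -⟩ := hB
  have hmem : ∀ x, x ∈ B ↔ ∃ s, c s = x := fun x => by
    rw [← Finset.mem_coe, ← hr, Set.mem_range]
  obtain ⟨s, rfl⟩ := (hmem i).1 hi
  obtain ⟨t, rfl⟩ := (hmem j).1 hj
  have h2 := two_ne_zero_zmod hk
  rcases (ha s t).1 hij with rfl | rfl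
  · refine ⟨c (s - 1), (hmem _).2 ⟨_, rfl⟩, fun h => h2 ?_, (ha _ _).2 (Or.inr (by ring)), ?_⟩
    · linear_combination hc h
    · intro r hrB hr'
      obtain ⟨u, rfl⟩ := (hmem r).1 hrB
      rcases (ha _ _).1 hr' with h | h
      · exact Or.inl (congrArg c h)
      · exact Or.inr (congrArg c (by rw [h]; ring))
  · refine ⟨c (t + 1 + 1), (hmem _).2 ⟨_, rfl⟩, fun h => h2 ?_, (ha _ _).2 (Or.inl rfl), ?_⟩
    · linear_combination -(hc h)
    · intro r hrB hr'
      obtain ⟨u, rfl⟩ := (hmem r).1 hrB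
      rcases (ha _ _).1 hr' with h | h
      · exact Or.inr (congrArg c h)
      · exact Or.inl (congrArg c (by linear_combination -h))

lemma IsBelt.exists_neighbour {B : Finset (Fin P.m)} (hB : P.IsBelt B) {i : Fin P.m}
    (hi : i ∈ B) : ∃ j ∈ B, P.Adj i j := by
  obtain ⟨k, hk, c, hc, hr, ha, -⟩ := hB
  have hmem : ∀ x, x ∈ B ↔ ∃ s, c s = x := fun x => by
    rw [← Finset.mem_coe, ← hr, Set.mem_range]
  obtain ⟨s, rfl⟩ := (hmem i).1 hi
  exact ⟨c (s + 1), (hmem _).2 ⟨_, rfl⟩, (ha _ _).2 (Or.inl rfl)⟩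

lemma IsBelt.nonempty {B : Finset (Fin P.m)} (hB : P.IsBelt B) : B.Nonempty := by
  obtain ⟨k, hk, c, hc, hr, -⟩ := hB
  exact ⟨c 0, by rw [← Finset.mem_coe, ← hr]; exact ⟨0, rfl⟩⟩

/-- A property of the steps of a belt that is inherited by the next step holds all around it. -/
lemma IsBelt.propagate {B : Finset (Fin P.m)} (hB : P.IsBelt B) {Q : Fin P.m → Fin P.m → Prop}
    (hQ : ∀ i ∈ B, ∀ j ∈ B, ∀ l ∈ B, j ≠ l → P.Adj i j → P.Adj i l → Q i j → Q l i)
    {i₀ j₀ : Fin P.m} (hi₀ : i₀ ∈ B) (hj₀ : j₀ ∈ B) (hadj : P.Adj i₀ j₀) (h₀ : Q i₀ j₀) :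
    ∀ i ∈ B, ∃ j ∈ B, P.Adj i j ∧ Q i j := by
  obtain ⟨k, hk, c, hc, hr, ha, -⟩ := hB
  have : NeZero k := ⟨by omega⟩
  have hmem : ∀ x, x ∈ B ↔ ∃ s, c s = x := fun x => by
    rw [← Finset.mem_coe, ← hr, Set.mem_range]
  have hc' : ∀ s, c s ∈ B := fun s => (hmem _).2 ⟨s, rfl⟩
  obtain ⟨s, rfl⟩ := (hmem i₀).1 hi₀
  obtain ⟨t, rfl⟩ := (hmem j₀).1 hj₀
  have h2 := two_ne_zero_zmod hk
  rcases (ha s t).1 hadj with rfl | rfl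
  · -- walk backwards
    have step : ∀ n : ℕ, Q (c (s - n)) (c (s - n + 1)) := by
      intro n
      induction n with
      | zero => simpa using h₀
      | succ n ih =>
        have e : s - ((n + 1 : ℕ) : ZMod k) = s - n - 1 := by push_cast; ring
        rw [e, sub_add_cancel]
        refine hQ _ (hc' _) _ (hc' _) _ (hc' _) (fun h => h2 ?_) ((ha _ _).2 (Or.inl rfl))
          ((ha _ _).2 (Or.inr (by ring))) ih
        linear_combination hc h
    intro i hi
    obtain ⟨u, rfl⟩ := (hmem i).1 hi
    refine ⟨c (u + 1), hc' _, (ha _ _).2 (Or.inl rfl), ?_⟩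
    have := step (s - u).val
    rwa [ZMod.natCast_zmod_val, sub_sub_cancel] at this
  · have step : ∀ n : ℕ, Q (c (t + 1 + n)) (c (t + n)) := by
      intro n
      induction n with
      | zero => simpa using h₀
      | succ n ih =>
        have e : t + 1 + ((n + 1 : ℕ) : ZMod k) = t + 1 + n + 1 := by push_cast; ring
        have e' : t + ((n + 1 : ℕ) : ZMod k) = t + 1 + n := by push_cast; ring
        rw [e, e']
        refine hQ _ (hc' _) _ (hc' _) _ (hc' _) (fun h => h2 ?_) ((ha _ _).2 (Or.inr (by ring)))
          ((ha _ _).2 (Or.inl rfl)) ih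
        linear_combination -(hc h)
    intro i hi
    obtain ⟨u, rfl⟩ := (hmem i).1 hi
    refine ⟨c (u - 1), hc' _, (ha _ _).2 (Or.inr (by ring)), ?_⟩
    have := step (u - (t + 1)).val
    rw [ZMod.natCast_zmod_val] at this
    rwa [show t + 1 + (u - (t + 1)) = u by ring, show t + (u - (t + 1)) = u - 1 by ring] at this

/-- A choice of a point in the relative interior of every edge that the belt `B` crosses. -/
def IsEdgeChoice (P : SimplePolytope3) (B : Finset (Fin P.m)) (p : Fin P.m → Fin P.m → E3) : Prop :=
  (∀ i j, p i j = p j i) ∧ ∀ i ∈ B, ∀ j ∈ B, P.Adj i j → p i j ∈ P.openEdge i j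

lemma isEdgeChoice_edgeMid (B : Finset (Fin P.m)) : P.IsEdgeChoice B P.edgeMid :=
  ⟨edgeMid_comm, fun _ _ _ _ h => edgeMid_mem h⟩

lemma IsEdgeChoice.lineMap {B : Finset (Fin P.m)} {p q : Fin P.m → Fin P.m → E3}
    (hp : P.IsEdgeChoice B p) (hq : P.IsEdgeChoice B q) {t : ℝ} (ht : t ∈ Set.Icc (0 : ℝ) 1) :
    P.IsEdgeChoice B fun i j => AffineMap.lineMap (p i j) (q i j) t :=
  ⟨fun i j => by dsimp only; rw [hp.1 i j, hq.1 i j], fun i hi j hj h =>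
    openEdge_convex.lineMap_mem (hp.2 i hi j hj h) (hq.2 i hi j hj h) ht⟩

lemma beltPolygon_subset_frontier {B : Finset (Fin P.m)} {p : Fin P.m → Fin P.m → E3}
    (hp : P.IsEdgeChoice B p) : P.beltPolygon B p ⊆ frontier P.body := by
  rintro x ⟨i, hi, j, hj, l, hl, -, hij, hil, hx⟩
  exact facet_subset_frontier i (mem_facet_of_mem_segment (mem_facet_left (hp.2 i hi j hj hij))
    (mem_facet_left (hp.2 i hi l hl hil)) hx)

/-- The polygon of a belt leaves a facet `F_i` of the belt only at its two vertices there. -/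
lemma eq_of_mem_two_facets {B : Finset (Fin P.m)} {p : Fin P.m → Fin P.m → E3}
    (hp : P.IsEdgeChoice B p) {i j l r : Fin P.m} (hi : i ∈ B) (hj : j ∈ B) (hl : l ∈ B)
    (hjl : j ≠ l) (hij : P.Adj i j) (hil : P.Adj i l) {x : E3}
    (hx : x ∈ segment ℝ (p i j) (p i l)) (hr : inner ℝ (P.normal r) x = P.offset r) (hri : r ≠ i) :
    r ∈ B ∧ P.Adj i r ∧ x = p i r := by
  have hpj := hp.2 i hi j hj hij
  have hpl := hp.2 i hi l hl hil
  rcases tight_of_mem_chord hjl hpj hpl hx with rfl | rfl | h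
  · rcases (hpj.2 r).1 hr with h | rfl
    · exact absurd h hri
    · exact ⟨hj, hij, rfl⟩
  · rcases (hpl.2 r).1 hr with h | rfl
    · exact absurd h hri
    · exact ⟨hl, hil, rfl⟩
  · exact absurd (h r hr) hri

/-- The polygons of two belts are disjoint if and only if in every common facet the chord of the
second one lies strictly on one side of the chord of the first one. -/
lemma disjoint_beltPolygon_iff {B₁ B₂ : Finset (Fin P.m)} (hB₁ : P.IsBelt B₁) (hB₂ : P.IsBelt B₂)
    {p₁ p₂ : Fin P.m → Fin P.m → E3} (h₁ : P.IsEdgeChoice B₁ p₁) (h₂ : P.IsEdgeChoice B₂ p₂) :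
    Disjoint (P.beltPolygon B₁ p₁) (P.beltPolygon B₂ p₂) ↔
      ∀ i ∈ B₁, i ∈ B₂ → ∀ j ∈ B₁, ∀ l ∈ B₁, j ≠ l → P.Adj i j → P.Adj i l →
        ∀ q ∈ B₂, ∀ r ∈ B₂, q ≠ r → P.Adj i q → P.Adj i r →
        0 < P.side i (p₁ i j) (p₁ i l) (p₂ i q) * P.side i (p₁ i j) (p₁ i l) (p₂ i r) := by
  constructor
  · intro hd i hi₁ hi₂ j hj l hl hjl hij hil q hq r hr hqr hiq hir
    rw [← disjoint_chords_iff hij.1 hil.1 hjl hiq.1 hir.1 (h₁.2 i hi₁ j hj hij)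
      (h₁.2 i hi₁ l hl hil) (h₂.2 i hi₂ q hq hiq) (h₂.2 i hi₂ r hr hir)]
    refine hd.mono (fun x hx => ?_) fun x hx => ?_
    · exact ⟨i, hi₁, j, hj, l, hl, hjl, hij, hil, hx⟩
    · exact ⟨i, hi₂, q, hq, r, hr, hqr, hiq, hir, hx⟩
  · intro h
    rw [Set.disjoint_left]
    rintro x ⟨i, hi, j, hj, l, hl, hjl, hij, hil, hx⟩ ⟨i', hi', q, hq, r, hr, hqr, hiq, hir, hx'⟩
    by_cases hii : i = i'
    · subst hii
      have := (disjoint_chords_iff hij.1 hil.1 hjl hiq.1 hir.1 (h₁.2 i hi j hj hij)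
        (h₁.2 i hi l hl hil) (h₂.2 i hi' q hq hiq) (h₂.2 i hi' r hr hir)).2
        (h i hi hi' j hj l hl hjl hij hil q hq r hr hqr hiq hir)
      exact Set.disjoint_left.1 this hx hx'
    · have hxi := (mem_facet_of_mem_segment (mem_facet_left (h₁.2 i hi j hj hij))
        (mem_facet_left (h₁.2 i hi l hl hil)) hx).2
      have hxi' := (mem_facet_of_mem_segment (mem_facet_left (h₂.2 i' hi' q hq hiq))
        (mem_facet_left (h₂.2 i' hi' r hr hir)) hx').2
      obtain ⟨hB1, hadj, e1⟩ := eq_of_mem_two_facets h₁ hi hj hl hjl hij hil hx hxi' (Ne.symm hii)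
      obtain ⟨hB2, -, e2⟩ := eq_of_mem_two_facets h₂ hi' hq hr hqr hiq hir hx' hxi hii
      obtain ⟨l₁, hl₁, hne₁, hadj₁, -⟩ := hB₁.exists_other_neighbour hi hB1 hadj
      obtain ⟨l₂, hl₂, hne₂, hadj₂, -⟩ := hB₂.exists_other_neighbour hB2 hi' hadj
      have := h i hi hB2 i' hB1 l₁ hl₁ hne₁ hadj hadj₁ i' hi' l₂ hl₂ hne₂ hadj hadj₂
      rw [h₂.1 i i', ← e2, ← e1, side_left, zero_mul] at this
      exact this.false

/-! ### Parametrization of polygons -/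

/-- The hat function on the circle `ℝ / ℤ` that is `1` at `s / k`, vanishes at distance at least
`1 / k` from it, and is linear in between. -/
noncomputable def hat (k : ℕ) (s : ZMod k) (θ : UnitAddCircle) : ℝ :=
  max 0 (1 - k * ‖θ - ((s.val / k : ℝ) : UnitAddCircle)‖)

lemma continuous_hat (k : ℕ) (s : ZMod k) : Continuous (hat k s) := by
  unfold hat
  fun_prop

/-- The closed polygonal line with vertices `v s` as a function on the circle. -/
noncomputable def polygonMap {k : ℕ} [NeZero k] (v : ZMod k → E3) (θ : UnitAddCircle) : E3 :=
  ∑ s, hat k s θ • v s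

lemma exists_circle_coord {k : ℕ} [NeZero k] (θ : UnitAddCircle) :
    ∃ s : ZMod k, ∃ f : ℝ, 0 ≤ f ∧ f < 1 ∧ θ = (((s.val + f) / k : ℝ) : UnitAddCircle) := by
  have hk : (0 : ℝ) < k := Nat.cast_pos.2 (NeZero.pos k)
  induction θ using QuotientAddGroup.induction_on with
  | H x =>
    set y := Int.fract x with hy
    have hy0 : 0 ≤ y := Int.fract_nonneg x
    have hy1 : y < 1 := Int.fract_lt_one x
    have hfl : 0 ≤ k * y := by positivity
    have hlt : ⌊k * y⌋₊ < k := by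
      rw [Nat.floor_lt hfl]
      nlinarith
    refine ⟨(⌊k * y⌋₊ : ZMod k), k * y - ⌊k * y⌋₊, ?_, ?_, ?_⟩
    · linarith [Nat.floor_le hfl]
    · linarith [Nat.lt_floor_add_one (k * y)]
    · rw [ZMod.val_natCast_of_lt hlt]
      have : ((⌊k * y⌋₊ + (k * y - ⌊k * y⌋₊)) / k : ℝ) = y := by field_simp; ring
      rw [this, hy]
      have e : x = Int.fract x + ⌊x⌋ := (Int.fract_add_floor x).symm
      conv_lhs => rw [e]
      change ((Int.fract x + ⌊x⌋ : ℝ) : UnitAddCircle) = _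
      rw [AddCircle.coe_add]
      have : ((⌊x⌋ : ℝ) : UnitAddCircle) = 0 := by
        rw [AddCircle.coe_eq_zero_iff]
        exact ⟨⌊x⌋, by simp⟩
      rw [this, add_zero]

/-- The value of a hat function in terms of the distance to the nearest representative. -/
lemma hat_eq {k : ℕ} [NeZero k] (s r : ZMod k) {f d : ℝ} (hd0 : 0 ≤ d) (hd1 : d ≤ 1)
    (hex : d = 1 ∨ ∃ m : ℤ, (m : ZMod k) = s - r ∧ |f + m| = d)
    (hmin : ∀ m : ℤ, (m : ZMod k) = s - r → d ≤ |f + m|) :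
    hat k r (((s.val + f) / k : ℝ) : UnitAddCircle) = 1 - d := by
  have hk : (0 : ℝ) < k := Nat.cast_pos.2 (NeZero.pos k)
  unfold hat
  rw [← AddCircle.coe_sub, UnitAddCircle.norm_eq]
  set z : ℝ := (s.val + f) / k - r.val / k with hz
  have hkz : ∀ n : ℤ, k * |z - n| = |f + ((s.val - r.val - n * k : ℤ) : ℝ)| := by
    intro n
    rw [← abs_of_pos hk, ← abs_mul]
    congr 1
    rw [hz]
    push_cast
    field_simp
    ring
  have hcast : ∀ n : ℤ, ((s.val - r.val - n * k : ℤ) : ZMod k) = s - r := by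
    intro n
    push_cast
    simp
  have h1 : d ≤ k * |z - round z| := by
    rw [hkz]
    exact hmin _ (hcast _)
  rcases hex with rfl | ⟨m, hm, hmd⟩
  · rw [max_eq_left (by linarith)]; ring
  · have h2 : k * |z - round z| ≤ d := by
      have hdvd : (k : ℤ) ∣ (s.val - r.val : ℤ) - m := by
        rw [← ZMod.intCast_zmod_eq_zero_iff_dvd]
        push_cast
        rw [hm]
        simp
      obtain ⟨n, hn⟩ := hdvd
      have := round_le z n
      calc k * |z - round z| ≤ k * |z - n| := by gcongr
        _ = d := by
          rw [hkz, ← hmd]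
          congr 3
          linarith [mul_comm (k : ℤ) n]
    rw [le_antisymm h2 h1, max_eq_right (by linarith)]

lemma polygonMap_apply {k : ℕ} [NeZero k] (hk : 3 ≤ k) (v : ZMod k → E3) (s : ZMod k) {f : ℝ}
    (hf0 : 0 ≤ f) (hf1 : f ≤ 1) :
    polygonMap v (((s.val + f) / k : ℝ) : UnitAddCircle) = (1 - f) • v s + f • v (s + 1) := by
  have key : ∀ (m : ℤ) (a : ℤ), (m : ZMod k) = a → |a| ≤ 1 → m ≠ a → m ≤ a - 3 ∨ a + 3 ≤ m := by
    intro m a hm ha hne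
    obtain ⟨n, hn⟩ := (ZMod.intCast_eq_intCast_iff_dvd_sub a m k).1 hm.symm
    have hk' : (3 : ℤ) ≤ k := by exact_mod_cast hk
    rcases lt_trichotomy n 0 with h | h | h
    · left; nlinarith
    · subst h; exact absurd (by linarith) hne
    · right; nlinarith
  have h0 : hat k s (((s.val + f) / k : ℝ) : UnitAddCircle) = 1 - f := by
    refine hat_eq s s hf0 hf1 (Or.inr ⟨0, by simp, by simp [abs_of_nonneg hf0]⟩) ?_
    intro m hm
    rw [sub_self] at hm
    by_cases h : m = 0
    · subst h; simp [abs_of_nonneg hf0]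
    · rcases key m 0 (by simpa using hm) (by norm_num) h with h | h
      · have h' : (m : ℝ) ≤ -3 := by exact_mod_cast (by linarith : m ≤ -3)
        rw [abs_of_neg (by linarith)]; linarith
      · have h' : (3 : ℝ) ≤ m := by exact_mod_cast (by linarith : (3 : ℤ) ≤ m)
        rw [abs_of_pos (by linarith)]; linarith
  have h1 : hat k (s + 1) (((s.val + f) / k : ℝ) : UnitAddCircle) = f := by
    have : hat k (s + 1) (((s.val + f) / k : ℝ) : UnitAddCircle) = 1 - (1 - f) := by
      refine hat_eq s (s + 1) (by linarith) (by linarith) (Or.inr ⟨-1, by simp, ?_⟩) ?_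
      · push_cast
        rw [abs_of_nonpos (by linarith)]; ring
      intro m hm
      by_cases h : m = -1
      · subst h
        push_cast
        rw [abs_of_nonpos (by linarith)]; linarith
      · rcases key m (-1) (by rw [hm]; simp) (by norm_num) h with h | h
        · have h' : (m : ℝ) ≤ -4 := by exact_mod_cast (by linarith : m ≤ -4)
          rw [abs_of_neg (by linarith)]; linarith
        · have h' : (2 : ℝ) ≤ m := by exact_mod_cast (by linarith : (2 : ℤ) ≤ m)
          rw [abs_of_pos (by linarith)]; linarith
    rw [this]; ring
  have h2 : ∀ r, r ≠ s → r ≠ s + 1 → hat k r (((s.val + f) / k : ℝ) : UnitAddCircle) = 0 := by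
    intro r hrs hrs1
    have : hat k r (((s.val + f) / k : ℝ) : UnitAddCircle) = 1 - 1 := by
      refine hat_eq s r zero_le_one le_rfl (Or.inl rfl) ?_
      intro m hm
      have hm0 : m ≠ 0 := by
        rintro rfl
        apply hrs
        push_cast at hm
        linear_combination hm
      have hm1 : m ≠ -1 := by
        rintro rfl
        apply hrs1
        push_cast at hm
        linear_combination hm
      rcases (by omega : m ≤ -2 ∨ 1 ≤ m) with h | h
      · have h' : (m : ℝ) ≤ -2 := by exact_mod_cast h
        rw [abs_of_neg (by linarith)]; linarith
      · have h' : (1 : ℝ) ≤ m := by exact_mod_cast h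
        rw [abs_of_pos (by linarith)]; linarith
    rw [this]; ring
  have hne : s ≠ s + 1 := by
    intro h
    apply two_ne_zero_zmod hk
    linear_combination -2 * h
  unfold polygonMap
  rw [← Finset.sum_subset (Finset.subset_univ {s, s + 1})]
  · rw [Finset.sum_pair hne, h0, h1]
  · intro r _ hr
    simp only [Finset.mem_insert, Finset.mem_singleton, not_or] at hr
    rw [h2 r hr.1 hr.2, zero_smul]

/-- The vertices of a polygon of a belt, in the order of the belt, where the `s`-th side lies in the
`s`-th facet. -/
def cycleVertex {k : ℕ} (c : ZMod k → Fin P.m) (p : Fin P.m → Fin P.m → E3) (s : ZMod k) : E3 :=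
  p (c s) (c (s - 1))

lemma beltPolygon_eq_cycle {B : Finset (Fin P.m)} {k : ℕ} (hk : 3 ≤ k) {c : ZMod k → Fin P.m}
    (hc : Function.Injective c) (hr : Set.range c = (B : Set (Fin P.m)))
    (ha : ∀ s t, P.Adj (c s) (c t) ↔ t = s + 1 ∨ s = t + 1) {p : Fin P.m → Fin P.m → E3}
    (hp : ∀ i j, p i j = p j i) :
    P.beltPolygon B p = ⋃ s, segment ℝ (cycleVertex c p s) (cycleVertex c p (s + 1)) := by
  have hmem : ∀ x, x ∈ B ↔ ∃ s, c s = x := fun x => by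
    rw [← Finset.mem_coe, ← hr, Set.mem_range]
  have hv : ∀ s, cycleVertex c p (s + 1) = p (c s) (c (s + 1)) := fun s => by
    rw [cycleVertex, add_sub_cancel_right, hp]
  ext x
  rw [Set.mem_iUnion]
  constructor
  · rintro ⟨i, hi, j, hj, l, hl, hjl, hij, hil, hx⟩
    obtain ⟨s, rfl⟩ := (hmem i).1 hi
    obtain ⟨t, rfl⟩ := (hmem j).1 hj
    obtain ⟨u, rfl⟩ := (hmem l).1 hl
    refine ⟨s, ?_⟩
    rw [hv, cycleVertex]
    rcases (ha _ _).1 hij with rfl | rfl <;> rcases (ha _ _).1 hil with h | h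
    · exact absurd (congrArg c h.symm) hjl
    · rw [segment_symm, show s - 1 = u by rw [h]; ring]; exact hx
    · rw [add_sub_cancel_right, ← h]; exact hx
    · exact absurd (congrArg c (add_right_cancel h)) hjl
  · rintro ⟨s, hx⟩
    rw [hv] at hx
    refine ⟨c s, (hmem _).2 ⟨_, rfl⟩, c (s - 1), (hmem _).2 ⟨_, rfl⟩, c (s + 1),
      (hmem _).2 ⟨_, rfl⟩, fun h => two_ne_zero_zmod hk ?_, (ha _ _).2 (Or.inr (by ring)),
      (ha _ _).2 (Or.inl rfl), hx⟩
    linear_combination -(hc h)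

lemma range_polygonMap {k : ℕ} [NeZero k] (hk : 3 ≤ k) (v : ZMod k → E3) :
    Set.range (polygonMap v) = ⋃ s, segment ℝ (v s) (v (s + 1)) := by
  ext x
  rw [Set.mem_iUnion]
  constructor
  · rintro ⟨θ, rfl⟩
    obtain ⟨s, f, hf0, hf1, rfl⟩ := exists_circle_coord (k := k) θ
    rw [polygonMap_apply hk v s hf0 hf1.le]
    exact ⟨s, 1 - f, f, by linarith, hf0, by ring, rfl⟩
  · rintro ⟨s, a, b, ha, hb, hab, rfl⟩
    obtain rfl : a = 1 - b := by linarith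
    exact ⟨_, polygonMap_apply hk v s hb (by linarith)⟩

lemma injective_polygonMap {B : Finset (Fin P.m)} {k : ℕ} [NeZero k] (hk : 3 ≤ k)
    {c : ZMod k → Fin P.m} (hc : Function.Injective c) (hr : Set.range c = (B : Set (Fin P.m)))
    (ha : ∀ s t, P.Adj (c s) (c t) ↔ t = s + 1 ∨ s = t + 1) {p : Fin P.m → Fin P.m → E3}
    (hp : P.IsEdgeChoice B p) : Function.Injective (polygonMap (cycleVertex c p)) := by
  have hcB : ∀ s, c s ∈ B := fun s => by rw [← Finset.mem_coe, ← hr]; exact ⟨s, rfl⟩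
  have h2 := two_ne_zero_zmod hk
  have hv : ∀ s, cycleVertex c p s ∈ P.openEdge (c s) (c (s - 1)) := fun s =>
    hp.2 _ (hcB _) _ (hcB _) ((ha _ _).2 (Or.inr (by ring)))
  have hv' : ∀ s, cycleVertex c p (s + 1) ∈ P.openEdge (c s) (c (s + 1)) := fun s => by
    have := hv (s + 1)
    rwa [add_sub_cancel_right, openEdge_comm] at this
  have hne : ∀ s, c (s - 1) ≠ c (s + 1) := fun s h => h2 (by linear_combination -(hc h))
  have hadj : ∀ s, c s ≠ c (s - 1) := fun s => ((ha _ _).2 (Or.inr (by ring))).1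
  -- the facets through a point of the polygon determine its position up to the parameter `f`
  have tight : ∀ s (f : ℝ), 0 ≤ f → f < 1 → ∀ r,
      inner ℝ (P.normal (c r)) ((1 - f) • cycleVertex c p s + f • cycleVertex c p (s + 1))
        = P.offset (c r) → r = s ∨ r = s - 1 := by
    intro s f hf0 hf1 r hr'
    rcases hf0.eq_or_lt with rfl | hf
    · rw [sub_zero, one_smul, zero_smul, add_zero] at hr'
      exact (((hv s).2 _).1 hr').imp (fun h => hc h) (fun h => hc h)
    · obtain ⟨h1, h3⟩ := tight_of_tight_combination (hv s).1 (hv' s).1 (by linarith) hf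
        (by ring) hr'
      rcases ((hv s).2 _).1 h1 with h | h
      · exact Or.inl (hc h)
      · rcases ((hv' s).2 _).1 h3 with h' | h'
        · exact Or.inl (hc h')
        · exact absurd (h.symm.trans h') (hne s)
  have self : ∀ s (f : ℝ), inner ℝ (P.normal (c s))
      ((1 - f) • cycleVertex c p s + f • cycleVertex c p (s + 1)) = P.offset (c s) := by
    intro s f
    rw [inner_add_right, inner_smul_right, inner_smul_right, (mem_facet_left (hv s)).2,
      (mem_facet_left (hv' s)).2]
    ring
  intro θ θ' heq
  obtain ⟨s, f, hf0, hf1, rfl⟩ := exists_circle_coord (k := k) θ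
  obtain ⟨s', f', hf0', hf1', rfl⟩ := exists_circle_coord (k := k) θ'
  rw [polygonMap_apply hk _ s hf0 hf1.le, polygonMap_apply hk _ s' hf0' hf1'.le] at heq
  have hs : s = s' := by
    rcases tight s f hf0 hf1 s' (heq ▸ self s' f') with h | h
    · exact h.symm
    rcases tight s' f' hf0' hf1' s (heq ▸ self s f) with h' | h'
    · exact h'
    · exact absurd (by linear_combination h + h') h2
  subst hs
  have hvne : cycleVertex c p s ≠ cycleVertex c p (s + 1) :=
    ne_of_mem_openEdge (hne s) (hadj s) (hv s) (hv' s)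
  have h0 : (f - f') • (cycleVertex c p (s + 1) - cycleVertex c p s) = 0 := by
    have := sub_eq_zero.2 heq
    rw [← this]
    module
  rcases smul_eq_zero.1 h0 with h | h
  · rw [sub_eq_zero.1 h]
  · exact absurd (sub_eq_zero.1 h).symm hvne

/-- Moving the vertices of the polygon of a belt linearly inside the edges is an isotopy of embedded
circles. -/
lemma IsBelt.exists_isotopy {B : Finset (Fin P.m)} (hB : P.IsBelt B)
    {p q : Fin P.m → Fin P.m → E3} (hp : P.IsEdgeChoice B p) (hq : P.IsEdgeChoice B q) :
    ∃ H : unitInterval → UnitAddCircle → E3,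
      (Continuous fun z : unitInterval × UnitAddCircle => H z.1 z.2) ∧
      (∀ t, Function.Injective (H t)) ∧
      ∀ t : unitInterval, Set.range (H t) =
        P.beltPolygon B fun i j => AffineMap.lineMap (p i j) (q i j) (t : ℝ) := by
  obtain ⟨k, hk, c, hc, hr, ha, -⟩ := hB
  have : NeZero k := ⟨by omega⟩
  refine ⟨fun t => polygonMap (cycleVertex c fun i j => AffineMap.lineMap (p i j) (q i j) (t : ℝ)),
    ?_, fun t => injective_polygonMap hk hc hr ha (hp.lineMap hq t.2), fun t => ?_⟩
  · unfold polygonMap cycleVertex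
    refine continuous_finsetSum _ fun s _ => ?_
    refine ((continuous_hat k s).comp continuous_snd).smul ?_
    exact AffineMap.lineMap_continuous.comp (continuous_subtype_val.comp continuous_fst)
  · rw [range_polygonMap hk, beltPolygon_eq_cycle hk hc hr ha (hp.lineMap hq t.2).1]

lemma isSimpleClosedCurve_beltPolygon {B : Finset (Fin P.m)} (hB : P.IsBelt B)
    {p : Fin P.m → Fin P.m → E3} (hp : P.IsEdgeChoice B p) :
    IsSimpleClosedCurve (P.beltPolygon B p) := by
  obtain ⟨H, hc, hi, hr⟩ := hB.exists_isotopy hp hp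
  refine ⟨H 0, ?_, hi 0, ?_⟩
  · exact hc.comp (continuous_const.prodMk continuous_id)
  · rw [hr]
    simp

lemma isBeltCurve_iff {B : Finset (Fin P.m)} (hB : P.IsBelt B) {C : Set E3} :
    P.IsBeltCurve B C ↔ ∃ p, P.IsEdgeChoice B p ∧ C = P.beltPolygon B p := by
  constructor
  · rintro ⟨-, p, hs, hp, rfl⟩
    exact ⟨p, ⟨hs, fun i hi j hj h => intrinsicInterior_eq_openEdge h ▸ hp i hi j hj h⟩, rfl⟩
  · rintro ⟨p, hp, rfl⟩
    exact ⟨isSimpleClosedCurve_beltPolygon hB hp, p, hp.1,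
      fun i hi j hj h => (intrinsicInterior_eq_openEdge h).symm ▸ hp.2 i hi j hj h, rfl⟩

end SimplePolytope3

lemma sign_eq_of_mul_pos {a b : ℝ} (h : 0 < a * b) : SignType.sign a = SignType.sign b := by
  rcases pos_and_pos_or_neg_and_neg_of_mul_pos h with ⟨ha, hb⟩ | ⟨ha, hb⟩
  · rw [sign_pos ha, sign_pos hb]
  · rw [sign_neg ha, sign_neg hb]

lemma mul_pos_of_sign_eq {a b : ℝ} (h : SignType.sign a = SignType.sign b) (ha : a ≠ 0) :
    0 < a * b := by
  rcases lt_or_gt_of_ne ha with ha | ha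
  · rw [sign_neg ha] at h
    exact mul_pos_of_neg_of_neg ha (sign_eq_neg_one_iff.1 h.symm)
  · rw [sign_pos ha] at h
    exact mul_pos ha (sign_eq_one_iff.1 h.symm)

namespace SimplePolytope3

variable {P : SimplePolytope3}

/-! ### Parallel runs of two belts -/

/-- Two different belts that run through a common edge diverge sooner or later. Hence a relation
between them that is inherited along their common run and excluded where they diverge holds
nowhere. -/
lemma not_of_parallel {B₁ B₂ : Finset (Fin P.m)} (hB₁ : P.IsBelt B₁) (hB₂ : P.IsBelt B₂)
    (hne : B₁ ≠ B₂) {Q : Fin P.m → Fin P.m → Prop}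
    (hstep : ∀ i ∈ B₁, i ∈ B₂ → ∀ j ∈ B₁, j ∈ B₂ → ∀ l ∈ B₁, l ∈ B₂ → j ≠ l →
      P.Adj i j → P.Adj i l → Q i j → Q l i)
    (hdiv : ∀ i ∈ B₁, i ∈ B₂ → ∀ j ∈ B₁, j ∈ B₂ → ∀ l₁ ∈ B₁, ∀ l₂ ∈ B₂, j ≠ l₁ → j ≠ l₂ → l₁ ≠ l₂ →
      P.Adj i j → P.Adj i l₁ → P.Adj i l₂ → ¬ Q i j)
    {i j : Fin P.m} (hi₁ : i ∈ B₁) (hi₂ : i ∈ B₂) (hj₁ : j ∈ B₁) (hj₂ : j ∈ B₂) (hij : P.Adj i j) :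
    ¬ Q i j := by
  intro hQ
  apply hne
  apply Finset.Subset.antisymm
  · intro x hx
    obtain ⟨-, -, -, h, -⟩ := hB₁.propagate (Q := fun i j => i ∈ B₂ ∧ j ∈ B₂ ∧ Q i j)
      (fun i hi j hj l hl hjl hij hil ⟨hi', hj', hq⟩ => by
        obtain ⟨l', hl', hjl', hil', -⟩ := hB₂.exists_other_neighbour hi' hj' hij
        by_cases hll : l = l'
        · subst hll
          exact ⟨hl', hi', hstep i hi hi' j hj hj' l hl hl' hjl hij hil hq⟩
        · exact absurd hq (hdiv i hi hi' j hj hj' l hl l' hl' hjl hjl' hll hij hil hil'))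
      hi₁ hj₁ hij ⟨hi₂, hj₂, hQ⟩ x hx
    exact h
  · intro x hx
    obtain ⟨-, -, -, h, -⟩ := hB₂.propagate (Q := fun i j => i ∈ B₁ ∧ j ∈ B₁ ∧ Q i j)
      (fun i hi j hj l hl hjl hij hil ⟨hi', hj', hq⟩ => by
        obtain ⟨l', hl', hjl', hil', -⟩ := hB₁.exists_other_neighbour hi' hj' hij
        by_cases hll : l = l'
        · subst hll
          exact ⟨hl', hi', hstep i hi' hi j hj' hj l hl' hl hjl hij hil hq⟩
        · exact absurd hq
            (hdiv i hi' hi j hj' hj l' hl' l hl hjl' hjl (Ne.symm hll) hij hil' hil))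
      hi₂ hj₂ hij ⟨hi₁, hj₁, hQ⟩ x hx
    exact h

lemma sign_side_first {i j l : Fin P.m} (hij : i ≠ j) (hjl : j ≠ l) {x y z : E3}
    (hx : x ∈ P.openEdge i j) (hy : y ∈ P.openEdge i l) (hz : z ∈ P.openEdge i j) :
    SignType.sign (P.side i x y z) = -SignType.sign (P.along i j x z) :=
  sign_side_eq_neg_sign_along hij hx (mem_facet_left hy) (lt_of_mem_openEdge hjl hij hy) hz

lemma sign_side_second {i j l : Fin P.m} (hil : i ≠ l) (hjl : j ≠ l) {x y z : E3}
    (hx : x ∈ P.openEdge i j) (hy : y ∈ P.openEdge i l) (hz : z ∈ P.openEdge i l) :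
    SignType.sign (P.side i x y z) = SignType.sign (P.along i l y z) := by
  rw [← neg_neg (P.side i x y z), ← side_swap, Left.sign_neg,
    sign_side_first hil hjl.symm hy hx hz, neg_neg]

/-- The orientation of a triangle with vertices on three different edges of a facet depends on the
edges only. -/
lemma sign_side_congr {i j l q : Fin P.m} (hij : i ≠ j) (hil : i ≠ l) (hjl : j ≠ l) (hiq : i ≠ q)
    (hjq : j ≠ q) (hlq : l ≠ q) {x₀ x₁ y₀ y₁ z₀ z₁ : E3} (hx₀ : x₀ ∈ P.openEdge i j)
    (hx₁ : x₁ ∈ P.openEdge i j) (hy₀ : y₀ ∈ P.openEdge i l) (hy₁ : y₁ ∈ P.openEdge i l)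
    (hz₀ : z₀ ∈ P.openEdge i q) (hz₁ : z₁ ∈ P.openEdge i q) :
    SignType.sign (P.side i x₀ y₀ z₀) = SignType.sign (P.side i x₁ y₁ z₁) := by
  have := sign_side_lineMap hij hil hjl hiq hx₀ hx₁ hy₀ hy₁ hz₀ hz₁
    (fun t ht => (ne_of_mem_openEdge hjq hij (openEdge_convex.lineMap_mem hx₀ hx₁ ht)
      (openEdge_convex.lineMap_mem hz₀ hz₁ ht)).symm)
    (fun t ht => (ne_of_mem_openEdge hlq hil (openEdge_convex.lineMap_mem hy₀ hy₁ ht)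
      (openEdge_convex.lineMap_mem hz₀ hz₁ ht)).symm)
    (s := 0) (t := 1) (by simp) (by simp)
  simpa only [AffineMap.lineMap_apply_zero, AffineMap.lineMap_apply_one] using this

/-! ### Uniqueness up to isotopy -/

lemma along_ne_zero_of_disjoint {B₁ B₂ : Finset (Fin P.m)} (hB₁ : P.IsBelt B₁) (hB₂ : P.IsBelt B₂)
    {p₁ p₂ : Fin P.m → Fin P.m → E3} (h₁ : P.IsEdgeChoice B₁ p₁) (h₂ : P.IsEdgeChoice B₂ p₂)
    (hd : Disjoint (P.beltPolygon B₁ p₁) (P.beltPolygon B₂ p₂)) {i j : Fin P.m} (hi₁ : i ∈ B₁)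
    (hi₂ : i ∈ B₂) (hj₁ : j ∈ B₁) (hj₂ : j ∈ B₂) (hij : P.Adj i j) :
    P.along i j (p₁ i j) (p₂ i j) ≠ 0 := by
  intro h0
  obtain ⟨l₁, hl₁, hjl₁, hil₁, -⟩ := hB₁.exists_other_neighbour hi₁ hj₁ hij
  obtain ⟨l₂, hl₂, hjl₂, hil₂, -⟩ := hB₂.exists_other_neighbour hi₂ hj₂ hij
  have h := (disjoint_beltPolygon_iff hB₁ hB₂ h₁ h₂).1 hd i hi₁ hi₂ j hj₁ l₁ hl₁ hjl₁ hij hil₁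
    j hj₂ l₂ hl₂ hjl₂ hij hil₂
  have hs := sign_side_first hij.1 hjl₁ (h₁.2 i hi₁ j hj₁ hij) (h₁.2 i hi₁ l₁ hl₁ hil₁)
    (h₂.2 i hi₂ j hj₂ hij)
  rw [h0, sign_zero, neg_zero, sign_eq_zero_iff] at hs
  rw [hs, zero_mul] at h
  exact h.false

/-- The order in which two disjoint curves cross a common edge is determined by their belts. -/
lemma sign_along_eq_of_disjoint {B₁ B₂ : Finset (Fin P.m)} (hB₁ : P.IsBelt B₁) (hB₂ : P.IsBelt B₂)
    (hne : B₁ ≠ B₂) {p₁ p₂ q₁ q₂ : Fin P.m → Fin P.m → E3} (hp₁ : P.IsEdgeChoice B₁ p₁)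
    (hp₂ : P.IsEdgeChoice B₂ p₂) (hq₁ : P.IsEdgeChoice B₁ q₁) (hq₂ : P.IsEdgeChoice B₂ q₂)
    (hp : Disjoint (P.beltPolygon B₁ p₁) (P.beltPolygon B₂ p₂))
    (hq : Disjoint (P.beltPolygon B₁ q₁) (P.beltPolygon B₂ q₂)) {i j : Fin P.m} (hi₁ : i ∈ B₁)
    (hi₂ : i ∈ B₂) (hj₁ : j ∈ B₁) (hj₂ : j ∈ B₂) (hij : P.Adj i j) :
    SignType.sign (P.along i j (p₁ i j) (p₂ i j)) =
      SignType.sign (P.along i j (q₁ i j) (q₂ i j)) := by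
  rw [disjoint_beltPolygon_iff hB₁ hB₂ hp₁ hp₂] at hp
  rw [disjoint_beltPolygon_iff hB₁ hB₂ hq₁ hq₂] at hq
  refine not_not.1 (not_of_parallel hB₁ hB₂ hne (Q := fun i j =>
    SignType.sign (P.along i j (p₁ i j) (p₂ i j)) ≠ SignType.sign (P.along i j (q₁ i j) (q₂ i j)))
    ?_ ?_ hi₁ hi₂ hj₁ hj₂ hij)
  · -- on a common run the order on one edge determines the order on the next one
    intro i hi₁ hi₂ j hj₁ hj₂ l hl₁ hl₂ hjl hij hil hbad heq
    apply hbad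
    have key : ∀ r₁ r₂ : Fin P.m → Fin P.m → E3, P.IsEdgeChoice B₁ r₁ → P.IsEdgeChoice B₂ r₂ →
        0 < P.side i (r₁ i j) (r₁ i l) (r₂ i j) * P.side i (r₁ i j) (r₁ i l) (r₂ i l) →
        SignType.sign (P.along i j (r₁ i j) (r₂ i j)) =
          SignType.sign (P.along l i (r₁ l i) (r₂ l i)) := by
      intro r₁ r₂ hr₁ hr₂ h
      have h := sign_eq_of_mul_pos h
      rw [sign_side_first hij.1 hjl (hr₁.2 i hi₁ j hj₁ hij) (hr₁.2 i hi₁ l hl₁ hil)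
        (hr₂.2 i hi₂ j hj₂ hij), sign_side_second hil.1 hjl (hr₁.2 i hi₁ j hj₁ hij)
        (hr₁.2 i hi₁ l hl₁ hil) (hr₂.2 i hi₂ l hl₂ hil)] at h
      rw [along_comm i l, Left.sign_neg, hr₁.1 l i, hr₂.1 l i, ← h, neg_neg]
    rw [key p₁ p₂ hp₁ hp₂ (hp i hi₁ hi₂ j hj₁ l hl₁ hjl hij hil j hj₂ l hl₂ hjl hij hil),
      key q₁ q₂ hq₁ hq₂ (hq i hi₁ hi₂ j hj₁ l hl₁ hjl hij hil j hj₂ l hl₂ hjl hij hil), heq]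
  · -- where the belts diverge, the order is determined by the cyclic order of three edges
    intro i hi₁ hi₂ j hj₁ hj₂ l₁ hl₁ l₂ hl₂ hjl₁ hjl₂ hll hij hil₁ hil₂
    rw [not_not]
    have key : ∀ r₁ r₂ : Fin P.m → Fin P.m → E3, P.IsEdgeChoice B₁ r₁ → P.IsEdgeChoice B₂ r₂ →
        0 < P.side i (r₁ i j) (r₁ i l₁) (r₂ i j) * P.side i (r₁ i j) (r₁ i l₁) (r₂ i l₂) →
        SignType.sign (P.along i j (r₁ i j) (r₂ i j)) =
          -SignType.sign (P.side i (r₁ i j) (r₁ i l₁) (r₂ i l₂)) := by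
      intro r₁ r₂ hr₁ hr₂ h
      rw [← sign_eq_of_mul_pos h, sign_side_first hij.1 hjl₁ (hr₁.2 i hi₁ j hj₁ hij)
        (hr₁.2 i hi₁ l₁ hl₁ hil₁) (hr₂.2 i hi₂ j hj₂ hij), neg_neg]
    rw [key p₁ p₂ hp₁ hp₂ (hp i hi₁ hi₂ j hj₁ l₁ hl₁ hjl₁ hij hil₁ j hj₂ l₂ hl₂ hjl₂ hij hil₂),
      key q₁ q₂ hq₁ hq₂ (hq i hi₁ hi₂ j hj₁ l₁ hl₁ hjl₁ hij hil₁ j hj₂ l₂ hl₂ hjl₂ hij hil₂)]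
    rw [sign_side_congr hij.1 hil₁.1 hjl₁ hil₂.1 hjl₂ hll (hp₁.2 i hi₁ j hj₁ hij)
      (hq₁.2 i hi₁ j hj₁ hij) (hp₁.2 i hi₁ l₁ hl₁ hil₁) (hq₁.2 i hi₁ l₁ hl₁ hil₁)
      (hp₂.2 i hi₂ l₂ hl₂ hil₂) (hq₂.2 i hi₂ l₂ hl₂ hil₂)]

/-- Points moving linearly along edges do not meet if their orders at both ends agree. -/
lemma lineMap_ne_of_sign_along {i j : Fin P.m} {x₀ x₁ z₀ z₁ : E3} (h0 : P.along i j x₀ z₀ ≠ 0)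
    (h : SignType.sign (P.along i j x₀ z₀) = SignType.sign (P.along i j x₁ z₁)) {t : ℝ}
    (ht : t ∈ Set.Icc (0 : ℝ) 1) : AffineMap.lineMap z₀ z₁ t ≠ AffineMap.lineMap x₀ x₁ t := by
  intro heq
  have h1 := along_lineMap (P := P) i j x₀ x₁ z₀ z₁ t
  rw [heq, show ∀ x, P.along i j x x = 0 by intro x; simp [along, det3]] at h1
  obtain ⟨ht0, ht1⟩ := ht
  have hpos := mul_pos_of_sign_eq h h0
  set a := P.along i j x₀ z₀
  set b := P.along i j x₁ z₁
  have h2 : 0 = (1 - t) * (a * a) + t * (a * b) := by linear_combination a * h1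
  have ha : 0 < a * a := mul_self_pos.2 h0
  rcases ht0.eq_or_lt with rfl | ht0
  · linarith
  · nlinarith [mul_pos ht0 hpos, mul_nonneg (sub_nonneg.2 ht1) ha.le]

/-- Linear motion of the vertices keeps the polygons of two belts disjoint. -/
lemma disjoint_lineMap {B₁ B₂ : Finset (Fin P.m)} (hB₁ : P.IsBelt B₁) (hB₂ : P.IsBelt B₂)
    (hne : B₁ ≠ B₂) {p₁ p₂ q₁ q₂ : Fin P.m → Fin P.m → E3} (hp₁ : P.IsEdgeChoice B₁ p₁)
    (hp₂ : P.IsEdgeChoice B₂ p₂) (hq₁ : P.IsEdgeChoice B₁ q₁) (hq₂ : P.IsEdgeChoice B₂ q₂)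
    (hp : Disjoint (P.beltPolygon B₁ p₁) (P.beltPolygon B₂ p₂))
    (hq : Disjoint (P.beltPolygon B₁ q₁) (P.beltPolygon B₂ q₂)) {t : ℝ}
    (ht : t ∈ Set.Icc (0 : ℝ) 1) :
    Disjoint (P.beltPolygon B₁ fun i j => AffineMap.lineMap (p₁ i j) (q₁ i j) t)
      (P.beltPolygon B₂ fun i j => AffineMap.lineMap (p₂ i j) (q₂ i j) t) := by
  rw [disjoint_beltPolygon_iff hB₁ hB₂ (hp₁.lineMap hq₁ ht) (hp₂.lineMap hq₂ ht)]
  intro i hi₁ hi₂ j hj l hl hjl hij hil q hq' r hr hqr hiq hir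
  -- vertices of the two polygons never meet during the motion
  have hmeet : ∀ a ∈ B₁, P.Adj i a → ∀ b ∈ B₂, P.Adj i b → ∀ t ∈ Set.Icc (0 : ℝ) 1,
      AffineMap.lineMap (p₂ i b) (q₂ i b) t ≠ AffineMap.lineMap (p₁ i a) (q₁ i a) t := by
    intro a ha hia b hb hib t ht
    by_cases hab : a = b
    · subst hab
      exact lineMap_ne_of_sign_along
        (along_ne_zero_of_disjoint hB₁ hB₂ hp₁ hp₂ hp hi₁ hi₂ ha hb hia)
        (sign_along_eq_of_disjoint hB₁ hB₂ hne hp₁ hp₂ hq₁ hq₂ hp hq hi₁ hi₂ ha hb hia) ht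
    · exact (ne_of_mem_openEdge hab hia.1
        (openEdge_convex.lineMap_mem (hp₁.2 i hi₁ a ha hia) (hq₁.2 i hi₁ a ha hia) ht)
        (openEdge_convex.lineMap_mem (hp₂.2 i hi₂ b hb hib) (hq₂.2 i hi₂ b hb hib) ht)).symm
  have hconst : ∀ b ∈ B₂, P.Adj i b →
      SignType.sign (P.side i (p₁ i j) (p₁ i l) (p₂ i b)) =
        SignType.sign (P.side i (AffineMap.lineMap (p₁ i j) (q₁ i j) t)
          (AffineMap.lineMap (p₁ i l) (q₁ i l) t) (AffineMap.lineMap (p₂ i b) (q₂ i b) t)) := by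
    intro b hb hib
    have := sign_side_lineMap hij.1 hil.1 hjl hib.1 (hp₁.2 i hi₁ j hj hij) (hq₁.2 i hi₁ j hj hij)
      (hp₁.2 i hi₁ l hl hil) (hq₁.2 i hi₁ l hl hil) (hp₂.2 i hi₂ b hb hib) (hq₂.2 i hi₂ b hb hib)
      (hmeet j hj hij b hb hib) (hmeet l hl hil b hb hib) (s := 0) (by simp) ht
    simpa only [AffineMap.lineMap_apply_zero] using this
  have h0 := (disjoint_beltPolygon_iff hB₁ hB₂ hp₁ hp₂).1 hp i hi₁ hi₂ j hj l hl hjl hij hil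
    q hq' r hr hqr hiq hir
  refine mul_pos_of_sign_eq ?_ ?_
  · rw [← hconst q hq' hiq, ← hconst r hr hir]
    exact sign_eq_of_mul_pos h0
  · intro hz
    have h1 := hconst q hq' hiq
    rw [hz, sign_zero, sign_eq_zero_iff] at h1
    rw [h1, zero_mul] at h0
    exact h0.false

theorem IsNestedCurves.isotopicInClass {𝓑 : Set (Finset (Fin P.m))} (h𝓑 : ∀ B ∈ 𝓑, P.IsBelt B)
    {Γ Γ' : Finset (Fin P.m) → Set E3} (hΓ : P.IsNestedCurves 𝓑 Γ) (hΓ' : P.IsNestedCurves 𝓑 Γ') :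
    P.IsotopicInClass 𝓑 Γ Γ' := by
  have hp : ∀ B, ∃ p, B ∈ 𝓑 → P.IsEdgeChoice B p ∧ Γ B = P.beltPolygon B p := by
    intro B
    by_cases h : B ∈ 𝓑
    · obtain ⟨p, hp⟩ := (isBeltCurve_iff (h𝓑 B h)).1 (hΓ.1 B h)
      exact ⟨p, fun _ => hp⟩
    · exact ⟨P.edgeMid, fun h' => absurd h' h⟩
  have hq : ∀ B, ∃ q, B ∈ 𝓑 → P.IsEdgeChoice B q ∧ Γ' B = P.beltPolygon B q := by
    intro B
    by_cases h : B ∈ 𝓑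
    · obtain ⟨p, hp⟩ := (isBeltCurve_iff (h𝓑 B h)).1 (hΓ'.1 B h)
      exact ⟨p, fun _ => hp⟩
    · exact ⟨P.edgeMid, fun h' => absurd h' h⟩
  choose p hp using hp
  choose q hq using hq
  have hH : ∀ B, ∃ H : unitInterval → UnitAddCircle → E3, B ∈ 𝓑 →
      (Continuous fun z : unitInterval × UnitAddCircle => H z.1 z.2) ∧
      (∀ t, Function.Injective (H t)) ∧
      ∀ t : unitInterval, Set.range (H t) =
        P.beltPolygon B fun i j => AffineMap.lineMap (p B i j) (q B i j) (t : ℝ) := by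
    intro B
    by_cases h : B ∈ 𝓑
    · obtain ⟨H, hH⟩ := (h𝓑 B h).exists_isotopy (hp B h).1 (hq B h).1
      exact ⟨H, fun _ => hH⟩
    · exact ⟨fun _ _ => 0, fun h' => absurd h' h⟩
  choose H hH using hH
  refine ⟨H, fun B h => (hH B h).1, fun B h => (hH B h).2.1, fun t => ⟨fun B h => ?_, ?_⟩,
    fun B h => ⟨?_, ?_⟩⟩
  · dsimp only
    rw [(hH B h).2.2 t]
    exact (isBeltCurve_iff (h𝓑 B h)).2 ⟨_, (hp B h).1.lineMap (hq B h).1 t.2, rfl⟩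
  · intro B₁ h₁ B₂ h₂ hne
    change Disjoint (Set.range (H B₁ t)) (Set.range (H B₂ t))
    rw [(hH B₁ h₁).2.2 t, (hH B₂ h₂).2.2 t]
    refine disjoint_lineMap (h𝓑 B₁ h₁) (h𝓑 B₂ h₂) hne (hp B₁ h₁).1 (hp B₂ h₂).1 (hq B₁ h₁).1
      (hq B₂ h₂).1 ?_ ?_ t.2
    · rw [← (hp B₁ h₁).2, ← (hp B₂ h₂).2]
      exact hΓ.2 h₁ h₂ hne
    · rw [← (hq B₁ h₁).2, ← (hq B₂ h₂).2]
      exact hΓ'.2 h₁ h₂ hne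
  · rw [(hH B h).2.2 0, (hp B h).2]
    simp
  · rw [(hH B h).2.2 1, (hq B h).2]
    simp

/-! ### The polygon of a belt separates the boundary -/

/-- A point in the relative interior of a facet, from which the boundary of the polytope is
projected to the plane, together with two linear functionals that serve as coordinates transversal
to the normal of that facet. -/
structure Viewpoint (P : SimplePolytope3) where
  /-- the facet that contains the centre of projection -/
  base : Fin P.m
  /-- the centre of projection -/
  point : E3
  /-- the first coordinate functional -/
  e₁ : E3
  /-- the second coordinate functional -/
  e₂ : E3
  tight : inner ℝ (P.normal base) point = P.offset base
  lt : ∀ j, j ≠ base → inner ℝ (P.normal j) point < P.offset j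
  det_ne_zero : det3 e₁ e₂ (P.normal base) ≠ 0

namespace Viewpoint

variable (V : P.Viewpoint)

/-- The difference of the projections of `q` and `x` from the viewpoint to the plane, multiplied by
the heights of `q` and `x` over the base facet. Clearing the denominators in this way makes sense of
it also for `x` in the base facet, which the projection sends to infinity. -/
noncomputable def diff (q x : E3) : ℂ :=
  ⟨inner ℝ V.e₁ (x - V.point) * inner ℝ (P.normal V.base) (q - V.point) -
      inner ℝ V.e₁ (q - V.point) * inner ℝ (P.normal V.base) (x - V.point),
    inner ℝ V.e₂ (x - V.point) * inner ℝ (P.normal V.base) (q - V.point) -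
      inner ℝ V.e₂ (q - V.point) * inner ℝ (P.normal V.base) (x - V.point)⟩

lemma continuous_diff (q : E3) : Continuous (V.diff q) := by
  have : V.diff q = fun x => Complex.equivRealProdCLM.symm
      (inner ℝ V.e₁ (x - V.point) * inner ℝ (P.normal V.base) (q - V.point) -
        inner ℝ V.e₁ (q - V.point) * inner ℝ (P.normal V.base) (x - V.point),
      inner ℝ V.e₂ (x - V.point) * inner ℝ (P.normal V.base) (q - V.point) -
        inner ℝ V.e₂ (q - V.point) * inner ℝ (P.normal V.base) (x - V.point)) := rfl
  rw [this]
  fun_prop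

lemma diff_combination (q r x : E3) {a b : ℝ} (hab : a + b = 1) :
    V.diff (a • q + b • r) x = a * V.diff q x + b * V.diff r x := by
  have h : a • q + b • r - V.point = a • (q - V.point) + b • (r - V.point) := by
    obtain rfl : a = 1 - b := by linarith
    module
  apply Complex.ext
  · simp only [diff, h, inner_add_right, inner_smul_right, Complex.add_re, Complex.re_ofReal_mul]
    ring
  · simp only [diff, h, inner_add_right, inner_smul_right, Complex.add_im, Complex.im_ofReal_mul]
    ring

lemma inner_sub_point_neg {q : E3}
    (hq : inner ℝ (P.normal V.base) q < P.offset V.base) :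
    inner ℝ (P.normal V.base) (q - V.point) < 0 := by
  rw [inner_sub_right, V.tight]; linarith

lemma combination_notMem_frontier {x : E3} {a b : ℝ} (ha : 0 < a) (hb : 0 < b) (hab : a + b = 1)
    (hx : x ∈ P.body) (hx' : inner ℝ (P.normal V.base) x < P.offset V.base) :
    a • V.point + b • x ∉ frontier P.body := by
  intro h
  obtain ⟨-, i, hi⟩ := mem_frontier_body.1 h
  rw [inner_add_right, inner_smul_right, inner_smul_right] at hi
  obtain rfl : b = 1 - a := by linarith
  by_cases hib : i = V.base
  · subst hib
    rw [V.tight] at hi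
    nlinarith [mul_lt_mul_of_pos_left hx' hb]
  · nlinarith [mul_lt_mul_of_pos_left (V.lt i hib) ha, mul_le_mul_of_nonneg_left (hx i) hb.le]

/-- The projection from the viewpoint is injective on the boundary outside the base facet. -/
lemma diff_ne_zero {q x : E3} (hq : q ∈ frontier P.body)
    (hq' : inner ℝ (P.normal V.base) q < P.offset V.base) (hx : x ∈ frontier P.body)
    (hxN : x ≠ V.point) (hxq : x ≠ q) : V.diff q x ≠ 0 := by
  intro h
  set hh := inner ℝ (P.normal V.base) (q - V.point) with hhdef
  set kk := inner ℝ (P.normal V.base) (x - V.point) with kkdef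
  have hneg : hh < 0 := V.inner_sub_point_neg hq'
  have hre := congrArg Complex.re h
  have him := congrArg Complex.im h
  simp only [diff, Complex.zero_re, Complex.zero_im] at hre him
  rw [← hhdef, ← kkdef] at hre him
  have hvec : hh • (x - V.point) - kk • (q - V.point) = 0 := by
    refine eq_zero_of_det3_ne_zero V.det_ne_zero ?_ ?_ ?_
    · rw [inner_sub_right, inner_smul_right, inner_smul_right]; linarith
    · rw [inner_sub_right, inner_smul_right, inner_smul_right]; linarith
    · rw [inner_sub_right, inner_smul_right, inner_smul_right, ← hhdef, ← kkdef]; ring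
  have hvec := sub_eq_zero.1 hvec
  have hxb := (mem_frontier_body.1 hx).1
  have hqb := (mem_frontier_body.1 hq).1
  have hkk : kk ≤ 0 := by
    rw [kkdef, inner_sub_right, V.tight]; linarith [hxb V.base]
  rcases hkk.eq_or_lt with hk0 | hk0
  · rw [hk0, zero_smul] at hvec
    rcases smul_eq_zero.1 hvec with h | h
    · exact hneg.ne h
    · exact hxN (sub_eq_zero.1 h)
  -- three collinear points: the middle one would be an interior point of the polytope
  rcases lt_trichotomy hh kk with hlt | heq | hlt
  · apply V.combination_notMem_frontier (a := 1 - kk / hh) (b := kk / hh)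
      (sub_pos.2 ((div_lt_one_of_neg hneg).2 hlt)) (div_pos_of_neg_of_neg hk0 hneg) (by ring)
      hqb hq'
    convert hx using 1
    have : x = V.point + (kk / hh) • (q - V.point) := by
      rw [div_eq_inv_mul, mul_smul, ← hvec, smul_smul, inv_mul_cancel₀ hneg.ne, one_smul]
      abel
    rw [this]
    module
  · rw [heq] at hvec
    have := smul_right_injective E3 hk0.ne hvec
    exact hxq (sub_left_injective this)
  · have hxlt : inner ℝ (P.normal V.base) x < P.offset V.base := by
      rw [kkdef, inner_sub_right, V.tight] at hk0; linarith
    apply V.combination_notMem_frontier (a := 1 - hh / kk) (b := hh / kk)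
      (sub_pos.2 ((div_lt_one_of_neg hk0).2 hlt)) (div_pos_of_neg_of_neg hneg hk0) (by ring)
      hxb hxlt
    convert hq using 1
    have : q = V.point + (hh / kk) • (x - V.point) := by
      rw [div_eq_inv_mul, mul_smul, hvec, smul_smul, inv_mul_cancel₀ hk0.ne, one_smul]
      abel
    rw [this]
    module

/-- Seen from the projection of `x`, a segment that does not contain `x` subtends an angle different
from `π`. -/
lemma ratio_mem_slitPlane {v v' x : E3}
    (hseg : ∀ q ∈ segment ℝ v v', q ∈ frontier P.body ∧
      inner ℝ (P.normal V.base) q < P.offset V.base)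
    (hx : x ∈ frontier P.body) (hxN : x ≠ V.point) (hxs : x ∉ segment ℝ v v') :
    V.diff v' x / V.diff v x ∈ Complex.slitPlane := by
  have hne : ∀ q ∈ segment ℝ v v', V.diff q x ≠ 0 := fun q hq =>
    V.diff_ne_zero (hseg q hq).1 (hseg q hq).2 hx hxN fun h => hxs (h ▸ hq)
  have hv := hne v (left_mem_segment ℝ v v')
  by_contra hcon
  rw [Complex.mem_slitPlane_iff, not_or, not_lt, not_not] at hcon
  set τ := -(V.diff v' x / V.diff v x).re with hτ
  have hτ0 : 0 ≤ τ := by linarith [hcon.1]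
  have heq : V.diff v' x = -τ * V.diff v x := by
    rw [← div_eq_iff hv]
    apply Complex.ext
    · simp [hτ]
    · simpa using hcon.2
  have h1 : 0 < 1 + τ := by linarith
  refine hne ((τ / (1 + τ)) • v + (1 / (1 + τ)) • v')
    ⟨_, _, by positivity, by positivity, by field_simp; ring, rfl⟩ ?_
  rw [V.diff_combination _ _ _ (by field_simp; ring), heq]
  push_cast
  have : (1 + τ : ℂ) ≠ 0 := by exact_mod_cast h1.ne'
  field_simp
  ring

/-- The total angle, `2π` times the winding number, of the projection of a closed polygonal line
around the projection of a point of the boundary. -/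
noncomputable def angle {k : ℕ} [NeZero k] (v : ZMod k → E3) (x : E3) : ℝ :=
  ∑ s, (V.diff (v (s + 1)) x / V.diff (v s) x).arg

/-- The parity of the winding number, as a sign. -/
noncomputable def parity {k : ℕ} [NeZero k] (v : ZMod k → E3) (x : E3) : ℝ :=
  Real.cos (V.angle v x / 2)

/-- The closed polygonal line with vertices `v s` lies in the boundary outside the base facet. -/
def Avoids {k : ℕ} (v : ZMod k → E3) : Prop :=
  ∀ s, ∀ q ∈ segment ℝ (v s) (v (s + 1)), q ∈ frontier P.body ∧
    inner ℝ (P.normal V.base) q < P.offset V.base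

variable {V} {k : ℕ} {v : ZMod k → E3}

lemma continuousAt_arg_ratio (hv : V.Avoids v) {x : E3} (hx : x ∈ frontier P.body)
    (hxN : x ≠ V.point) {s : ZMod k} (hxv : x ∉ segment ℝ (v s) (v (s + 1))) :
    ContinuousAt (fun x => (V.diff (v (s + 1)) x / V.diff (v s) x).arg) x := by
  have hne : V.diff (v s) x ≠ 0 :=
    V.diff_ne_zero (hv s _ (left_mem_segment ℝ _ _)).1 (hv s _ (left_mem_segment ℝ _ _)).2 hx hxN
      fun h => hxv (h ▸ left_mem_segment ℝ _ _)
  refine ContinuousAt.comp (f := fun x => V.diff (v (s + 1)) x / V.diff (v s) x)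
    (Complex.continuousAt_arg (V.ratio_mem_slitPlane (hv s) hx hxN hxv)) ?_
  exact (V.continuous_diff _).continuousAt.div (V.continuous_diff _).continuousAt hne

variable [NeZero k]

lemma angle_eq_zero_of_mem_base (hv : V.Avoids v) {x : E3}
    (hx : inner ℝ (P.normal V.base) x = P.offset V.base) : V.angle v x = 0 := by
  refine Finset.sum_eq_zero fun s _ => ?_
  have h0 : inner ℝ (P.normal V.base) (x - V.point) = 0 := by
    rw [inner_sub_right, hx, V.tight, sub_self]
  have hd : ∀ q, V.diff q x = (inner ℝ (P.normal V.base) (q - V.point) : ℝ) *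
      (⟨inner ℝ V.e₁ (x - V.point), inner ℝ V.e₂ (x - V.point)⟩ : ℂ) := by
    intro q
    apply Complex.ext
    · simp only [diff, h0, Complex.re_ofReal_mul]; ring
    · simp only [diff, h0, Complex.im_ofReal_mul]; ring
  have h1 := V.inner_sub_point_neg (hv s _ (left_mem_segment ℝ _ _)).2
  have h2 := V.inner_sub_point_neg (hv s _ (right_mem_segment ℝ _ _)).2
  rw [hd, hd]
  set w : ℂ := ⟨inner ℝ V.e₁ (x - V.point), inner ℝ V.e₂ (x - V.point)⟩
  by_cases hw : w = 0
  · rw [hw]; simp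
  · rw [mul_div_mul_right _ _ hw, ← Complex.ofReal_div]
    exact Complex.arg_ofReal_of_nonneg (div_pos_of_neg_of_neg h2 h1).le

lemma parity_eq_one_or (hv : V.Avoids v) {x : E3} (hx : x ∈ frontier P.body)
    (hxv : ∀ s, x ∉ segment ℝ (v s) (v (s + 1))) : V.parity v x = 1 ∨ V.parity v x = -1 := by
  by_cases hxN : x = V.point
  · left
    rw [parity, angle_eq_zero_of_mem_base hv (hxN ▸ V.tight)]
    simp
  have hne : ∀ s, V.diff (v s) x ≠ 0 := fun s =>
    V.diff_ne_zero (hv s _ (left_mem_segment ℝ _ _)).1 (hv s _ (left_mem_segment ℝ _ _)).2 hx hxN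
      fun h => hxv s (h ▸ left_mem_segment ℝ _ _)
  have h0 : ((V.angle v x : ℝ) : Real.Angle) = 0 := by
    unfold angle
    rw [← Real.Angle.coe_coeHom, map_sum]
    simp only [Real.Angle.coe_coeHom, Complex.arg_div_coe_angle (hne _) (hne _)]
    rw [Finset.sum_sub_distrib, sub_eq_zero]
    exact Equiv.sum_comp (Equiv.addRight (1 : ZMod k)) fun s => ((V.diff (v s) x).arg : Real.Angle)
  obtain ⟨n, hn⟩ := Real.Angle.coe_eq_zero_iff.1 h0
  have : V.angle v x / 2 = n * Real.pi := by
    rw [← hn]; simp; ring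
  rw [parity, this, Real.cos_int_mul_pi]
  exact (Int.even_or_odd n).imp (fun h => h.neg_one_zpow) (fun h => h.neg_one_zpow)

lemma continuousOn_parity (hv : V.Avoids v) : ContinuousOn (V.parity v)
    (frontier P.body \ ⋃ s, segment ℝ (v s) (v (s + 1))) := by
  intro x hx
  have hxv : ∀ s, x ∉ segment ℝ (v s) (v (s + 1)) := fun s h => hx.2 (Set.mem_iUnion.2 ⟨s, h⟩)
  by_cases hxN : x = V.point
  · -- near the viewpoint the boundary coincides with the base facet
    have hU : {y | ∀ j, j ≠ V.base → inner ℝ (P.normal j) y < P.offset j} ∈ nhds x := by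
      have : {y | ∀ j, j ≠ V.base → inner ℝ (P.normal j) y < P.offset j} =
          ⋂ j : {j // j ≠ V.base}, {y | inner ℝ (P.normal j) y < P.offset j} := by
        ext y; simp
      rw [this]
      refine (isOpen_iInter_of_finite fun j => isOpen_lt (by fun_prop) (by fun_prop)).mem_nhds ?_
      refine Set.mem_iInter.2 fun j => ?_
      rw [hxN]
      exact V.lt j j.2
    have hev : V.parity v =ᶠ[nhdsWithin x (frontier P.body \ ⋃ s, segment ℝ (v s) (v (s + 1)))]
        fun _ => 1 := by
      filter_upwards [mem_nhdsWithin_of_mem_nhds hU, self_mem_nhdsWithin] with y hy hyX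
      obtain ⟨-, i, hi⟩ := mem_frontier_body.1 hyX.1
      have hib : i = V.base := by
        by_contra h
        exact (hy i h).ne hi
      rw [parity, angle_eq_zero_of_mem_base hv (hib ▸ hi)]
      simp
    exact (continuousWithinAt_const (b := (1 : ℝ))).congr_of_eventuallyEq hev
      (hev.self_of_nhdsWithin hx)
  · refine ContinuousAt.continuousWithinAt ?_
    unfold parity
    refine Real.continuous_cos.continuousAt.comp (ContinuousAt.div_const ?_ 2)
    exact tendsto_finsetSum _ fun s _ => continuousAt_arg_ratio hv hx.1 hxN (hxv s)

end Viewpoint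

lemma det3_mul_inner_self {n u a b : E3} (ha : inner ℝ n a = 0) (hb : inner ℝ n b = 0) :
    det3 u (u + a) (u + b) * inner ℝ n n = det3 n a b * inner ℝ n u := by
  simp only [inner_eq_coords] at ha hb ⊢
  unfold det3
  simp only [PiLp.add_apply]
  linear_combination (- u 0 * (n 2 * b 1 - n 1 * b 2) - u 1 * (n 0 * b 2 - n 2 * b 0)
      - u 2 * (n 1 * b 0 - n 0 * b 1)) * ha - (u 0 * (n 1 * a 2 - n 2 * a 1)
      + u 1 * (n 2 * a 0 - n 0 * a 2) + u 2 * (n 0 * a 1 - n 1 * a 0)) * hb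

lemma det3_product (a b c x y z : E3) :
    det3 a b c * det3 x y z =
      inner ℝ a x * (inner ℝ b y * inner ℝ c z - inner ℝ c y * inner ℝ b z)
      - inner ℝ b x * (inner ℝ a y * inner ℝ c z - inner ℝ c y * inner ℝ a z)
      + inner ℝ c x * (inner ℝ a y * inner ℝ b z - inner ℝ b y * inner ℝ a z) := by
  simp only [inner_eq_coords]
  unfold det3
  ring

/-- The position of `x` relative to the line `vv'` in a facet `F_i` is seen in the plane of the
projection as the sign of an imaginary part. -/
lemma Viewpoint.im_ratio (V : P.Viewpoint) {i : Fin P.m} {v v' x : E3} (hv : v ∈ P.facet i)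
    (hv' : v' ∈ P.facet i) (hx : x ∈ P.facet i) :
    (V.diff v' x / V.diff v x).im * (Complex.normSq (V.diff v x) *
        inner ℝ (P.normal i) (P.normal i)) =
      inner ℝ (P.normal V.base) (x - V.point) * det3 V.e₁ V.e₂ (P.normal V.base) *
        (P.side i v v' x * inner ℝ (P.normal i) (v - V.point)) := by
  have h1 : (V.diff v' x / V.diff v x).im * Complex.normSq (V.diff v x) =
      (V.diff v x).re * (V.diff v' x).im - (V.diff v x).im * (V.diff v' x).re := by
    by_cases h0 : V.diff v x = 0
    · rw [h0]; simp
    · have := Complex.normSq_pos.2 h0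
      rw [Complex.div_im]
      field_simp
  have h2 : (V.diff v x).re * (V.diff v' x).im - (V.diff v x).im * (V.diff v' x).re =
      inner ℝ (P.normal V.base) (x - V.point) * (det3 V.e₁ V.e₂ (P.normal V.base) *
        det3 (v - V.point) (v' - V.point) (x - V.point)) := by
    rw [det3_product]
    simp only [diff]
    ring
  have h3 : det3 (v - V.point) (v' - V.point) (x - V.point) * inner ℝ (P.normal i) (P.normal i) =
      P.side i v v' x * inner ℝ (P.normal i) (v - V.point) := by
    have := det3_mul_inner_self (n := P.normal i) (u := v - V.point) (a := v' - v) (b := x - v)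
      (by rw [inner_sub_right, hv'.2, hv.2, sub_self])
      (by rw [inner_sub_right, hx.2, hv.2, sub_self])
    rw [side, ← this, show v - V.point + (v' - v) = v' - V.point by abel,
      show v - V.point + (x - v) = x - V.point by abel]
  rw [← mul_assoc, h1, h2, ← h3]
  ring

lemma Viewpoint.parity_eq_of_isPreconnected {V : P.Viewpoint} {k : ℕ} [NeZero k] {v : ZMod k → E3}
    (hv : V.Avoids v) {S : Set E3} (hS : IsPreconnected S)
    (hSX : S ⊆ frontier P.body \ ⋃ s, segment ℝ (v s) (v (s + 1))) {x y : E3} (hx : x ∈ S)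
    (hy : y ∈ S) : V.parity v x = V.parity v y := by
  refine hS.constant_of_mapsTo (T := ({1, -1} : Set ℝ)) (Set.toFinite _).isDiscrete
    ((continuousOn_parity hv).mono hSX)
    (fun z hz => ?_) hx hy
  exact parity_eq_one_or hv (hSX hz).1 fun s h => (hSX hz).2 (Set.mem_iUnion.2 ⟨s, h⟩)

/-- At an end of an edge that the belt crosses, the third facet does not belong to the belt, as no
three facets of a belt meet. It serves as the base facet. -/
lemma IsBelt.exists_viewpoint {B : Finset (Fin P.m)} (hB : P.IsBelt B) :
    ∃ V : P.Viewpoint, V.base ∉ B := by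
  obtain ⟨i, hi⟩ := hB.nonempty
  obtain ⟨j, hj, hij⟩ := hB.exists_neighbour hi
  obtain ⟨x, hx⟩ := hij.openEdge_nonempty
  obtain ⟨v, hv, l, hil, hjl, hvi, hvj, hvl⟩ :=
    exists_third_facet hx.1 hij.1 (mem_facet_left hx).2 (mem_facet_right hx).2
  obtain ⟨N, hN, hN'⟩ := exists_mem_facet_relint l
  refine ⟨⟨l, N, P.normal i, P.normal j, hN, hN',
    (three_tight hv hij.1 hil hjl hvi hvj hvl).1⟩, fun hl => ?_⟩
  obtain ⟨k, hk, c, hc, hr, ha, h3⟩ := hB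
  have hmem : ∀ x, x ∈ B ↔ ∃ s, c s = x := fun x => by
    rw [← Finset.mem_coe, ← hr, Set.mem_range]
  obtain ⟨s, rfl⟩ := (hmem i).1 hi
  obtain ⟨t, rfl⟩ := (hmem j).1 hj
  obtain ⟨u, hu⟩ := (hmem l).1 hl
  subst hu
  have := h3 s t u (fun h => hij.1 (congrArg c h)) (fun h => hjl (congrArg c h))
    (fun h => hil (congrArg c h))
  exact Set.eq_empty_iff_forall_notMem.1 this v ⟨⟨⟨hv, hvi⟩, ⟨hv, hvj⟩⟩, ⟨hv, hvl⟩⟩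

/-- The polygon of a belt meets a facet of the belt in one chord only. -/
lemma mem_chord_of_mem_facet {B : Finset (Fin P.m)} (hB : P.IsBelt B)
    {p : Fin P.m → Fin P.m → E3} (hp : P.IsEdgeChoice B p) {i j l : Fin P.m} (hi : i ∈ B)
    (hj : j ∈ B) (hl : l ∈ B) (hjl : j ≠ l) (hij : P.Adj i j) (hil : P.Adj i l) {x : E3}
    (hx : x ∈ P.beltPolygon B p) (hxi : x ∈ P.facet i) : x ∈ segment ℝ (p i j) (p i l) := by
  obtain ⟨l', hl', hjl', hil', hall⟩ := hB.exists_other_neighbour hi hj hij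
  have hll : l = l' := (hall l hl hil).resolve_left hjl.symm
  subst hll
  obtain ⟨i', hi', q, hq, r, hr, hqr, hiq, hir, hx'⟩ := hx
  by_cases hii : i' = i
  · subst hii
    rcases hall q hq hiq with rfl | rfl <;> rcases hall r hr hir with rfl | rfl
    · exact absurd rfl hqr
    · exact hx'
    · rw [segment_symm]; exact hx'
    · exact absurd rfl hqr
  · obtain ⟨-, hadj, rfl⟩ := eq_of_mem_two_facets hp hi' hq hr hqr hiq hir hx' hxi.2
      (Ne.symm hii)
    rw [hp.1 i' i]
    rcases hall i' hi' hadj.symm with rfl | rfl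
    · exact left_mem_segment ℝ _ _
    · exact right_mem_segment ℝ _ _

lemma side_lineMap (i : Fin P.m) (x y z w : E3) (t : ℝ) :
    P.side i x y (AffineMap.lineMap z w t) = (1 - t) * P.side i x y z + t * P.side i x y w := by
  rw [AffineMap.lineMap_apply_module, side_combination _ _ _ _ _ (by ring)]

section Jump

variable {V : P.Viewpoint} {k : ℕ} {v : ZMod k → E3} {i : Fin P.m} {s : ZMod k} {q z : E3}

/-- As one approaches the midpoint of a chord from one of its sides, the angle subtended by the
chord tends to `π` or `-π`, depending on the side. -/
lemma Viewpoint.tendsto_arg (hi : i ≠ V.base) (hv : V.Avoids v) (hs : v s ∈ P.facet i)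
    (hs' : v (s + 1) ∈ P.facet i) (hne : v s ≠ v (s + 1))
    (hq : q = (1 / 2 : ℝ) • v s + (1 / 2 : ℝ) • v (s + 1))
    (hz : z ∈ P.facet i) :
    (0 < det3 V.e₁ V.e₂ (P.normal V.base) * P.side i (v s) (v (s + 1)) z →
      Filter.Tendsto (fun t : ℝ => (V.diff (v (s + 1)) (AffineMap.lineMap q z t) /
        V.diff (v s) (AffineMap.lineMap q z t)).arg) (nhdsWithin 0 (Set.Ioi 0)) (nhds (-Real.pi))) ∧
    (det3 V.e₁ V.e₂ (P.normal V.base) * P.side i (v s) (v (s + 1)) z < 0 →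
      Filter.Tendsto (fun t : ℝ => (V.diff (v (s + 1)) (AffineMap.lineMap q z t) /
        V.diff (v s) (AffineMap.lineMap q z t)).arg)
        (nhdsWithin 0 (Set.Ioi 0)) (nhds Real.pi)) := by
  have hqs : q ∈ segment ℝ (v s) (v (s + 1)) :=
    ⟨1 / 2, 1 / 2, by norm_num, by norm_num, by norm_num, hq.symm⟩
  have hqN : q ≠ V.point := by
    rintro rfl
    exact (hv s _ hqs).2.ne V.tight
  have hqi : q ∈ P.facet i := mem_facet_of_mem_segment hs hs' hqs
  have hdiff : V.diff (v s) q ≠ 0 := by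
    refine V.diff_ne_zero (hv s _ (left_mem_segment ℝ _ _)).1 (hv s _ (left_mem_segment ℝ _ _)).2
      (hv s _ hqs).1 hqN fun h => hne ?_
    rw [hq] at h
    have h' : (1 / 2 : ℝ) • (v (s + 1) - v s) = 0 := by
      have := sub_eq_zero.2 h
      rw [← this]
      module
    rcases smul_eq_zero.1 h' with h' | h'
    · norm_num at h'
    · exact (sub_eq_zero.1 h').symm
  have hratio : V.diff (v (s + 1)) q / V.diff (v s) q = -1 := by
    have h0 : V.diff q q = 0 := by
      apply Complex.ext <;> simp [diff]
    have h1 := V.diff_combination (v s) (v (s + 1)) q (a := 1 / 2) (b := 1 / 2) (by norm_num)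
    rw [← hq, h0] at h1
    rw [div_eq_iff hdiff]
    push_cast at h1
    linear_combination -2 * h1
  have hline : Filter.Tendsto (fun t : ℝ => AffineMap.lineMap q z t) (nhdsWithin 0 (Set.Ioi 0))
      (nhds q) := by
    have : Continuous fun t : ℝ => (AffineMap.lineMap q z t : E3) := AffineMap.lineMap_continuous
    have h := this.tendsto 0
    rw [AffineMap.lineMap_apply_zero] at h
    exact h.mono_left nhdsWithin_le_nhds
  have hr : Filter.Tendsto (fun t : ℝ => V.diff (v (s + 1)) (AffineMap.lineMap q z t) /
        V.diff (v s) (AffineMap.lineMap q z t)) (nhdsWithin 0 (Set.Ioi 0)) (nhds (-1)) := by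
    have h := ((V.continuous_diff (v (s + 1))).continuousAt (x := q)).div
      ((V.continuous_diff (v s)).continuousAt (x := q)) hdiff
    rw [← hratio]
    exact h.tendsto.comp hline
  -- the sign of the imaginary part near the chord
  have him : ∀ᶠ t in nhdsWithin (0 : ℝ) (Set.Ioi 0), ∃ a : ℝ, 0 < a ∧
      (V.diff (v (s + 1)) (AffineMap.lineMap q z t) /
        V.diff (v s) (AffineMap.lineMap q z t)).im * a =
      -(det3 V.e₁ V.e₂ (P.normal V.base) * P.side i (v s) (v (s + 1)) z) := by
    have hopen : ∀ᶠ x in nhds q, inner ℝ (P.normal V.base) (x - V.point) < 0 := by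
      have hc : Continuous fun x : E3 => inner ℝ (P.normal V.base) (x - V.point) := by fun_prop
      exact hc.continuousAt.eventually (gt_mem_nhds (V.inner_sub_point_neg (hv s _ hqs).2))
    have hdne : ∀ᶠ x in nhds q, V.diff (v s) x ≠ 0 :=
      (V.continuous_diff (v s)).continuousAt.eventually_ne hdiff
    filter_upwards [hline.eventually hopen, hline.eventually hdne,
      Ioc_mem_nhdsGT (zero_lt_one' ℝ)] with t h1 h2 ht
    have hti : AffineMap.lineMap q z t ∈ P.facet i :=
      mem_facet_of_mem_segment hqi hz (by
        rw [segment_eq_image_lineMap]; exact ⟨t, ⟨ht.1.le, ht.2⟩, rfl⟩)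
    have key := V.im_ratio hs hs' hti
    have hside0 : P.side i (v s) (v (s + 1)) q = 0 := by
      rw [hq, side_combination _ _ _ _ _ (by norm_num), side_left, side_right]; ring
    rw [side_lineMap, hside0] at key
    have hδ : 0 < inner ℝ (P.normal i) (v s - V.point) := by
      rw [inner_sub_right, hs.2]; linarith [V.lt i hi]
    have hn : 0 < inner ℝ (P.normal i) (P.normal i) := real_inner_self_pos.2 (normal_ne_zero i)
    have hN := Complex.normSq_pos.2 h2
    set β := inner ℝ (P.normal V.base) (AffineMap.lineMap q z t - V.point) with hβ
    have ht0 := ht.1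
    refine ⟨(Complex.normSq (V.diff (v s) (AffineMap.lineMap q z t)) *
      inner ℝ (P.normal i) (P.normal i)) / (-β * t * inner ℝ (P.normal i) (v s - V.point)),
      div_pos (mul_pos hN hn) (mul_pos (mul_pos (neg_pos.2 h1) ht0) hδ), ?_⟩
    rw [← mul_div_assoc, key, div_eq_iff (mul_pos (mul_pos (neg_pos.2 h1) ht0) hδ).ne']
    ring
  constructor
  · intro hpos
    have hw := Complex.tendsto_arg_nhdsWithin_im_neg_of_re_neg_of_im_zero (z := -1)
      (by simp) (by simp)
    refine hw.comp (tendsto_nhdsWithin_iff.2 ⟨hr, ?_⟩)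
    filter_upwards [him] with t ⟨a, ha, h⟩
    change (_ : ℝ) < 0
    nlinarith
  · intro hneg
    have hw := Complex.tendsto_arg_nhdsWithin_im_nonneg_of_re_neg_of_im_zero (z := -1)
      (by simp) (by simp)
    refine hw.comp (tendsto_nhdsWithin_iff.2 ⟨hr, ?_⟩)
    filter_upwards [him] with t ⟨a, ha, h⟩
    change (0 : ℝ) ≤ _
    by_contra hcon
    nlinarith

variable [NeZero k]

/-- The parity on one side of the chord of a facet is the limit of the parity as one approaches an
inner point `q` of the chord from this side. -/
lemma Viewpoint.parity_eq_cos (hv : V.Avoids v)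
    (hq : q ∈ segment ℝ (v s) (v (s + 1))) (hqr : ∀ r, r ≠ s → q ∉ segment ℝ (v r) (v (r + 1)))
    (hX : ∀ t ∈ Set.Ioc (0 : ℝ) 1, AffineMap.lineMap q z t ∈
      frontier P.body \ ⋃ s, segment ℝ (v s) (v (s + 1))) {κ : ℝ}
    (hκ : Filter.Tendsto (fun t : ℝ => (V.diff (v (s + 1)) (AffineMap.lineMap q z t) /
      V.diff (v s) (AffineMap.lineMap q z t)).arg) (nhdsWithin 0 (Set.Ioi 0)) (nhds κ)) :
    V.parity v z = Real.cos ((κ + ∑ r ∈ Finset.univ.erase s,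
      (V.diff (v (r + 1)) q / V.diff (v r) q).arg) / 2) := by
  have hqN : q ≠ V.point := by
    rintro rfl
    exact (hv s _ hq).2.ne V.tight
  have hline : Filter.Tendsto (fun t : ℝ => AffineMap.lineMap q z t) (nhdsWithin 0 (Set.Ioi 0))
      (nhds q) := by
    have : Continuous fun t : ℝ => (AffineMap.lineMap q z t : E3) := AffineMap.lineMap_continuous
    have h := this.tendsto 0
    rw [AffineMap.lineMap_apply_zero] at h
    exact h.mono_left nhdsWithin_le_nhds
  have hlim : Filter.Tendsto (fun t : ℝ => V.parity v (AffineMap.lineMap q z t))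
      (nhdsWithin 0 (Set.Ioi 0)) (nhds (Real.cos ((κ + ∑ r ∈ Finset.univ.erase s,
      (V.diff (v (r + 1)) q / V.diff (v r) q).arg) / 2))) := by
    unfold parity angle
    refine (Real.continuous_cos.tendsto _).comp (Filter.Tendsto.div_const ?_ 2)
    simp_rw [← Finset.add_sum_erase _ _ (Finset.mem_univ s)]
    refine hκ.add (tendsto_finsetSum _ fun r hr => ?_)
    exact (continuousAt_arg_ratio hv (hv s _ hq).1 hqN
      (hqr r (Finset.ne_of_mem_erase hr))).tendsto.comp hline
  have hconst : ∀ᶠ t in nhdsWithin (0 : ℝ) (Set.Ioi 0),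
      V.parity v (AffineMap.lineMap q z t) = V.parity v z := by
    filter_upwards [Ioc_mem_nhdsGT (zero_lt_one' ℝ)] with t ht
    have hS : IsPreconnected ((fun t : ℝ => (AffineMap.lineMap q z t : E3)) '' Set.Ioc 0 1) :=
      isPreconnected_Ioc.image _ AffineMap.lineMap_continuous.continuousOn
    refine parity_eq_of_isPreconnected hv hS ?_ ⟨t, ht, rfl⟩ ⟨1, by simp, by simp⟩
    rintro _ ⟨t, ht, rfl⟩
    exact hX t ht
  exact tendsto_nhds_unique (tendsto_const_nhds.congr' (hconst.mono fun t ht => ht.symm)) hlim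

end Jump

/-- A simple closed polygon along a belt separates the boundary of the polytope, and its two sides
in each facet of the belt belong to different parts: there is a locally constant function with
values `±1` on the complement that changes sign across the polygon. -/
lemma IsBelt.exists_separation {B : Finset (Fin P.m)} (hB : P.IsBelt B)
    {p : Fin P.m → Fin P.m → E3} (hp : P.IsEdgeChoice B p) :
    ∃ ε : E3 → ℝ, ContinuousOn ε (frontier P.body \ P.beltPolygon B p) ∧
      (∀ x ∈ frontier P.body \ P.beltPolygon B p, ε x = 1 ∨ ε x = -1) ∧
      (∀ S ⊆ frontier P.body \ P.beltPolygon B p, IsPreconnected S →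
        ∀ x ∈ S, ∀ y ∈ S, ε x = ε y) ∧
      ∀ i ∈ B, ∀ j ∈ B, ∀ l ∈ B, j ≠ l → P.Adj i j → P.Adj i l → ∀ z ∈ P.facet i, ∀ w ∈ P.facet i,
        0 < P.side i (p i j) (p i l) z → P.side i (p i j) (p i l) w < 0 → ε z ≠ ε w := by
  obtain ⟨V, hV⟩ := hB.exists_viewpoint
  have hB' := hB
  obtain ⟨k, hk, c, hc, hr, ha, -⟩ := hB'
  have : NeZero k := ⟨by omega⟩
  have hmem : ∀ x, x ∈ B ↔ ∃ s, c s = x := fun x => by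
    rw [← Finset.mem_coe, ← hr, Set.mem_range]
  have hcB : ∀ s, c s ∈ B := fun s => (hmem _).2 ⟨s, rfl⟩
  set v := cycleVertex c p with hvdef
  have hpoly : P.beltPolygon B p = ⋃ s, segment ℝ (v s) (v (s + 1)) :=
    beltPolygon_eq_cycle hk hc hr ha hp.1
  have hprev : ∀ s, P.Adj (c s) (c (s - 1)) := fun s => (ha _ _).2 (Or.inr (by ring))
  have hnext : ∀ s, P.Adj (c s) (c (s + 1)) := fun s => (ha _ _).2 (Or.inl rfl)
  have hpn : ∀ s, c (s - 1) ≠ c (s + 1) := fun s h =>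
    two_ne_zero_zmod hk (by linear_combination -(hc h))
  have hv1 : ∀ s, v (s + 1) = p (c s) (c (s + 1)) := fun s => by
    rw [hvdef, cycleVertex, add_sub_cancel_right, hp.1]
  have hvs : ∀ s, v s ∈ P.openEdge (c s) (c (s - 1)) := fun s =>
    hp.2 _ (hcB _) _ (hcB _) (hprev s)
  have hvs' : ∀ s, v (s + 1) ∈ P.openEdge (c s) (c (s + 1)) := fun s => by
    rw [hv1]; exact hp.2 _ (hcB _) _ (hcB _) (hnext s)
  have hav : V.Avoids v := by
    intro s q hq
    have hqp : q ∈ P.beltPolygon B p := by rw [hpoly]; exact Set.mem_iUnion.2 ⟨s, hq⟩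
    have hqf := beltPolygon_subset_frontier hp hqp
    refine ⟨hqf, lt_of_le_of_ne ((mem_frontier_body.1 hqf).1 _) fun h => hV ?_⟩
    obtain ⟨i, hi, j, hj, l, hl, hjl, hij, hil, hx⟩ := hqp
    by_cases hib : V.base = i
    · exact hib ▸ hi
    · exact (eq_of_mem_two_facets hp hi hj hl hjl hij hil hx h hib).1
  have hjump : ∀ s, ∀ z ∈ P.facet (c s), ∀ w ∈ P.facet (c s),
      0 < P.side (c s) (v s) (v (s + 1)) z → P.side (c s) (v s) (v (s + 1)) w < 0 →
      V.parity v z ≠ V.parity v w := by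
    intro s z hz w hw hzs hws
    have hne : v s ≠ v (s + 1) := ne_of_mem_openEdge (hpn s) (hprev s).1 (hvs s) (hvs' s)
    set q := (1 / 2 : ℝ) • v s + (1 / 2 : ℝ) • v (s + 1) with hq
    have hqs : q ∈ segment ℝ (v s) (v (s + 1)) :=
      ⟨1 / 2, 1 / 2, by norm_num, by norm_num, by norm_num, rfl⟩
    have hqi : q ∈ P.facet (c s) :=
      mem_facet_of_mem_segment (mem_facet_left (hvs s)) (mem_facet_left (hvs' s)) hqs
    have hqr : ∀ r, r ≠ s → q ∉ segment ℝ (v r) (v (r + 1)) := by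
      intro r hrs hqr
      have hqr' := mem_facet_of_mem_segment (mem_facet_left (hvs r)) (mem_facet_left (hvs' r)) hqr
      obtain ⟨h1, h2⟩ := tight_of_tight_combination (hvs s).1 (hvs' s).1 (by norm_num) (by norm_num)
        (by norm_num) hqr'.2
      rcases ((hvs s).2 _).1 h1 with h | h
      · exact hrs (hc h)
      rcases ((hvs' s).2 _).1 h2 with h' | h'
      · exact hrs (hc h')
      · exact hpn s (h.symm.trans h')
    have hside0 : P.side (c s) (v s) (v (s + 1)) q = 0 := by
      rw [hq, side_combination _ _ _ _ _ (by norm_num), side_left, side_right]; ring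
    have hX : ∀ z ∈ P.facet (c s), P.side (c s) (v s) (v (s + 1)) z ≠ 0 →
        ∀ t ∈ Set.Ioc (0 : ℝ) 1, AffineMap.lineMap q z t ∈
          frontier P.body \ ⋃ s, segment ℝ (v s) (v (s + 1)) := by
      intro z hz hzs t ht
      have hti : AffineMap.lineMap q z t ∈ P.facet (c s) :=
        mem_facet_of_mem_segment hqi hz (by
          rw [segment_eq_image_lineMap]; exact ⟨t, ⟨ht.1.le, ht.2⟩, rfl⟩)
      refine ⟨facet_subset_frontier _ hti, fun hmem => ?_⟩
      rw [← hpoly] at hmem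
      have hch := mem_chord_of_mem_facet hB hp (hcB s) (hcB _) (hcB _) (hpn s) (hprev s) (hnext s)
        hmem hti
      rw [← hv1] at hch
      obtain ⟨a, b, -, -, hab, he⟩ := hch
      have h0 : P.side (c s) (v s) (v (s + 1)) (AffineMap.lineMap q z t) = 0 := by
        rw [← he]
        change P.side (c s) (v s) (v (s + 1)) (a • v s + b • v (s + 1)) = 0
        rw [side_combination _ _ _ _ _ hab, side_left, side_right]; ring
      rw [side_lineMap, hside0, mul_zero, zero_add] at h0
      exact (mul_ne_zero ht.1.ne' hzs) h0
    have hib : c s ≠ V.base := fun h => hV (h ▸ hcB s)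
    have hzt := Viewpoint.tendsto_arg hib hav (mem_facet_left (hvs s)) (mem_facet_left (hvs' s))
      hne hq hz
    have hwt := Viewpoint.tendsto_arg hib hav (mem_facet_left (hvs s)) (mem_facet_left (hvs' s))
      hne hq hw
    have hz1 : V.parity v z = 1 ∨ V.parity v z = -1 := by
      have := hX z hz hzs.ne' 1 (by simp)
      rw [AffineMap.lineMap_apply_one] at this
      exact Viewpoint.parity_eq_one_or hav this.1 fun s h => this.2 (Set.mem_iUnion.2 ⟨s, h⟩)
    -- the total angles on the two sides differ by `2π`, so the cosines of their halves are opposite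
    have hopp : V.parity v z = -V.parity v w := by
      rcases lt_or_gt_of_ne V.det_ne_zero with hD | hD
      · rw [Viewpoint.parity_eq_cos hav hqs hqr (hX z hz hzs.ne')
            (hzt.2 (mul_neg_of_neg_of_pos hD hzs)),
          Viewpoint.parity_eq_cos hav hqs hqr (hX w hw hws.ne)
            (hwt.1 (mul_pos_of_neg_of_neg hD hws)),
          ← Real.cos_add_pi]
        congr 1
        ring
      · rw [Viewpoint.parity_eq_cos hav hqs hqr (hX z hz hzs.ne') (hzt.1 (mul_pos hD hzs)),
          Viewpoint.parity_eq_cos hav hqs hqr (hX w hw hws.ne)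
            (hwt.2 (mul_neg_of_pos_of_neg hD hws)),
          ← Real.cos_sub_pi]
        congr 1
        ring
    intro heq
    rcases hz1 with h | h <;> linarith
  refine ⟨V.parity v, ?_, ?_, ?_, ?_⟩
  · rw [hpoly]
    exact Viewpoint.continuousOn_parity hav
  · rw [hpoly]
    exact fun x hx => Viewpoint.parity_eq_one_or hav hx.1 fun s h =>
      hx.2 (Set.mem_iUnion.2 ⟨s, h⟩)
  · rw [hpoly]
    exact fun S hS hS' x hx y hy => Viewpoint.parity_eq_of_isPreconnected hav hS' hS hx hy
  · intro i hi j hj l hl hjl hij hil z hz w hw hzs hws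
    obtain ⟨s, rfl⟩ := (hmem i).1 hi
    obtain ⟨t, rfl⟩ := (hmem j).1 hj
    obtain ⟨u, rfl⟩ := (hmem l).1 hl
    rcases (ha _ _).1 hij with rfl | rfl <;> rcases (ha _ _).1 hil with h | h
    · exact absurd (congrArg c h.symm) hjl
    · obtain rfl : u = s - 1 := by rw [h]; ring
      rw [side_swap, ← hv1] at hzs hws
      exact (hjump s w hw z hz (neg_neg_iff_pos.1 hws) (neg_pos.1 hzs)).symm
    · rw [h, ← hv1] at hzs hws
      have e : p (c (t + 1)) (c t) = v (t + 1) := by rw [hvdef, cycleVertex, add_sub_cancel_right]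
      rw [e] at hzs hws
      exact hjump (t + 1) z hz w hw hzs hws
    · exact absurd (congrArg c (add_right_cancel h)) hjl

/-! ### Sides of compatible belts -/

lemma exists_along_pos {i j : Fin P.m} (hij : i ≠ j) {x : E3} (hx : x ∈ P.openEdge i j) :
    ∃ z ∈ P.openEdge i j, 0 < P.along i j x z := by
  obtain ⟨v, hv, l, hil, hjl, hvi, hvj, hvl⟩ :=
    exists_third_facet hx.1 hij (mem_facet_left hx).2 (mem_facet_right hx).2
  have hG := gram_pos_of_det3_ne_zero (three_tight hv hij hil hjl hvi hvj hvl).1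
  -- the cross product of the two normals is a direction of the edge
  obtain ⟨d, hdi, hdj, hd⟩ : ∃ d : E3, inner ℝ (P.normal i) d = 0 ∧ inner ℝ (P.normal j) d = 0 ∧
      0 < det3 (P.normal i) (P.normal j) d := by
    set a := P.normal i
    set b := P.normal j
    refine ⟨WithLp.toLp 2 ![a 1 * b 2 - a 2 * b 1, a 2 * b 0 - a 0 * b 2, a 0 * b 1 - a 1 * b 0],
      ?_, ?_, ?_⟩
    · rw [inner_eq_coords]
      simp only [Matrix.cons_val_zero, Matrix.cons_val_one, Matrix.cons_val]
      ring
    · rw [inner_eq_coords]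
      simp only [Matrix.cons_val_zero, Matrix.cons_val_one, Matrix.cons_val]
      ring
    · simp only [inner_eq_coords] at hG
      simp only [det3, Matrix.cons_val_zero, Matrix.cons_val_one, Matrix.cons_val]
      linarith
  have hev : ∀ᶠ t in nhds (0 : ℝ), ∀ r, r ≠ i → r ≠ j →
      inner ℝ (P.normal r) (x + t • d) < P.offset r := by
    refine Filter.eventually_all.2 fun r => ?_
    by_cases hri : r = i
    · exact Filter.Eventually.of_forall fun t h => absurd hri h
    by_cases hrj : r = j
    · exact Filter.Eventually.of_forall fun t _ h => absurd hrj h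
    have hlt : inner ℝ (P.normal r) x < P.offset r := by
      refine lt_of_le_of_ne (hx.1 r) fun h => ?_
      rcases (hx.2 r).1 h with h | h
      exacts [hri h, hrj h]
    have hc : Continuous fun t : ℝ => inner ℝ (P.normal r) (x + t • d) := by fun_prop
    have := hc.tendsto 0
    rw [zero_smul, add_zero] at this
    exact (this.eventually (gt_mem_nhds hlt)).mono fun t ht _ _ => ht
  obtain ⟨t, ht, ht0⟩ :=
    ((hev.filter_mono (nhdsWithin_le_nhds (s := Set.Ioi 0))).and self_mem_nhdsWithin).exists
  have ht0 : 0 < t := ht0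
  have hi : inner ℝ (P.normal i) (x + t • d) = P.offset i := by
    rw [inner_add_right, inner_smul_right, hdi, (mem_facet_left hx).2, mul_zero, add_zero]
  have hj : inner ℝ (P.normal j) (x + t • d) = P.offset j := by
    rw [inner_add_right, inner_smul_right, hdj, (mem_facet_right hx).2, mul_zero, add_zero]
  refine ⟨x + t • d, ⟨fun r => ?_, fun r => ⟨fun hr => ?_, ?_⟩⟩, ?_⟩
  · by_cases hri : r = i
    · exact hri ▸ hi.le
    by_cases hrj : r = j
    · exact hrj ▸ hj.le
    exact (ht r hri hrj).le
  · by_contra! hcon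
    exact (ht r hcon.1 hcon.2).ne hr
  · rintro (rfl | rfl)
    exacts [hi, hj]
  · have : P.along i j x (x + t • d) = t * det3 (P.normal i) (P.normal j) d := by
      simp only [along, det3, PiLp.sub_apply, PiLp.add_apply, PiLp.smul_apply, smul_eq_mul]
      ring
    rw [this]
    exact mul_pos ht0 hd

/-- An edge contains an increasing sequence of inner points. -/
lemma exists_increasing {i j : Fin P.m} (hij : P.Adj i j) :
    ∃ f : ℕ → E3, (∀ n, f n ∈ P.openEdge i j) ∧ ∀ a b, a < b → 0 < P.along i j (f a) (f b) := by
  obtain ⟨x, hx⟩ := hij.openEdge_nonempty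
  obtain ⟨y, hy, hxy⟩ := exists_along_pos hij.1 hx
  refine ⟨fun n => AffineMap.lineMap x y (1 - 1 / ((n : ℝ) + 1)), fun n => ?_, fun a b hab => ?_⟩
  · refine openEdge_convex.lineMap_mem hx hy ⟨?_, ?_⟩
    · rw [sub_nonneg, div_le_one (by positivity)]
      linarith [n.cast_nonneg (α := ℝ)]
    · have : 0 ≤ 1 / ((n : ℝ) + 1) := by positivity
      linarith
  · have h : ∀ s t : ℝ, P.along i j (AffineMap.lineMap x y s) (AffineMap.lineMap x y t) =
        (t - s) * P.along i j x y := by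
      intro s t
      simp only [along, det3, AffineMap.lineMap_apply_module, PiLp.sub_apply, PiLp.add_apply,
        PiLp.smul_apply, smul_eq_mul]
      ring
    rw [h]
    refine mul_pos ?_ hxy
    have hab' : (a : ℝ) < b := by exact_mod_cast hab
    have : 1 / ((b : ℝ) + 1) < 1 / ((a : ℝ) + 1) :=
      one_div_lt_one_div_of_lt (by positivity) (by linarith)
    linarith

lemma exists_const_of_compatible {B₁ B₂ : Finset (Fin P.m)} (h : P.Compatible B₁ B₂) {ε : E3 → ℝ}
    (hε : ContinuousOn ε (frontier P.body \ P.middleLine B₁))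
    (hval : ∀ x ∈ frontier P.body \ P.middleLine B₁, ε x = 1 ∨ ε x = -1)
    (hconst : ∀ S ⊆ frontier P.body \ P.middleLine B₁, IsPreconnected S →
      ∀ x ∈ S, ∀ y ∈ S, ε x = ε y) :
    ∃ b : ℝ, (b = 1 ∨ b = -1) ∧ ∀ y ∈ P.middleLine B₂, y ∉ P.middleLine B₁ → ε y = b := by
  obtain ⟨x, hx, hsub⟩ := h
  refine ⟨ε x, hval x hx, fun y hy hy' => ?_⟩
  set X := frontier P.body \ P.middleLine B₁
  set C := connectedComponentIn X x
  have hyX : y ∈ X :=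
    ⟨beltPolygon_subset_frontier (isEdgeChoice_edgeMid B₂) hy, hy'⟩
  have hyC := hsub hy
  have : (nhdsWithin y C).NeBot := mem_closure_iff_nhdsWithin_neBot.1 hyC
  have h1 : Filter.Tendsto ε (nhdsWithin y C) (nhds (ε y)) :=
    (hε y hyX).mono (connectedComponentIn_subset X x)
  have h2 : ∀ᶠ z in nhdsWithin y C, ε x = ε z := by
    filter_upwards [self_mem_nhdsWithin] with z hz
    exact hconst C (connectedComponentIn_subset X x) isPreconnected_connectedComponentIn x
      (mem_connectedComponentIn hx) z hz
  exact (tendsto_nhds_unique (tendsto_const_nhds.congr' h2) h1).symm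

/-- The side of the belt `B₁` on which a compatible belt `B₂` lies, recorded at the edges that `B₁`
crosses: `R i j` says that `B₂` lies on that side of `B₁` to which the edge `F_i ∩ F_j`, directed as
in the boundary of `F_i`, leads. -/
structure IsSideRelation (P : SimplePolytope3) (B₁ B₂ : Finset (Fin P.m))
    (R : Fin P.m → Fin P.m → Prop) : Prop where
  comm : ∀ i ∈ B₁, ∀ j ∈ B₁, P.Adj i j → (R i j ↔ ¬ R j i)
  step : ∀ i ∈ B₁, ∀ j ∈ B₁, ∀ l ∈ B₁, j ≠ l → P.Adj i j → P.Adj i l → (R i j ↔ R l i)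
  diverge : ∀ i ∈ B₁, i ∈ B₂ → ∀ j ∈ B₁, ∀ l ∈ B₁, ∀ r ∈ B₂, j ≠ l → j ≠ r → l ≠ r →
    P.Adj i j → P.Adj i l → P.Adj i r →
    (R i j ↔ P.side i (P.edgeMid i j) (P.edgeMid i l) (P.edgeMid i r) < 0)

lemma exists_isSideRelation {B₁ B₂ : Finset (Fin P.m)} (hB₁ : P.IsBelt B₁) (hB₂ : P.IsBelt B₂)
    (h : P.Compatible B₁ B₂) : ∃ R, P.IsSideRelation B₁ B₂ R := by
  have hm₁ := isEdgeChoice_edgeMid (P := P) B₁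
  obtain ⟨ε, hε, hval, hconst, hjump⟩ := hB₁.exists_separation hm₁
  obtain ⟨b, hb, hb₂⟩ := exists_const_of_compatible h hε hval hconst
  -- off the chord, the points of a facet do not lie on the middle line
  have hoff : ∀ i ∈ B₁, ∀ j ∈ B₁, ∀ l ∈ B₁, j ≠ l → P.Adj i j → P.Adj i l → ∀ z ∈ P.facet i,
      P.side i (P.edgeMid i j) (P.edgeMid i l) z ≠ 0 →
      z ∈ frontier P.body \ P.beltPolygon B₁ P.edgeMid := by
    intro i hi j hj l hl hjl hij hil z hz hs
    refine ⟨facet_subset_frontier i hz, fun hmem => hs ?_⟩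
    obtain ⟨c, d, -, -, hcd, rfl⟩ := mem_chord_of_mem_facet hB₁ hm₁ hi hj hl hjl hij hil hmem hz
    rw [side_combination _ _ _ _ _ hcd, side_left, side_right]; ring
  -- `ε` is constant on the part of a facet on one side of the chord
  have hhalf : ∀ i ∈ B₁, ∀ j ∈ B₁, ∀ l ∈ B₁, j ≠ l → P.Adj i j → P.Adj i l → ∀ z ∈ P.facet i,
      ∀ w ∈ P.facet i, P.side i (P.edgeMid i j) (P.edgeMid i l) z < 0 →
      P.side i (P.edgeMid i j) (P.edgeMid i l) w < 0 → ε z = ε w := by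
    intro i hi j hj l hl hjl hij hil z hz w hw hzs hws
    refine hconst (segment ℝ z w) (fun u hu => ?_) (convex_segment z w).isPreconnected z
      (left_mem_segment ℝ z w) w (right_mem_segment ℝ z w)
    refine hoff i hi j hj l hl hjl hij hil u (mem_facet_of_mem_segment hz hw hu) ?_
    obtain ⟨c, d, hc, hd, hcd, rfl⟩ := hu
    rw [side_combination _ _ _ _ _ hcd]
    rcases hc.eq_or_lt with rfl | hc
    · obtain rfl : d = 1 := by linarith
      simpa using hws.ne
    · exact (by linarith [mul_neg_of_pos_of_neg hc hzs, mul_nonpos_of_nonneg_of_nonpos hd hws.le] :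
        c * P.side i (P.edgeMid i j) (P.edgeMid i l) z +
          d * P.side i (P.edgeMid i j) (P.edgeMid i l) w < 0).ne
  set S : Fin P.m → Fin P.m → Fin P.m → Prop := fun i j l => ∀ z ∈ P.facet i,
    P.side i (P.edgeMid i j) (P.edgeMid i l) z < 0 → ε z = b with hS
  set R : Fin P.m → Fin P.m → Prop := fun i j => ∀ z ∈ P.openEdge i j,
    0 < P.along i j (P.edgeMid i j) z → ε z = b with hR
  have hfirst : ∀ i ∈ B₁, ∀ j ∈ B₁, ∀ l ∈ B₁, j ≠ l → P.Adj i j → P.Adj i l →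
      ∀ z ∈ P.openEdge i j, (P.side i (P.edgeMid i j) (P.edgeMid i l) z < 0 ↔
        0 < P.along i j (P.edgeMid i j) z) := by
    intro i hi j hj l hl hjl hij hil z hz
    have := sign_side_first hij.1 hjl (edgeMid_mem hij) (edgeMid_mem hil) hz
    rw [← sign_eq_neg_one_iff, this, ← sign_eq_one_iff, neg_inj]
  have hsecond : ∀ i ∈ B₁, ∀ j ∈ B₁, ∀ l ∈ B₁, j ≠ l → P.Adj i j → P.Adj i l →
      ∀ z ∈ P.openEdge l i, (P.side i (P.edgeMid i j) (P.edgeMid i l) z < 0 ↔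
        0 < P.along l i (P.edgeMid l i) z) := by
    intro i hi j hj l hl hjl hij hil z hz
    rw [openEdge_comm] at hz
    have := sign_side_second hil.1 hjl (edgeMid_mem hij) (edgeMid_mem hil) hz
    rw [← sign_eq_neg_one_iff, this, sign_eq_neg_one_iff, along_comm i l, edgeMid_comm l i, neg_pos]
  have hRS : ∀ i ∈ B₁, ∀ j ∈ B₁, ∀ l ∈ B₁, j ≠ l → P.Adj i j → P.Adj i l → (R i j ↔ S i j l) := by
    intro i hi j hj l hl hjl hij hil
    constructor
    · intro hRij z hz hzs
      obtain ⟨w, hw, hwpos⟩ := exists_along_pos hij.1 (edgeMid_mem hij)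
      rw [← hRij w hw hwpos]
      exact hhalf i hi j hj l hl hjl hij hil z hz w (mem_facet_left hw) hzs
        ((hfirst i hi j hj l hl hjl hij hil w hw).2 hwpos)
    · exact fun hSijl z hz hzpos => hSijl z (mem_facet_left hz)
        ((hfirst i hi j hj l hl hjl hij hil z hz).2 hzpos)
  have hRS' : ∀ i ∈ B₁, ∀ j ∈ B₁, ∀ l ∈ B₁, j ≠ l → P.Adj i j → P.Adj i l → (R l i ↔ S i j l) := by
    intro i hi j hj l hl hjl hij hil
    constructor
    · intro hRli z hz hzs
      obtain ⟨w, hw, hwpos⟩ := exists_along_pos hil.1.symm (edgeMid_mem hil.symm)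
      rw [← hRli w hw hwpos]
      exact hhalf i hi j hj l hl hjl hij hil z hz w (mem_facet_right hw) hzs
        ((hsecond i hi j hj l hl hjl hij hil w hw).2 hwpos)
    · exact fun hSijl z hz hzpos => hSijl z (mem_facet_right hz)
        ((hsecond i hi j hj l hl hjl hij hil z hz).2 hzpos)
  have hSS : ∀ i ∈ B₁, ∀ j ∈ B₁, ∀ l ∈ B₁, j ≠ l → P.Adj i j → P.Adj i l →
      (S i j l ↔ ¬ S i l j) := by
    intro i hi j hj l hl hjl hij hil
    obtain ⟨w, hw, hwpos⟩ := exists_along_pos hij.1 (edgeMid_mem hij)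
    have hwneg := (hfirst i hi j hj l hl hjl hij hil w hw).2 hwpos
    obtain ⟨u, hu, hupos⟩ := exists_along_pos hil.1 (edgeMid_mem hil)
    have huneg := (hfirst i hi l hl j hj hjl.symm hil hij u hu).2 hupos
    have hne : ε u ≠ ε w := hjump i hi j hj l hl hjl hij hil u (mem_facet_left hu) w
      (mem_facet_left hw) (by rw [side_swap] at huneg; exact neg_lt_zero.1 huneg) hwneg
    have hvw := hval w (hoff i hi j hj l hl hjl hij hil w (mem_facet_left hw) hwneg.ne)
    have hvu := hval u (hoff i hi l hl j hj hjl.symm hil hij u (mem_facet_left hu) huneg.ne)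
    constructor
    · intro h1 h2
      exact hne ((h2 u (mem_facet_left hu) huneg).trans (h1 w (mem_facet_left hw) hwneg).symm)
    · intro hn z hz hzs
      rw [hhalf i hi j hj l hl hjl hij hil z hz w (mem_facet_left hw) hzs hwneg]
      have hub : ε u ≠ b := by
        intro hub
        refine hn fun z hz hzs => ?_
        rw [hhalf i hi l hl j hj hjl.symm hil hij z hz u (mem_facet_left hu) hzs huneg, hub]
      rcases hvw with h1 | h1 <;> rcases hvu with h2 | h2 <;> rcases hb with h3 | h3
      all_goals first
        | exact h1.trans h3.symm
        | exact absurd (h2.trans h3.symm) hub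
        | exact absurd (h2.trans h1.symm) hne
  refine ⟨R, ?_, ?_, ?_⟩
  · intro i hi j hj hij
    obtain ⟨l, hl, hjl, hil, -⟩ := hB₁.exists_other_neighbour hi hj hij
    rw [hRS i hi j hj l hl hjl hij hil, hRS' i hi l hl j hj hjl.symm hil hij]
    exact hSS i hi j hj l hl hjl hij hil
  · intro i hi j hj l hl hjl hij hil
    rw [hRS i hi j hj l hl hjl hij hil, hRS' i hi j hj l hl hjl hij hil]
  · intro i hi hi₂ j hj l hl r hr hjl hjr hlr hij hil hir
    rw [hRS i hi j hj l hl hjl hij hil]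
    have hy := edgeMid_mem hir
    have hne := side_ne_zero hij.1 hil.1 hjl hir.1 (edgeMid_mem hij) (edgeMid_mem hil) hy
      (ne_of_mem_openEdge hjr hij.1 (edgeMid_mem hij) hy).symm
      (ne_of_mem_openEdge hlr hil.1 (edgeMid_mem hil) hy).symm
    have hyb : ε (P.edgeMid i r) = b := by
      refine hb₂ _ ?_ (hoff i hi j hj l hl hjl hij hil _ (mem_facet_left hy) hne).2
      obtain ⟨r', hr', hrr', hir', -⟩ := hB₂.exists_other_neighbour hi₂ hr hir
      exact ⟨i, hi₂, r, hr, r', hr', hrr', hir, hir', left_mem_segment ℝ _ _⟩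
    constructor
    · intro hSijl
      by_contra hcon
      have hpos := lt_of_le_of_ne (not_lt.1 hcon) hne.symm
      refine (hSS i hi j hj l hl hjl hij hil).1 hSijl fun z hz hzs => ?_
      rw [← hyb]
      refine hhalf i hi l hl j hj hjl.symm hil hij z hz _ (mem_facet_left hy) hzs ?_
      rw [side_swap]
      exact neg_lt_zero.2 hpos
    · intro hneg z hz hzs
      rw [← hyb]
      exact hhalf i hi j hj l hl hjl hij hil z hz _ (mem_facet_left hy) hzs hneg

/-! ### The order of belts on an edge -/

lemma side_swap_right (i : Fin P.m) (x y z : E3) : P.side i x z y = -P.side i x y z := by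
  simp only [side, det3, PiLp.sub_apply]; ring

lemma side_edgeMid_ne_zero {i j l r : Fin P.m} (hjl : j ≠ l) (hjr : j ≠ r) (hlr : l ≠ r)
    (hij : P.Adj i j) (hil : P.Adj i l) (hir : P.Adj i r) :
    P.side i (P.edgeMid i j) (P.edgeMid i l) (P.edgeMid i r) ≠ 0 :=
  side_ne_zero hij.1 hil.1 hjl hir.1 (edgeMid_mem hij) (edgeMid_mem hil) (edgeMid_mem hir)
    (ne_of_mem_openEdge hjr hij.1 (edgeMid_mem hij) (edgeMid_mem hir)).symm
    (ne_of_mem_openEdge hlr hil.1 (edgeMid_mem hil) (edgeMid_mem hir)).symm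

lemma IsSideRelation.antisymm {B₁ B₂ : Finset (Fin P.m)} (hB₁ : P.IsBelt B₁) (hB₂ : P.IsBelt B₂)
    (hne : B₁ ≠ B₂) {R₁ R₂ : Fin P.m → Fin P.m → Prop} (h₁ : P.IsSideRelation B₁ B₂ R₁)
    (h₂ : P.IsSideRelation B₂ B₁ R₂) {i j : Fin P.m} (hi₁ : i ∈ B₁) (hi₂ : i ∈ B₂) (hj₁ : j ∈ B₁)
    (hj₂ : j ∈ B₂) (hij : P.Adj i j) : R₁ i j ↔ ¬ R₂ i j := by
  have := not_of_parallel hB₁ hB₂ hne (Q := fun i j => (R₁ i j ↔ R₂ i j)) ?_ ?_ hi₁ hi₂ hj₁ hj₂ hij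
  · tauto
  · intro i hi₁ hi₂ j hj₁ hj₂ l hl₁ hl₂ hjl hij hil hq
    rw [← h₁.step i hi₁ j hj₁ l hl₁ hjl hij hil, ← h₂.step i hi₂ j hj₂ l hl₂ hjl hij hil]
    exact hq
  · intro i hi₁ hi₂ j hj₁ hj₂ l₁ hl₁ l₂ hl₂ hjl₁ hjl₂ hll hij hil₁ hil₂
    rw [h₁.diverge i hi₁ hi₂ j hj₁ l₁ hl₁ l₂ hl₂ hjl₁ hjl₂ hll hij hil₁ hil₂,
      h₂.diverge i hi₂ hi₁ j hj₂ l₂ hl₂ l₁ hl₁ hjl₂ hjl₁ hll.symm hij hil₂ hil₁,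
      side_swap_right i (P.edgeMid i j) (P.edgeMid i l₁) (P.edgeMid i l₂), neg_lt_zero]
    have := side_edgeMid_ne_zero hjl₁ hjl₂ hll hij hil₁ hil₂
    intro h
    rcases lt_or_gt_of_ne this with h' | h'
    · exact (h.1 h').not_gt h'
    · exact (h.2 h').not_gt h'

/-- Three directions from a point of an edge into the facet cannot turn cyclically in one sense, as
they lie in a half-plane. -/
lemma not_cyclic_side {i j : Fin P.m} {x a b c : E3} (hx : x ∈ P.openEdge i j)
    (ha : a ∈ P.facet i) (hb : b ∈ P.facet i) (hc : c ∈ P.facet i)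
    (haj : inner ℝ (P.normal j) a < P.offset j) (hbj : inner ℝ (P.normal j) b < P.offset j)
    (hcj : inner ℝ (P.normal j) c < P.offset j) (h₁ : P.side i x a b < 0)
    (h₂ : P.side i x b c < 0) (h₃ : P.side i x c a < 0) : False := by
  have key : ∀ n u a b c : E3, n ≠ 0 → inner ℝ n a = 0 → inner ℝ n b = 0 → inner ℝ n c = 0 →
      det3 n a b * inner ℝ u c + det3 n b c * inner ℝ u a + det3 n c a * inner ℝ u b = 0 := by
    intro n u a b c hn ha hb hc
    have hdet : det3 a b c = 0 := by
      by_contra h0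
      refine hn (eq_zero_of_det3_ne_zero h0 ?_ ?_ ?_) <;> rwa [real_inner_comm]
    have : det3 n a b * inner ℝ u c + det3 n b c * inner ℝ u a + det3 n c a * inner ℝ u b =
        det3 a b c * inner ℝ u n := by
      simp only [inner_eq_coords]
      unfold det3
      ring
    rw [this, hdet, zero_mul]
  have hxi := (mem_facet_left hx).2
  have hxj := (mem_facet_right hx).2
  have hk := key (P.normal i) (P.normal j) (a - x) (b - x) (c - x) (normal_ne_zero i)
    (by rw [inner_sub_right, ha.2, hxi, sub_self]) (by rw [inner_sub_right, hb.2, hxi, sub_self])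
    (by rw [inner_sub_right, hc.2, hxi, sub_self])
  have e : ∀ y, inner ℝ (P.normal j) y < P.offset j → inner ℝ (P.normal j) (y - x) < 0 := by
    intro y hy
    rw [inner_sub_right, hxj]; linarith
  have p1 := mul_pos_of_neg_of_neg h₁ (e c hcj)
  have p2 := mul_pos_of_neg_of_neg h₂ (e a haj)
  have p3 := mul_pos_of_neg_of_neg h₃ (e b hbj)
  unfold side at p1 p2 p3
  linarith

lemma IsSideRelation.not_cyclic {B₁ B₂ B₃ : Finset (Fin P.m)} (hB₁ : P.IsBelt B₁)
    (hB₂ : P.IsBelt B₂) (hB₃ : P.IsBelt B₃) (hne : B₁ ≠ B₂)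
    {R₁ R₂ R₃ : Fin P.m → Fin P.m → Prop} (h₁ : P.IsSideRelation B₁ B₂ R₁)
    (h₂ : P.IsSideRelation B₂ B₃ R₂) (h₃ : P.IsSideRelation B₃ B₁ R₃) {i j : Fin P.m}
    (hi₁ : i ∈ B₁) (hi₂ : i ∈ B₂) (hi₃ : i ∈ B₃) (hj₁ : j ∈ B₁) (hj₂ : j ∈ B₂) (hj₃ : j ∈ B₃)
    (hij : P.Adj i j) (hR₁ : R₁ i j) (hR₂ : R₂ i j) (hR₃ : R₃ i j) : False := by
  refine not_of_parallel hB₁ hB₂ hne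
    (Q := fun i j => i ∈ B₃ ∧ j ∈ B₃ ∧ R₁ i j ∧ R₂ i j ∧ R₃ i j) ?_ ?_ hi₁ hi₂ hj₁ hj₂ hij
    ⟨hi₃, hj₃, hR₁, hR₂, hR₃⟩
  · rintro i hi₁ hi₂ j hj₁ hj₂ l hl₁ hl₂ hjl hij hil ⟨hi₃, hj₃, hR₁, hR₂, hR₃⟩
    obtain ⟨l₃, hl₃, hjl₃, hil₃, -⟩ := hB₃.exists_other_neighbour hi₃ hj₃ hij
    by_cases hll : l = l₃
    · subst hll
      exact ⟨hl₃, hi₃, (h₁.step i hi₁ j hj₁ l hl₁ hjl hij hil).1 hR₁,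
        (h₂.step i hi₂ j hj₂ l hl₂ hjl hij hil).1 hR₂,
        (h₃.step i hi₃ j hj₃ l hl₃ hjl hij hil).1 hR₃⟩
    · rw [h₂.diverge i hi₂ hi₃ j hj₂ l hl₂ l₃ hl₃ hjl hjl₃ hll hij hil hil₃] at hR₂
      rw [h₃.diverge i hi₃ hi₁ j hj₃ l₃ hl₃ l hl₁ hjl₃ hjl (Ne.symm hll) hij hil₃ hil,
        side_swap_right, neg_lt_zero] at hR₃
      exact absurd hR₂ hR₃.not_gt
  · rintro i hi₁ hi₂ j hj₁ hj₂ l₁ hl₁ l₂ hl₂ hjl₁ hjl₂ hll hij hil₁ hil₂ ⟨hi₃, hj₃, hR₁, hR₂, hR₃⟩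
    obtain ⟨l₃, hl₃, hjl₃, hil₃, -⟩ := hB₃.exists_other_neighbour hi₃ hj₃ hij
    rw [h₁.diverge i hi₁ hi₂ j hj₁ l₁ hl₁ l₂ hl₂ hjl₁ hjl₂ hll hij hil₁ hil₂] at hR₁
    by_cases h13 : l₁ = l₃
    · subst h13
      rw [h₂.diverge i hi₂ hi₃ j hj₂ l₂ hl₂ l₁ hl₃ hjl₂ hjl₁ hll.symm hij hil₂ hil₁,
        side_swap_right, neg_lt_zero] at hR₂
      exact absurd hR₁ hR₂.not_gt
    by_cases h23 : l₂ = l₃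
    · subst h23
      rw [h₃.diverge i hi₃ hi₁ j hj₃ l₂ hl₃ l₁ hl₁ hjl₂ hjl₁ hll.symm hij hil₂ hil₁,
        side_swap_right, neg_lt_zero] at hR₃
      exact absurd hR₁ hR₃.not_gt
    rw [h₂.diverge i hi₂ hi₃ j hj₂ l₂ hl₂ l₃ hl₃ hjl₂ hjl₃ h23 hij hil₂ hil₃] at hR₂
    rw [h₃.diverge i hi₃ hi₁ j hj₃ l₃ hl₃ l₁ hl₁ hjl₃ hjl₁ (Ne.symm h13) hij hil₃ hil₁] at hR₃
    exact not_cyclic_side (edgeMid_mem hij) (mem_facet_left (edgeMid_mem hil₁))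
      (mem_facet_left (edgeMid_mem hil₂)) (mem_facet_left (edgeMid_mem hil₃))
      (lt_of_mem_openEdge hjl₁ hij.1 (edgeMid_mem hil₁))
      (lt_of_mem_openEdge hjl₂ hij.1 (edgeMid_mem hil₂))
      (lt_of_mem_openEdge hjl₃ hij.1 (edgeMid_mem hil₃)) hR₁ hR₂ hR₃

/-! ### Existence -/

/-- Curves whose vertices are ordered on every common edge as the sides of the belts prescribe are
disjoint. -/
lemma IsSideRelation.disjoint {B₁ B₂ : Finset (Fin P.m)} (hB₁ : P.IsBelt B₁) (hB₂ : P.IsBelt B₂)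
    {R : Fin P.m → Fin P.m → Prop} (hR : P.IsSideRelation B₁ B₂ R)
    {q₁ q₂ : Fin P.m → Fin P.m → E3} (h₁ : P.IsEdgeChoice B₁ q₁) (h₂ : P.IsEdgeChoice B₂ q₂)
    (hpos : ∀ i ∈ B₁, i ∈ B₂ → ∀ j ∈ B₁, j ∈ B₂ → P.Adj i j → R i j →
      0 < P.along i j (q₁ i j) (q₂ i j)) :
    Disjoint (P.beltPolygon B₁ q₁) (P.beltPolygon B₂ q₂) := by
  rw [disjoint_beltPolygon_iff hB₁ hB₂ h₁ h₂]
  intro i hi₁ hi₂ j hj l hl hjl hij hil a ha b hb hab hia hib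
  have hneg : ∀ i ∈ B₁, i ∈ B₂ → ∀ j ∈ B₁, j ∈ B₂ → P.Adj i j → ¬ R i j →
      P.along i j (q₁ i j) (q₂ i j) < 0 := by
    intro i hi₁ hi₂ j hj₁ hj₂ hij hn
    have h := hpos j hj₁ hj₂ i hi₁ hi₂ hij.symm ((hR.comm j hj₁ i hi₁ hij.symm).2 hn)
    rw [along_comm i j, h₁.1 j i, h₂.1 j i] at h
    linarith
  -- the side of the first chord on which the second curve leaves the facet
  have key : ∀ r ∈ B₂, P.Adj i r →
      (R i j → P.side i (q₁ i j) (q₁ i l) (q₂ i r) < 0) ∧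
      (¬ R i j → 0 < P.side i (q₁ i j) (q₁ i l) (q₂ i r)) := by
    intro r hr hir
    have hx := h₁.2 i hi₁ j hj hij
    have hy := h₁.2 i hi₁ l hl hil
    have hz := h₂.2 i hi₂ r hr hir
    by_cases hjr : j = r
    · subst hjr
      have hs := sign_side_first hij.1 hjl hx hy hz
      constructor
      · intro h
        rw [sign_pos (hpos i hi₁ hi₂ j hj hr hij h)] at hs
        exact sign_eq_neg_one_iff.1 hs
      · intro h
        rw [sign_neg (hneg i hi₁ hi₂ j hj hr hij h), neg_neg] at hs
        exact sign_eq_one_iff.1 hs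
    by_cases hlr : l = r
    · subst hlr
      have hs := sign_side_second hil.1 hjl hx hy hz
      have hstep := (hR.step i hi₁ j hj l hl hjl hij hil).trans (hR.comm l hl i hi₁ hil.symm)
      constructor
      · intro h
        rw [sign_neg (hneg i hi₁ hi₂ l hl hr hil (hstep.1 h))] at hs
        exact sign_eq_neg_one_iff.1 hs
      · intro h
        rw [sign_pos (hpos i hi₁ hi₂ l hl hr hil (not_not.1 fun h' => h (hstep.2 h')))] at hs
        exact sign_eq_one_iff.1 hs
    have hs := sign_side_congr hij.1 hil.1 hjl hir.1 hjr hlr hx (edgeMid_mem hij) hy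
      (edgeMid_mem hil) hz (edgeMid_mem hir)
    have hd := hR.diverge i hi₁ hi₂ j hj l hl r hr hjl hjr hlr hij hil hir
    constructor
    · intro h
      rw [sign_neg (hd.1 h)] at hs
      exact sign_eq_neg_one_iff.1 hs
    · intro h
      have hne := side_edgeMid_ne_zero hjl hjr hlr hij hil hir
      rw [sign_pos (lt_of_le_of_ne (not_lt.1 fun h' => h (hd.2 h')) hne.symm)] at hs
      exact sign_eq_one_iff.1 hs
  obtain ⟨ha1, ha2⟩ := key a ha hia
  obtain ⟨hb1, hb2⟩ := key b hb hib
  by_cases h : R i j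
  · exact mul_pos_of_neg_of_neg (ha1 h) (hb1 h)
  · exact mul_pos (ha2 h) (hb2 h)

theorem IsNestedFamily.exists_isNestedCurves {𝓑 : Set (Finset (Fin P.m))}
    (h𝓑 : P.IsNestedFamily 𝓑) : ∃ Γ, P.IsNestedCurves 𝓑 Γ := by
  classical
  obtain ⟨hbelt, hcomp⟩ := h𝓑
  have hR : ∀ B₁ B₂, ∃ R, B₁ ∈ 𝓑 → B₂ ∈ 𝓑 → B₁ ≠ B₂ → P.IsSideRelation B₁ B₂ R := by
    intro B₁ B₂
    by_cases h : B₁ ∈ 𝓑 ∧ B₂ ∈ 𝓑 ∧ B₁ ≠ B₂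
    · obtain ⟨R, hR⟩ := exists_isSideRelation (hbelt B₁ h.1) (hbelt B₂ h.2.1)
        (hcomp h.1 h.2.1 h.2.2)
      exact ⟨R, fun _ _ _ => hR⟩
    · exact ⟨fun _ _ => True, fun h1 h2 h3 => absurd ⟨h1, h2, h3⟩ h⟩
  choose R hR using hR
  have hf : ∀ i j, ∃ f : ℕ → E3, P.Adj i j → (∀ n, f n ∈ P.openEdge i j) ∧
      ∀ a b, a < b → 0 < P.along i j (f a) (f b) := by
    intro i j
    by_cases h : P.Adj i j
    · obtain ⟨f, hf⟩ := exists_increasing h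
      exact ⟨f, fun _ => hf⟩
    · exact ⟨fun _ => 0, fun h' => absurd h' h⟩
  choose f hf using hf
  -- the belts of the family that cross an edge before `B`
  set before : Finset (Fin P.m) → Fin P.m → Fin P.m → Finset (Finset (Fin P.m)) :=
    fun B i j => Finset.univ.filter fun B' => B' ∈ 𝓑 ∧ i ∈ B' ∧ j ∈ B' ∧ B' ≠ B ∧ R B' B i j
    with hbefore
  have hrank : ∀ B₁ ∈ 𝓑, ∀ B₂ ∈ 𝓑, B₁ ≠ B₂ → ∀ i ∈ B₁, i ∈ B₂ → ∀ j ∈ B₁, j ∈ B₂ → P.Adj i j →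
      R B₁ B₂ i j → (before B₁ i j).card < (before B₂ i j).card := by
    intro B₁ h₁ B₂ h₂ hne i hi₁ hi₂ j hj₁ hj₂ hij hr
    refine Finset.card_lt_card (Finset.ssubset_iff_of_subset (fun B hB => ?_) |>.2
      ⟨B₁, ?_, ?_⟩)
    · simp only [hbefore, Finset.mem_filter, Finset.mem_univ, true_and] at hB ⊢
      obtain ⟨hB𝓑, hi, hj, hB₁, hr'⟩ := hB
      have hB₂ : B ≠ B₂ := by
        rintro rfl
        exact ((hR B₁ B h₁ h₂ hne).antisymm (hbelt _ h₁) (hbelt _ h₂) hne (hR B B₁ h₂ h₁ hne.symm)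
          hi₁ hi₂ hj₁ hj₂ hij).1 hr hr'
      refine ⟨hB𝓑, hi, hj, hB₂, ?_⟩
      by_contra hn
      have hr'' : R B₂ B i j := not_not.1 fun h => hn
        (((hR B B₂ hB𝓑 h₂ hB₂).antisymm (hbelt _ hB𝓑) (hbelt _ h₂) hB₂ (hR B₂ B h₂ hB𝓑 hB₂.symm)
          hi hi₂ hj hj₂ hij).2 h)
      exact (hR B B₁ hB𝓑 h₁ hB₁).not_cyclic (hbelt _ hB𝓑) (hbelt _ h₁) (hbelt _ h₂) hB₁
        (hR B₁ B₂ h₁ h₂ hne) (hR B₂ B h₂ hB𝓑 hB₂.symm) hi hi₁ hi₂ hj hj₁ hj₂ hij hr' hr hr''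
    · simp only [hbefore, Finset.mem_filter, Finset.mem_univ, true_and]
      exact ⟨h₁, hi₁, hj₁, hne, hr⟩
    · simp [hbefore]
  set q : Finset (Fin P.m) → Fin P.m → Fin P.m → E3 := fun B i j =>
    if i < j then f i j (before B i j).card else f j i (before B j i).card with hq
  have hqlt : ∀ B i j, i < j → q B i j = f i j (before B i j).card := fun B i j h => if_pos h
  have hqcomm : ∀ B i j, q B i j = q B j i := by
    intro B i j
    rcases lt_trichotomy i j with h | rfl | h
    · simp only [hq, if_pos h, if_neg h.not_gt]
    · rfl
    · simp only [hq, if_pos h, if_neg h.not_gt]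
  have hqe : ∀ B, P.IsEdgeChoice B (q B) := by
    refine fun B => ⟨hqcomm B, fun i _ j _ hij => ?_⟩
    rcases lt_or_gt_of_ne hij.1 with h | h
    · rw [hqlt B i j h]
      exact (hf i j hij).1 _
    · rw [hqcomm, hqlt B j i h, openEdge_comm]
      exact (hf j i hij.symm).1 _
  refine ⟨fun B => P.beltPolygon B (q B), fun B hB =>
    (isBeltCurve_iff (hbelt B hB)).2 ⟨q B, hqe B, rfl⟩, fun B₁ h₁ B₂ h₂ hne => ?_⟩
  refine (hR B₁ B₂ h₁ h₂ hne).disjoint (hbelt B₁ h₁) (hbelt B₂ h₂) (hqe B₁) (hqe B₂) ?_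
  intro i hi₁ hi₂ j hj₁ hj₂ hij hr
  rcases lt_or_gt_of_ne hij.1 with h | h
  · rw [hqlt B₁ i j h, hqlt B₂ i j h]
    exact (hf i j hij).2 _ _ (hrank B₁ h₁ B₂ h₂ hne i hi₁ hi₂ j hj₁ hj₂ hij hr)
  · -- in the opposite direction of the edge the two belts are in the opposite order
    have hr' : R B₂ B₁ j i := by
      have h3 := ((hR B₁ B₂ h₁ h₂ hne).comm i hi₁ j hj₁ hij).1 hr
      have h4 := (hR B₁ B₂ h₁ h₂ hne).antisymm (hbelt _ h₁) (hbelt _ h₂) hne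
        (hR B₂ B₁ h₂ h₁ hne.symm) hj₁ hj₂ hi₁ hi₂ hij.symm
      exact not_not.1 fun h5 => h3 (h4.2 h5)
    have hlt := (hf j i hij.symm).2 _ _
      (hrank B₂ h₂ B₁ h₁ hne.symm j hj₂ hj₁ i hi₂ hi₁ hij.symm hr')
    rw [along_comm, along_swap, neg_neg, hqcomm B₁, hqcomm B₂, hqlt B₁ j i h, hqlt B₂ j i h]
    exact hlt

end SimplePolytope3

theorem mainTheorem10 (P : SimplePolytope3) (𝓑 : Set (Finset (Fin P.m)))
    (h𝓑 : P.IsNestedFamily 𝓑) :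
    (∃ Γ : Finset (Fin P.m) → Set (EuclideanSpace ℝ (Fin 3)), P.IsNestedCurves 𝓑 Γ) ∧
    ∀ Γ Γ' : Finset (Fin P.m) → Set (EuclideanSpace ℝ (Fin 3)),
      P.IsNestedCurves 𝓑 Γ → P.IsNestedCurves 𝓑 Γ' → P.IsotopicInClass 𝓑 Γ Γ' :=
  ⟨h𝓑.exists_isNestedCurves, fun _ _ hΓ hΓ' => hΓ.isotopicInClass h𝓑.1 hΓ'⟩
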